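/- Graphs are finite and connected; parallel edges and self-edges are allowed. The degree of a vertex is the number of edges incident to it, and simple random walk moves at each step along an edge chosen uniformly among the edges incident to its current position. A sequence of graphs $(G_n)$ is called \emph{Gino-regular} if there is a sequence of real numbers $D_n$ such that, as $n \to \infty$, (i) the maximum and the minimum degree of a vertex of $G_n$ are $(1+o(1))D_n$; and (ii) the maximum and the minimum, over triples of distinct vertices $x, y, z$ of $G_n$, of the probability that simple random walk on $G_n$ started at $x$ hits $y$ before $z$ are $1/2 + o(1)$. For a tree $T$ with root $v$, the \emph{$r$-truncation} $T \wedge r$ is the subtree, rooted at $v$, spanned by the vertices at distance at most $r$ from $v$; it is regarded as an abstract rooted tree, that is, up to root-preserving isomorphism. Let $\mathcal P_1$ be the random infinite tree obtained from an infinite line $v_0, v_1, v_2, \dots$, rooted at $v_0$, by attaching to the vertices $v_i$ independent Galton--Watson trees with Poisson(1) offspring distribution, the $i$-th of which has root $v_i$. \textbf{Theorem.} Let $(G_n)$ be a Gino-regular sequence of graphs with $|V(G_n)| \to \infty$, let $v_n$ be a vertex of $G_n$, and let $\mathbf T_n$ be a uniformly chosen spanning tree of $G_n$, rooted at $v_n$.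 Then for every $r \ge 0$, $\mathbf T_n \wedge r$ converges in distribution to $\mathcal P_1 \wedge r$ as $n \to \infty$: for every finite rooted tree $t$ of height at most $r$, $$\mathbf P(\mathbf T_n \wedge r = t) \longrightarrow \mathbf P(\mathcal P_1 \wedge r = t).$$ Here $\mathcal P_1$ is the Poisson(1) Galton--Watson tree $U$ conditioned to survive forever, in the sense that for all such $r$ and $t$ $$\mathbf P(\mathcal P_1 \wedge r = t) = \lim_{N \to \infty} \mathbf P(U \wedge r = t \mid U \text{ survives for at least } N \text{ generations}).$$ -/

import Mathlib

open Filter Topology MeasureTheory ProbabilityTheory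
open scoped Graph

noncomputable section

namespace UST

/-! ### Rooted truncations -/

/-- The `r`-truncation of the graph `T` rooted at `v` (the subgraph spanned by the vertices at
distance at most `r` from `v`, with root `v`) is the abstract rooted graph `(t, x)`: there is a
graph isomorphism onto `t` which matches the roots. -/
def TruncationIs {V W : Type*} (T : SimpleGraph V) (v : V) (r : ℕ)
    (t : SimpleGraph W) (x : W) : Prop :=
  ∃ φ : T.induce {w | T.edist v w ≤ r} ≃g t, ((φ.symm x : {w | T.edist v w ≤ r}) : V) = v

/-! ### Finite multigraphs: degree, connectedness, simple random walk -/

section Multigraph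

variable {α β : Type*}

/-- The degree of a vertex is the number of edges incident to it
(parallel edges are counted separately, a self-edge is counted once). -/
def degree (G : Graph α β) (x : α) : ℕ := (G.incidenceSet x).ncard

/-- Any two vertices are joined by a path of edges, and there is a vertex. -/
def IsConnected (G : Graph α β) : Prop := G.toSimpleGraph.Connected

open Classical in
/-- The endpoint reached by leaving `x` along the edge `e` (`x` itself if `e` is a self-edge). -/
def otherEnd (G : Graph α β) (x : α) (e : β) : α :=
  if h : G.Inc e x then h.other else x

open Classical in
/-- One step of simple random walk: choose uniformly one of the edges incident to the current
position `x` and move to its other end. (The walk stays put if there is no incident edge.) -/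
def srwStep (G : Graph α β) (x : α) : PMF α :=
  if h : (G.incidenceSet x).Finite ∧ (G.incidenceSet x).Nonempty then
    (PMF.uniformOfFinset h.1.toFinset (h.1.toFinset_nonempty.2 h.2)).map (otherEnd G x)
  else PMF.pure x

/-- The joint law of the positions at times `0, 1, …, k` of simple random walk started at `x`. -/
def srwPath (G : Graph α β) : ℕ → α → PMF (List α)
  | 0, x => PMF.pure [x]
  | k + 1, x => (srwStep G x).bind fun y => (srwPath G k y).map fun l => x :: l

/-- The sequence of positions `l` visits `y`, and does so without having visited `z` earlier. -/
def HitsBefore (y z : α) (l : List α) : Prop :=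
  ∃ l₁ l₂ : List α, l = l₁ ++ y :: l₂ ∧ z ∉ l₁

/-- The probability that simple random walk started at `x` hits `y` before `z`: the increasing
limit over `k` of the probabilities that this has happened by time `k`. -/
def hitProb (G : Graph α β) (x y z : α) : ℝ :=
  (⨆ k : ℕ, (srwPath G k x).toOuterMeasure {l | HitsBefore y z l}).toReal

/-! ### Uniform spanning trees -/

/-- The edge set `F` is (the edge set of) a spanning tree of `G`: the subgraph with all the
vertices of `G` and the edges in `F` has no self-edges and no parallel edges, is connected and
has no cycles. -/
def IsSpanningTree (G : Graph α β) (F : Set β) : Prop :=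
  F ⊆ E(G) ∧ (G.restrict F).Simple ∧ (G.restrict F).toSimpleGraph.IsTree

/-- The subgraph of `G` with edge set `F`, on the vertex set of `G`. -/
def subgraphOf (G : Graph α β) (F : Set β) : SimpleGraph V(G) := (G.restrict F).toSimpleGraph

/-- The probability that the `r`-truncation at `v` of a uniformly chosen spanning tree of `G` is
the rooted tree `(t, x)`. -/
def ustTruncProb {W : Type*} (G : Graph α β) (v : V(G)) (r : ℕ) (t : SimpleGraph W) (x : W) : ℝ :=
  ({F : Set β | IsSpanningTree G F ∧ TruncationIs (subgraphOf G F) v r t x}.ncard : ℝ) /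
    ({F : Set β | IsSpanningTree G F}.ncard : ℝ)

end Multigraph

/-- Gino-regularity of a sequence of graphs: for some sequence `D`, all the degrees in `G n` are
`(1 + o(1)) D n`, and the probability of hitting `y` before `z` from `x` is `1/2 + o(1)`,
uniformly over distinct vertices `x, y, z` of `G n`. -/
def IsGinoRegular {α β : ℕ → Type*} (G : ∀ n, Graph (α n) (β n)) : Prop :=
  ∃ D : ℕ → ℝ,
    (∀ ε : ℝ, 0 < ε → ∀ᶠ n in atTop, ∀ x ∈ V(G n), |(degree (G n) x : ℝ) - D n| ≤ ε * D n) ∧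
    (∀ ε : ℝ, 0 < ε → ∀ᶠ n in atTop, ∀ x ∈ V(G n), ∀ y ∈ V(G n), ∀ z ∈ V(G n),
      x ≠ y → x ≠ z → y ≠ z → |hitProb (G n) x y z - 1 / 2| ≤ ε)

/-! ### The Poisson(1) Galton–Watson tree -/

/-- Given the number of children `ξ u` of every potential individual `u`, the set of individuals
that are born. An individual is a finite word: the root is the empty word, and the children of
`u` are `u ++ [k]` for `k < ξ u`. -/
def gwVertices (ξ : List ℕ → ℕ) : Set (List ℕ) :=
  {u | ∀ (w : List ℕ) (k : ℕ), w ++ [k] <+: u → k < ξ w}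

lemma nil_mem_gwVertices (ξ : List ℕ → ℕ) : [] ∈ gwVertices ξ := by
  intro w k h
  simp at h

/-- One of the two words is a child of the other. -/
def ParentChild (u w : List ℕ) : Prop := (∃ k, w = u ++ [k]) ∨ (∃ k, u = w ++ [k])

lemma ParentChild.symm {u w : List ℕ} (h : ParentChild u w) : ParentChild w u := Or.symm h

lemma not_parentChild_self (u : List ℕ) : ¬ ParentChild u u := by
  rintro (⟨k, h⟩ | ⟨k, h⟩) <;> simpa using congrArg List.length h

/-- The family tree. -/
def gwTree (ξ : List ℕ → ℕ) : SimpleGraph (gwVertices ξ) where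
  Adj u w := ParentChild u.1 w.1
  symm := ⟨fun _ _ h => h.symm⟩
  loopless := ⟨fun u h => not_parentChild_self u.1 h⟩

/-- The root of the family tree. -/
def gwRoot (ξ : List ℕ → ℕ) : gwVertices ξ := ⟨[], nil_mem_gwVertices ξ⟩

/-- The `N`-th generation is not empty. -/
def Survives (N : ℕ) (ξ : List ℕ → ℕ) : Prop := ∃ u ∈ gwVertices ξ, u.length = N

/-- All numbers of children are independent and Poisson(1). -/
def gwMeasure : Measure (List ℕ → ℕ) := Measure.infinitePi fun _ => poissonMeasure 1

instance : IsProbabilityMeasure gwMeasure := by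
  unfold gwMeasure
  infer_instance

/-- The conditional probability, given that the Poisson(1) Galton–Watson tree survives for at
least `N` generations, that its `r`-truncation at the root is `(t, x)`. -/
def gwCondTruncProb {W : Type*} (N r : ℕ) (t : SimpleGraph W) (x : W) : ℝ :=
  gwMeasure.real {ξ | Survives N ξ ∧ TruncationIs (gwTree ξ) (gwRoot ξ) r t x} /
    gwMeasure.real {ξ | Survives N ξ}

/-! ### The infinite tree `𝒫₁` -/

/-- The vertices of the tree obtained by pasting the family tree given by `ω i` onto the `i`-th
vertex of an infinite line, for every `i`. -/
def spineVertices (ω : ℕ → List ℕ → ℕ) : Set (ℕ × List ℕ) := {p | p.2 ∈ gwVertices (ω p.1)}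

/-- The tree obtained by pasting, for every `i`, the family tree given by `ω i` onto the `i`-th
vertex of an infinite line (the root of the `i`-th family tree is this vertex). -/
def spineTree (ω : ℕ → List ℕ → ℕ) : SimpleGraph (spineVertices ω) where
  Adj p q := (p.1.1 = q.1.1 ∧ ParentChild p.1.2 q.1.2) ∨
    (p.1.2 = [] ∧ q.1.2 = [] ∧ (q.1.1 = p.1.1 + 1 ∨ p.1.1 = q.1.1 + 1))
  symm := ⟨by
    rintro p q (⟨h, h'⟩ | ⟨h, h', h''⟩)
    · exact Or.inl ⟨h.symm, h'.symm⟩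
    · exact Or.inr ⟨h', h, h''.symm⟩⟩
  loopless := ⟨by
    rintro p (⟨_, h⟩ | ⟨_, _, h⟩)
    · exact not_parentChild_self _ h
    · omega⟩

/-- The root is the first vertex of the line. -/
def spineRoot (ω : ℕ → List ℕ → ℕ) : spineVertices ω := ⟨(0, []), nil_mem_gwVertices (ω 0)⟩

/-- The family trees pasted onto the line are independent Poisson(1) Galton–Watson trees. -/
def spineMeasure : Measure (ℕ → List ℕ → ℕ) := Measure.infinitePi fun _ => gwMeasure

/-- The probability that the `r`-truncation of `𝒫₁` is the rooted tree `(t, x)`. -/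
def p1TruncProb {W : Type*} (r : ℕ) (t : SimpleGraph W) (x : W) : ℝ :=
  spineMeasure.real {ω | TruncationIs (spineTree ω) (spineRoot ω) r t x}

end UST

end

/-!
A tree with root `v` is encoded by its parent map. For a finite rooted tree `t` of height at most
`r`, the truncation `T ∧ r` is isomorphic to `t` exactly when some root-preserving embedding of `t`
into `T` is saturated, that is, misses no child of a vertex of depth less than `r`; there are then
`|Aut t|` of them. Hence `P(T ∧ r = t) |Aut t|` is the expected number of saturated embeddings. Let
`k` be the number of vertices of `t` and `s` the number of those of depth less than `r`: in all
three cases this expectation is, or tends to, `e^{-s} (k - s)`.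

For the uniform spanning tree, contracting the image of an embedding of `t` turns a sum over
spanning trees into a sum over spanning forests rooted at the image. If `G` is nearly `D`-regular
and all three-point hitting probabilities are nearly `1/2`, the harmonicity of hitting probabilities
makes every vertex other than the roots belong to each of the `m` trees of a random rooted forest
with probability about `1/m`. Consequently adding a root to a forest with `m` roots multiplies the
total weight by about `(m + 1)/(m D)`, and the expected number of all embeddings of `t` tends to
`k`. Applied to `t` with `m` additional leaves, this gives the factorial moments of the number of
missed children, and by the Bonferroni inequalities the expected number of saturated embeddings
tends to `∑ m, (-1)^m s^m (k + m)/m! = e^{-s} (k - s)`.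

For `𝒫₁` and for the Galton–Watson tree, summing over the plane orderings of `t` cancels the
factorials in the Poisson weights, so that every admissible position of the spine contributes
`e^{-s}`. The spine of `𝒫₁` leaves the truncation at one of the `k - s` vertices of depth `r`, while
the Galton–Watson tree survives through at least one of `k - s` independent families, which has
asymptotically `k - s` times the survival probability of a single one.
-/

noncomputable section

namespace UST

/-! ### Parent maps -/

section ParentMap

variable {V W : Type*}

/-- The orbit of `x` under `σ` visits `a`: in the forest in which `σ` sends every vertex to its
parent, `a` is an ancestor of `x` or `x` itself. -/
def Reach (σ : V → V) (x a : V) : Prop := ∃ n, σ^[n] x = a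

/-- `σ` is the parent map of a tree with root `v`. Rooted trees on `V` are encoded by such maps, in
which the root is its own parent. -/
structure IsParentMap (σ : V → V) (v : V) : Prop where
  root : σ v = v
  reach : ∀ u, Reach σ u v

/-- The graph joining every vertex to its image under `σ`. -/
def parentGraph (σ : V → V) : SimpleGraph V := SimpleGraph.fromRel fun a b => σ a = b

/-- The distance from `u` to the root `v` of the tree with parent map `σ`. -/
def depth (σ : V → V) (v u : V) : ℕ := (parentGraph σ).dist v u

lemma parentGraph_adj {σ : V → V} {a b : V} :
    (parentGraph σ).Adj a b ↔ a ≠ b ∧ (σ a = b ∨ σ b = a) := by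
  simp [parentGraph]

lemma IsParentMap.of_lt {σ : V → V} {v : V} (height : V → ℕ) (hroot : σ v = v)
    (hlt : ∀ u, u ≠ v → height (σ u) < height u) : IsParentMap σ v := by
  refine ⟨hroot, fun u => ?_⟩
  induction hu : height u using Nat.strong_induction_on generalizing u with
  | _ n ih =>
    by_cases huv : u = v
    · exact ⟨0, huv⟩
    · obtain ⟨m, hm⟩ := ih _ (hu ▸ hlt u huv) (σ u) rfl
      exact ⟨m + 1, hm⟩

namespace IsParentMap

variable {σ : V → V} {v : V}

lemma iterate_of_le (h : IsParentMap σ v) {u : V} {m n : ℕ} (hm : σ^[m] u = v) (hmn : m ≤ n) :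
    σ^[n] u = v := by
  obtain ⟨k, rfl⟩ := Nat.exists_eq_add_of_le' hmn
  rw [Function.iterate_add_apply, hm, Function.iterate_fixed h.root]

lemma eq_root_of_iterate_eq (h : IsParentMap σ v) {u : V} {k : ℕ} (hk : 0 < k)
    (hu : σ^[k] u = u) : u = v := by
  obtain ⟨n, hn⟩ := h.reach u
  have hfixed : σ^[k * n] u = u := by
    rw [Function.iterate_mul]
    exact Function.iterate_fixed hu n
  exact hfixed.symm.trans (h.iterate_of_le hn (Nat.le_mul_of_pos_left n hk))

lemma parent_ne (h : IsParentMap σ v) {u : V} (hu : u ≠ v) : σ u ≠ u :=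
  fun e => hu (h.eq_root_of_iterate_eq one_pos e)

lemma parent_parent_ne (h : IsParentMap σ v) {u : V} (hu : u ≠ v) : σ (σ u) ≠ u :=
  fun e => hu (h.eq_root_of_iterate_eq two_pos e)

@[elab_as_elim]
lemma induction (h : IsParentMap σ v) {P : V → Prop} (root : P v)
    (parent : ∀ u, u ≠ v → P (σ u) → P u) (u : V) : P u := by
  obtain ⟨n, hn⟩ := h.reach u
  induction n generalizing u with
  | zero => exact (show u = v from hn) ▸ root
  | succ n ih =>
    by_cases hu : u = v
    · exact hu ▸ root
    · exact parent u hu (ih _ hn)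

lemma adj_parent (h : IsParentMap σ v) {u : V} (hu : u ≠ v) : (parentGraph σ).Adj u (σ u) :=
  parentGraph_adj.2 ⟨(h.parent_ne hu).symm, Or.inl rfl⟩

lemma connected (h : IsParentMap σ v) : (parentGraph σ).Connected := by
  have reachable_root : ∀ u, (parentGraph σ).Reachable u v :=
    h.induction (SimpleGraph.Reachable.refl _) fun u hu ih => (h.adj_parent hu).reachable.trans ih
  have : Nonempty V := ⟨v⟩
  exact ⟨fun a b => (reachable_root a).trans (reachable_root b).symm⟩

lemma eq_of_parentGraph_le {τ : V → V} (hτ : IsParentMap τ v) (hσ : IsParentMap σ v)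
    (hle : parentGraph τ ≤ parentGraph σ) : τ = σ := by
  refine funext (hτ.induction (hτ.root.trans hσ.root.symm) fun u hu ih => ?_)
  rcases (parentGraph_adj.1 (hle (hτ.adj_parent hu))).2 with hup | hdown
  · exact hup.symm
  · exact absurd (ih.trans hdown) (hτ.parent_parent_ne hu)

lemma eq_of_parentGraph_eq {τ : V → V} (hτ : IsParentMap τ v) (hσ : IsParentMap σ v)
    (h : parentGraph τ = parentGraph σ) : τ = σ :=
  hτ.eq_of_parentGraph_le hσ h.le

lemma iterate_eq_root_of_walk (h : IsParentMap σ v) {a b : V} (q : (parentGraph σ).Walk a b)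
    {n : ℕ} (ha : σ^[n] a = v) : σ^[n + q.length] b = v := by
  induction q generalizing n with
  | nil => exact ha
  | @cons a b _ hab q ih =>
    have hb : σ^[n + 1] b = v := by
      rcases (parentGraph_adj.1 hab).2 with rfl | rfl
      · rw [← Function.iterate_succ_apply]
        exact h.iterate_of_le ha (by omega)
      · exact ha
    rw [SimpleGraph.Walk.length_cons, ← Nat.add_assoc, Nat.add_right_comm]
    exact ih hb

lemma depth_le_iff (h : IsParentMap σ v) {u : V} {n : ℕ} : depth σ v u ≤ n ↔ σ^[n] u = v := by
  refine ⟨fun hle => ?_, fun hn => ?_⟩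
  · obtain ⟨q, hq⟩ := h.connected.exists_walk_length_eq_dist v u
    have hiter := h.iterate_eq_root_of_walk q (n := 0) rfl
    exact h.iterate_of_le hiter (by rwa [zero_add, hq])
  · induction n generalizing u with
    | zero => exact (show u = v from hn) ▸ (SimpleGraph.dist_self).le
    | succ n ih =>
      by_cases hu : u = v
      · exact hu ▸ (SimpleGraph.dist_self).le.trans (Nat.zero_le _)
      · have hdist := h.connected.dist_triangle (u := v) (v := σ u) (w := u)
        rw [SimpleGraph.dist_eq_one_iff_adj.2 (h.adj_parent hu).symm] at hdist
        exact hdist.trans (Nat.succ_le_succ (ih hn))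

lemma edist_le_iff (h : IsParentMap σ v) {u : V} {n : ℕ} :
    (parentGraph σ).edist v u ≤ n ↔ σ^[n] u = v := by
  rw [← (h.connected v u).coe_dist_eq_edist, ← h.depth_le_iff, Nat.cast_le, depth]

lemma depth_eq_zero (h : IsParentMap σ v) {u : V} : depth σ v u = 0 ↔ u = v := by
  rw [← Nat.le_zero, h.depth_le_iff, Function.iterate_zero_apply]

lemma depth_root (h : IsParentMap σ v) : depth σ v v = 0 := h.depth_eq_zero.2 rfl

lemma depth_eq_succ (h : IsParentMap σ v) {u : V} (hu : u ≠ v) :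
    depth σ v u = depth σ v (σ u) + 1 := by
  have hpos : depth σ v u ≠ 0 := h.depth_eq_zero.not.2 hu
  have hle : depth σ v u ≤ depth σ v (σ u) + 1 := h.depth_le_iff.2 <| by
    rw [Function.iterate_succ_apply]
    exact h.depth_le_iff.1 le_rfl
  have hge : depth σ v (σ u) ≤ depth σ v u - 1 := by
    rw [h.depth_le_iff, ← Function.iterate_succ_apply, Nat.succ_eq_add_one,
      Nat.sub_add_cancel (Nat.pos_of_ne_zero hpos)]
    exact h.depth_le_iff.1 le_rfl
  omega

end IsParentMap

lemma exists_isParentMap_of_connected {T : SimpleGraph V} (hT : T.Connected) (v : V) :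
    ∃ σ : V → V, IsParentMap σ v ∧ ∀ u, u ≠ v → T.Adj u (σ u) := by
  classical
  have exists_closer : ∀ u, u ≠ v → ∃ w, T.Adj u w ∧ T.dist w v < T.dist u v := by
    intro u hu
    obtain ⟨q, hq⟩ := hT.exists_walk_length_eq_dist u v
    cases q with
    | nil => exact absurd rfl hu
    | cons hadj q =>
      exact ⟨_, hadj, hq ▸ Nat.lt_succ_of_le (SimpleGraph.dist_le q)⟩
  choose g hadj hlt using exists_closer
  refine ⟨fun u => if hu : u = v then v else g u hu,
    IsParentMap.of_lt (T.dist · v) (dif_pos rfl) fun u hu => ?_, fun u hu => ?_⟩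
  · rw [dif_neg hu]
    exact hlt u hu
  · simpa only [dif_neg hu] using hadj u hu

lemma parentGraph_le {σ : V → V} {v : V} {T : SimpleGraph V} (hroot : σ v = v)
    (hadj : ∀ u, u ≠ v → T.Adj u (σ u)) : parentGraph σ ≤ T := by
  intro a b hab
  obtain ⟨hne, rfl | rfl⟩ := parentGraph_adj.1 hab
  · exact hadj a fun e => hne (by rw [e, hroot])
  · exact (hadj b fun e => hne (by rw [e, hroot])).symm

lemma IsParentMap.isTree {σ : V → V} {v : V} (h : IsParentMap σ v) : (parentGraph σ).IsTree := by
  refine SimpleGraph.isTree_iff_minimal_connected.2 ⟨h.connected, fun T hT hle => ?_⟩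
  obtain ⟨τ, hτ, hadj⟩ := exists_isParentMap_of_connected hT v
  have hτT : parentGraph τ ≤ T := parentGraph_le hτ.root hadj
  exact hτ.eq_of_parentGraph_le h (hτT.trans hle) ▸ hτT

lemma exists_eq_parentGraph {T : SimpleGraph V} (hT : T.IsTree) (v : V) :
    ∃ σ : V → V, IsParentMap σ v ∧ T = parentGraph σ := by
  obtain ⟨σ, hσ, hadj⟩ := exists_isParentMap_of_connected hT.1 v
  have hle := parentGraph_le hσ.root hadj
  exact ⟨σ, hσ, ((SimpleGraph.isTree_iff_minimal_connected.1 hT).2 hσ.connected hle).antisymm hle⟩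

/-! ### Truncations and embeddings -/

/-- `f` embeds the tree with parent map `p` and root `x` into the tree with parent map `σ` and root
`v`, root to root. -/
structure IsTreeEmbedding (p : W → W) (x : W) (σ : V → V) (v : V) (f : W → V) : Prop where
  inj : Function.Injective f
  map_root : f x = v
  map_parent : Function.Semiconj f p σ

/-- An embedding of rooted trees is saturated at `I` if it misses no child of a vertex of `f '' I`.
The `r`-truncation of a tree is `t` if and only if `t` has an embedding into it which is saturated
at the vertices of depth less than `r`. -/
structure IsSaturatedEmbedding (p : W → W) (x : W) (I : Set W) (σ : V → V) (v : V)
    (f : W → V) : Prop extends IsTreeEmbedding p x σ v f where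
  mem_range : ∀ u, σ u ∈ f '' I → u ∈ Set.range f

/-- The number of automorphisms of a rooted graph. -/
def autCard (t : SimpleGraph W) (x : W) : ℕ := Nat.card {g : t ≃g t // g x = x}

lemma autCard_pos [Finite W] (t : SimpleGraph W) (x : W) : 0 < autCard t x := by
  have : Finite (t ≃g t) :=
    Finite.of_injective (fun g : t ≃g t => (g : W → W)) DFunLike.coe_injective
  have : Nonempty {g : t ≃g t // g x = x} := ⟨⟨SimpleGraph.Iso.refl, rfl⟩⟩
  exact Nat.card_pos

variable {p : W → W} {x : W} {σ : V → V} {v : V} {r : ℕ} {f : W → V}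

lemma IsTreeEmbedding.adj_iff (hf : IsTreeEmbedding p x σ v f) (a b : W) :
    (parentGraph σ).Adj (f a) (f b) ↔ (parentGraph p).Adj a b := by
  simp only [parentGraph_adj, ← hf.map_parent.eq, hf.inj.ne_iff, hf.inj.eq_iff]

lemma IsTreeEmbedding.iterate_eq_root_iff (hf : IsTreeEmbedding p x σ v f) {w : W} {n : ℕ} :
    σ^[n] (f w) = v ↔ p^[n] w = x := by
  rw [← (hf.map_parent.iterate_right n).eq, ← hf.map_root, hf.inj.eq_iff]

lemma IsTreeEmbedding.of_hom (hp : IsParentMap p x) (hσ : IsParentMap σ v)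
    (hinj : Function.Injective f) (hfx : f x = v)
    (hadj : ∀ a b, (parentGraph p).Adj a b → (parentGraph σ).Adj (f a) (f b)) :
    IsTreeEmbedding p x σ v f := by
  refine ⟨hinj, hfx, hp.induction ?_ fun w hw ih => ?_⟩
  · rw [hp.root, hfx, hσ.root]
  · rcases (parentGraph_adj.1 (hadj w (p w) (hp.adj_parent hw))).2 with hup | hdown
    · exact hup.symm
    · exact absurd (hinj (ih.trans hdown)) (hp.parent_parent_ne hw)

lemma IsSaturatedEmbedding.range_eq (hp : IsParentMap p x) (hr : ∀ w, depth p x w ≤ r)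
    (hf : IsSaturatedEmbedding p x {w | depth p x w < r} σ v f) :
    Set.range f = {u | σ^[r] u = v} := by
  have mem_range_of_iterate : ∀ n ≤ r, ∀ u, σ^[n] u = v → u ∈ Set.range f := by
    intro n
    induction n with
    | zero => exact fun _ u hu => ⟨x, hf.map_root.trans (show u = v from hu).symm⟩
    | succ n ih =>
      intro hn u hu
      obtain ⟨w, hw⟩ := ih (by omega) (σ u) hu
      have hiter : p^[n] w = x := hf.iterate_eq_root_iff.1 (by rw [hw]; exact hu)
      exact hf.mem_range u ⟨w, (hp.depth_le_iff.2 hiter).trans_lt hn, hw⟩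
  refine Set.Subset.antisymm ?_ (mem_range_of_iterate r le_rfl)
  rintro _ ⟨w, rfl⟩
  exact hf.iterate_eq_root_iff.2 (hp.depth_le_iff.1 (hr w))

lemma isSaturatedEmbedding_of_iso (hp : IsParentMap p x) (hσ : IsParentMap σ v)
    (ψ : parentGraph p ≃g (parentGraph σ).induce {w | (parentGraph σ).edist v w ≤ r})
    (hψ : (ψ x : V) = v) :
    IsSaturatedEmbedding p x {w | depth p x w < r} σ v fun w => (ψ w : V) := by
  have hemb : IsTreeEmbedding p x σ v fun w => (ψ w : V) :=
    .of_hom hp hσ (Subtype.val_injective.comp ψ.injective) hψ fun _ _ => ψ.map_adj_iff.2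
  refine ⟨hemb, fun u hu => ?_⟩
  obtain ⟨w, hw : depth p x w < r, hwu⟩ := hu
  have hu : σ^[depth p x w + 1] u = v := by
    rw [Function.iterate_succ_apply, ← hwu]
    exact hemb.iterate_eq_root_iff.2 (hp.depth_le_iff.1 le_rfl)
  have hmem : (parentGraph σ).edist v u ≤ r := hσ.edist_le_iff.2 (hσ.iterate_of_le hu hw)
  exact ⟨ψ.symm ⟨u, hmem⟩, by simp⟩

/-- Isomorphisms onto the `r`-truncation are the same as embeddings saturated below depth `r`. -/
def saturatedEmbeddingEquivIso (hp : IsParentMap p x) (hσ : IsParentMap σ v)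
    (hr : ∀ w, depth p x w ≤ r) :
    {f : W → V // IsSaturatedEmbedding p x {w | depth p x w < r} σ v f} ≃
      {ψ : parentGraph p ≃g (parentGraph σ).induce {w | (parentGraph σ).edist v w ≤ r} //
        (ψ x : V) = v} where
  toFun f :=
    have hrange : Set.range f.1 = {w | (parentGraph σ).edist v w ≤ r} :=
      (f.2.range_eq hp hr).trans (Set.ext fun _ => hσ.edist_le_iff.symm)
    ⟨⟨(Equiv.ofInjective f.1 f.2.inj).trans (Equiv.setCongr hrange),
      fun {a b} => f.2.adj_iff a b⟩, f.2.map_root⟩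
  invFun ψ := ⟨fun w => ψ.1 w, isSaturatedEmbedding_of_iso hp hσ ψ.1 ψ.2⟩
  left_inv _ := rfl
  right_inv _ := by
    ext
    rfl

open Classical in
lemma card_isSaturatedEmbedding (hp : IsParentMap p x) (hσ : IsParentMap σ v)
    (hr : ∀ w, depth p x w ≤ r) :
    Nat.card {f : W → V // IsSaturatedEmbedding p x {w | depth p x w < r} σ v f} =
      if TruncationIs (parentGraph σ) v r (parentGraph p) x then autCard (parentGraph p) x
      else 0 := by
  rw [Nat.card_congr (saturatedEmbeddingEquivIso hp hσ hr)]
  split_ifs with h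
  · obtain ⟨φ, hφ⟩ := h
    refine Nat.card_congr ⟨fun ψ => ⟨ψ.1.trans φ, ?_⟩, fun g => ⟨g.1.trans φ.symm, ?_⟩,
      fun ψ => ?_, fun g => ?_⟩
    · have hψ : ψ.1 x = φ.symm x := Subtype.ext (ψ.2.trans hφ.symm)
      simp [hψ]
    · simp [g.2, hφ]
    · ext
      simp
    · ext
      simp
  · have : IsEmpty {ψ : parentGraph p ≃g (parentGraph σ).induce
        {w | (parentGraph σ).edist v w ≤ r} // (ψ x : V) = v} :=
      ⟨fun ψ => h ⟨ψ.1.symm, ψ.2⟩⟩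
    exact Nat.card_of_isEmpty

end ParentMap

/-! ### Rooted spanning forests -/

section Forest

variable {V : Type*}

lemma Reach.refl (σ : V → V) (x : V) : Reach σ x x := ⟨0, rfl⟩

lemma Reach.trans {σ : V → V} {x y z : V} (hxy : Reach σ x y) (hyz : Reach σ y z) :
    Reach σ x z := by
  obtain ⟨m, rfl⟩ := hxy
  obtain ⟨n, rfl⟩ := hyz
  exact ⟨n + m, Function.iterate_add_apply _ _ _ _⟩

lemma Reach.of_fixed {σ : V → V} {x y b : V} (hb : σ b = b) (hxy : Reach σ x y)
    (hxb : Reach σ x b) : Reach σ y b := by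
  obtain ⟨m, rfl⟩ := hxy
  obtain ⟨n, hn⟩ := hxb
  refine ⟨n, ?_⟩
  rw [← Function.iterate_add_apply, add_comm, Function.iterate_add_apply, hn,
    Function.iterate_fixed hb]

lemma Reach.eq_of_fixed {σ : V → V} {x b : V} (hb : σ b = b) (h : Reach σ b x) : x = b := by
  obtain ⟨n, rfl⟩ := h
  exact Function.iterate_fixed hb n

lemma Reach.unique {σ : V → V} {x a b : V} (ha : σ a = a) (hb : σ b = b) (hxa : Reach σ x a)
    (hxb : Reach σ x b) : a = b :=
  ((hxa.of_fixed hb hxb).eq_of_fixed ha).symm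

/-- `σ` maps every vertex outside `A` to its parent in a spanning forest with set of roots `A`. -/
structure IsForest (A : Finset V) (σ : V → V) : Prop where
  fixed : ∀ x ∈ A, σ x = x
  reach : ∀ x, ∃ a ∈ A, Reach σ x a

namespace IsForest

variable {A : Finset V} {σ : V → V}

lemma not_reach_parent (h : IsForest A σ) {z : V} (hz : z ∉ A) : ¬ Reach σ (σ z) z := by
  rintro ⟨n, hn⟩
  obtain ⟨a, ha, m, hm⟩ := h.reach z
  have hcycle : σ^[(n + 1) * m] z = z := by
    rw [Function.iterate_mul]
    exact Function.iterate_fixed (f := σ^[n + 1]) hn m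
  rw [add_one_mul, Function.iterate_add_apply, hm, Function.iterate_fixed (h.fixed a ha)] at hcycle
  exact hz (hcycle ▸ ha)

lemma not_reach_of_reach (h : IsForest A σ) {x a b : V} (ha : a ∈ A) (hb : b ∈ A) (hab : a ≠ b)
    (hxa : Reach σ x a) : ¬ Reach σ x b :=
  fun hxb => hab (hxa.unique (h.fixed a ha) (h.fixed b hb) hxb)

lemma reach_iff_eq {a x : V} (h : IsForest A σ) (hx : x ∈ A) : Reach σ x a ↔ a = x :=
  ⟨fun hxa => hxa.eq_of_fixed (h.fixed x hx), fun e => e ▸ Reach.refl _ _⟩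

lemma isParentMap {v : V} (h : IsForest {v} σ) : IsParentMap σ v :=
  ⟨h.fixed v (Finset.mem_singleton_self v), fun u => by
    obtain ⟨a, ha, hr⟩ := h.reach u
    rwa [Finset.mem_singleton.1 ha] at hr⟩

end IsForest

lemma IsParentMap.isForest {σ : V → V} {v : V} (h : IsParentMap σ v) : IsForest {v} σ :=
  ⟨fun x hx => by rw [Finset.mem_singleton.1 hx, h.root],
    fun x => ⟨v, Finset.mem_singleton_self v, h.reach x⟩⟩

lemma isForest_singleton_iff {σ : V → V} {v : V} : IsForest {v} σ ↔ IsParentMap σ v :=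
  ⟨IsForest.isParentMap, IsParentMap.isForest⟩

lemma IsParentMap.isForest_ite {σ : V → V} {v : V} (h : IsParentMap σ v) {A : Finset V}
    [DecidablePred (· ∈ A)] (hv : v ∈ A) : IsForest A fun u => if u ∈ A then u else σ u := by
  refine ⟨fun x hx => if_pos hx, h.induction ⟨v, hv, Reach.refl _ _⟩ ?_⟩
  rintro u - ⟨a, ha, hr⟩
  by_cases hu : u ∈ A
  · exact ⟨u, hu, Reach.refl _ _⟩
  · exact ⟨a, ha, Reach.trans ⟨1, if_neg hu⟩ hr⟩

section Update

variable [DecidableEq V]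

lemma iterate_update_of_not_reach {σ : V → V} {y z w : V} (h : ¬ Reach σ y z) (n : ℕ) :
    (Function.update σ z w)^[n] y = σ^[n] y := by
  induction n with
  | zero => rfl
  | succ n ih =>
    rw [Function.iterate_succ_apply', Function.iterate_succ_apply', ih,
      Function.update_of_ne fun e => h ⟨n, e⟩]

lemma reach_update_iff_of_not_reach {σ : V → V} {y z w u : V} (h : ¬ Reach σ y z) :
    Reach (Function.update σ z w) y u ↔ Reach σ y u := by
  simp only [Reach, iterate_update_of_not_reach h]

lemma Reach.update {σ : V → V} {y z w : V} (h : Reach σ y z) :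
    Reach (Function.update σ z w) y z := by
  obtain ⟨n, hn⟩ := h
  induction n generalizing y with
  | zero => exact ⟨0, hn⟩
  | succ n ih =>
    by_cases hy : y = z
    · exact ⟨0, hy⟩
    · refine Reach.trans ⟨1, ?_⟩ (ih hn)
      exact Function.update_of_ne hy _ _

namespace IsForest

variable {B : Finset V} {σ : V → V} {z w : V}

lemma update_self (h : IsForest B σ) : IsForest (insert z B) (Function.update σ z z) := by
  constructor
  · intro x hx
    by_cases hxz : x = z
    · rw [hxz, Function.update_self]
    · rw [Function.update_of_ne hxz]
      exact h.fixed x (Finset.mem_of_mem_insert_of_ne hx hxz)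
  · intro x
    by_cases hx : Reach σ x z
    · exact ⟨z, Finset.mem_insert_self _ _, hx.update⟩
    · obtain ⟨a, ha, hr⟩ := h.reach x
      exact ⟨a, Finset.mem_insert_of_mem ha, (reach_update_iff_of_not_reach hx).2 hr⟩

lemma not_reach_update_self (h : IsForest B σ) (hz : z ∉ B) :
    ¬ Reach (Function.update σ z z) (σ z) z := by
  rw [reach_update_iff_of_not_reach (h.not_reach_parent hz)]
  exact h.not_reach_parent hz

lemma reach_update_iff_of_reach (h : IsForest (insert z B) σ) (hz : z ∉ B) (hw : ¬ Reach σ w z)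
    {u b : V} (hb : b ∈ B) (hu : Reach σ u z) :
    Reach (Function.update σ z w) u b ↔ Reach σ w b := by
  have hb_fixed : Function.update σ z w b = b := by
    rw [Function.update_of_ne (ne_of_mem_of_not_mem hb hz), h.fixed b (Finset.mem_insert_of_mem hb)]
  have huw : Reach (Function.update σ z w) u w := hu.update.trans ⟨1, by simp⟩
  rw [← reach_update_iff_of_not_reach (w := w) hw]
  exact ⟨huw.of_fixed hb_fixed, huw.trans⟩

lemma update (h : IsForest (insert z B) σ) (hz : z ∉ B) (hw : ¬ Reach σ w z) :
    IsForest B (Function.update σ z w) := by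
  refine ⟨fun x hx => ?_, fun x => ?_⟩
  · rw [Function.update_of_ne (ne_of_mem_of_not_mem hx hz)]
    exact h.fixed x (Finset.mem_insert_of_mem hx)
  · by_cases hx : Reach σ x z
    · obtain ⟨b, hb, hwb⟩ := h.reach w
      have hbB : b ∈ B := Finset.mem_of_mem_insert_of_ne hb fun e => hw (e ▸ hwb)
      exact ⟨b, hbB, (h.reach_update_iff_of_reach hz hw hbB hx).2 hwb⟩
    · obtain ⟨a, ha, hxa⟩ := h.reach x
      exact ⟨a, Finset.mem_of_mem_insert_of_ne ha fun e => hx (e ▸ hxa),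
        (reach_update_iff_of_not_reach hx).2 hxa⟩

end IsForest

end Update

/-! ### Networks -/

/-- Symmetric conductances on `V` without self-loops, positive along the edges of some spanning
tree. -/
structure IsNetwork (c : V → V → ℝ) : Prop where
  nonneg : ∀ x y, 0 ≤ c x y
  symm : ∀ x y, c x y = c y x
  self : ∀ x, c x x = 0
  conn : ∀ v, ∃ σ, IsParentMap σ v ∧ ∀ u, u ≠ v → 0 < c u (σ u)

lemma IsNetwork.exists_forest {c : V → V → ℝ} (hc : IsNetwork c) {A : Finset V} (hA : A.Nonempty) :
    ∃ σ, IsForest A σ ∧ ∀ u, u ∉ A → 0 < c u (σ u) := by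
  classical
  obtain ⟨v, hv⟩ := hA
  obtain ⟨σ, hσ, hpos⟩ := hc.conn v
  refine ⟨_, hσ.isForest_ite hv, fun u hu => ?_⟩
  simp only [if_neg hu]
  exact hpos u (ne_of_mem_of_not_mem hv hu).symm

/-! ### The Laplacian of a network -/

lemma sum_sum_eq_zero_of_antisymm {ι : Type*} (s : Finset ι) {F : ι → ι → ℝ}
    (hF : ∀ i j, F i j = -F j i) : ∑ i ∈ s, ∑ j ∈ s, F i j = 0 := by
  have hneg : ∑ i ∈ s, ∑ j ∈ s, F i j = -∑ i ∈ s, ∑ j ∈ s, F i j := by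
    conv_lhs => rw [Finset.sum_comm]
    simp only [← Finset.sum_neg_distrib, ← hF]
  linarith

section Laplacian

variable [Fintype V] {c : V → V → ℝ}

variable (c) in
/-- The Laplacian of the network with conductances `c`. A function is harmonic at the vertices
where its Laplacian vanishes. -/
def laplacian : (V → ℝ) →ₗ[ℝ] V → ℝ where
  toFun g z := ∑ w, c z w * (g z - g w)
  map_add' f g := by
    ext z
    simp only [Pi.add_apply, ← Finset.sum_add_distrib]
    exact Finset.sum_congr rfl fun w _ => by ring
  map_smul' a g := by
    ext z
    simp only [Pi.smul_apply, smul_eq_mul, RingHom.id_apply, Finset.mul_sum]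
    exact Finset.sum_congr rfl fun w _ => by ring

lemma laplacian_apply (g : V → ℝ) (z : V) : laplacian c g z = ∑ w, c z w * (g z - g w) := rfl

lemma laplacian_const (a : ℝ) (z : V) : laplacian c (fun _ => a) z = 0 := by
  simp [laplacian_apply]

lemma IsNetwork.sum_laplacian (hc : IsNetwork c) (g : V → ℝ) : ∑ z, laplacian c g z = 0 :=
  sum_sum_eq_zero_of_antisymm _ fun u w => by
    rw [hc.symm u w]
    ring

lemma IsNetwork.le_of_laplacian_nonpos (hc : IsNetwork c) {A : Finset V} (hA : A.Nonempty)
    {g : V → ℝ} (hg : ∀ z, z ∉ A → laplacian c g z ≤ 0) {ε : ℝ} (hε : ∀ a ∈ A, g a ≤ ε) (x : V) :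
    g x ≤ ε := by
  obtain ⟨σ, hσ, hpos⟩ := hc.exists_forest hA
  obtain ⟨m, -, hm⟩ := Finset.exists_max_image Finset.univ g ⟨x, Finset.mem_univ x⟩
  have maximal_parent : ∀ u, g u = g m → g (σ u) = g m := by
    intro u hu
    by_cases huA : u ∈ A
    · rw [hσ.fixed u huA, hu]
    · have hnonneg : ∀ w ∈ Finset.univ, 0 ≤ c u w * (g u - g w) := fun w hw =>
        mul_nonneg (hc.nonneg u w) (sub_nonneg.2 (hu ▸ hm w hw))
      have hzero := (Finset.sum_eq_zero_iff_of_nonneg hnonneg).1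
        ((hg u huA).antisymm (Finset.sum_nonneg hnonneg)) (σ u) (Finset.mem_univ _)
      have hdiff := (mul_eq_zero.1 hzero).resolve_left (hpos u huA).ne'
      linarith
  have maximal_iterate : ∀ n, g (σ^[n] m) = g m := by
    intro n
    induction n with
    | zero => rfl
    | succ n ih => rw [Function.iterate_succ_apply']; exact maximal_parent _ ih
  obtain ⟨a, ha, n, rfl⟩ := hσ.reach m
  exact (hm x (Finset.mem_univ x)).trans (maximal_iterate n ▸ hε _ ha)

lemma IsNetwork.abs_le_of_laplacian_eq_zero (hc : IsNetwork c) {A : Finset V} (hA : A.Nonempty)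
    {g : V → ℝ} (hg : ∀ z, z ∉ A → laplacian c g z = 0) {ε : ℝ} (hε : ∀ a ∈ A, |g a| ≤ ε)
    (x : V) : |g x| ≤ ε := by
  refine abs_le'.2 ⟨hc.le_of_laplacian_nonpos hA (fun z hz => (hg z hz).le)
    (fun a ha => (le_abs_self _).trans (hε a ha)) x,
    hc.le_of_laplacian_nonpos (g := -g) hA (fun z hz => ?_)
      (fun a ha => (neg_le_abs _).trans (hε a ha)) x⟩
  rw [map_neg, Pi.neg_apply, hg z hz, neg_zero]

end Laplacian

/-! ### The weights of the forests of a network -/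

variable [Fintype V] [DecidableEq V] (c : V → V → ℝ)

open Classical in
/-- The spanning forests with set of roots `A`. -/
def forests (A : Finset V) : Finset (V → V) := {σ | IsForest A σ}

lemma mem_forests {A : Finset V} {σ : V → V} : σ ∈ forests A ↔ IsForest A σ := by
  simp [forests]

/-- The weight of a spanning forest with set of roots `A`: the product of the conductances of its
edges. -/
def forestWeight (A : Finset V) (σ : V → V) : ℝ := ∏ x ∈ Aᶜ, c x (σ x)

/-- The total weight of the spanning forests with set of roots `A`. -/
def forestSum (A : Finset V) : ℝ := ∑ σ ∈ forests A, forestWeight c A σ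

open Classical in
/-- The total weight of the spanning forests with set of roots `A` in which `x` belongs to the
tree of `a`. -/
def reachSum (A : Finset V) (a x : V) : ℝ :=
  ∑ σ ∈ forests A, forestWeight c A σ * if Reach σ x a then 1 else 0

lemma forestWeight_update {B : Finset V} {z : V} (hz : z ∉ B) (σ : V → V) (w : V) :
    forestWeight c B (Function.update σ z w) = forestWeight c (insert z B) σ * c z w := by
  have hcompl : Bᶜ = insert z (insert z B)ᶜ := by
    rw [← Finset.insert_compl_insert hz]
  rw [forestWeight, forestWeight, hcompl, Finset.prod_insert (by simp), Function.update_self,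
    mul_comm]
  congr 1
  refine Finset.prod_congr rfl fun x hx => ?_
  rw [Function.update_of_ne (ne_of_mem_of_not_mem (Finset.mem_insert_self z B)
    (Finset.mem_compl.1 hx)).symm]

open Classical in
lemma sum_forests_eq_sum_insert {B : Finset V} {z : V} (hz : z ∉ B) (φ : (V → V) → ℝ) :
    ∑ σ ∈ forests B, forestWeight c B σ * φ σ =
      ∑ σ ∈ forests (insert z B), ∑ w with ¬ Reach σ w z,
        forestWeight c (insert z B) σ * c z w * φ (Function.update σ z w) := by
  rw [Finset.sum_sigma']
  refine Finset.sum_bij' (fun σ _ => ⟨Function.update σ z z, σ z⟩)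
    (fun q _ => Function.update q.1 z q.2) ?_ ?_ ?_ ?_ ?_
  · intro σ hσ
    rw [mem_forests] at hσ
    simp only [Finset.mem_sigma, mem_forests, Finset.mem_filter, Finset.mem_univ, true_and]
    exact ⟨hσ.update_self, hσ.not_reach_update_self hz⟩
  · rintro ⟨σ, w⟩ hq
    simp only [Finset.mem_sigma, mem_forests, Finset.mem_filter, Finset.mem_univ, true_and] at hq
    exact mem_forests.2 (hq.1.update hz hq.2)
  · intro σ _
    simp
  · rintro ⟨σ, w⟩ hq
    simp only [Finset.mem_sigma, mem_forests] at hq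
    have hzz : Function.update σ z z = σ := by
      rw [Function.update_eq_self_iff, hq.1.fixed z (Finset.mem_insert_self _ _)]
    simp [hzz]
  · intro σ _
    rw [← forestWeight_update c hz]
    simp only [Function.update_idem, Function.update_eq_self]

lemma sum_reachSum (A : Finset V) (x : V) : ∑ a ∈ A, reachSum c A a x = forestSum c A := by
  simp only [reachSum]
  rw [Finset.sum_comm, forestSum]
  refine Finset.sum_congr rfl fun σ hσ => ?_
  rw [mem_forests] at hσ
  obtain ⟨a, ha, hxa⟩ := hσ.reach x
  rw [← Finset.mul_sum, Finset.sum_eq_single_of_mem a ha, if_pos hxa, mul_one]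
  exact fun b hb hba => if_neg (hσ.not_reach_of_reach ha hb hba.symm hxa)

lemma reachSum_of_mem {A : Finset V} {a x : V} (hx : x ∈ A) :
    reachSum c A a x = if a = x then forestSum c A else 0 := by
  classical
  have hterm : ∀ σ ∈ forests A, (forestWeight c A σ * if Reach σ x a then (1 : ℝ) else 0) =
      if a = x then forestWeight c A σ else 0 := by
    intro σ hσ
    simp only [(mem_forests.1 hσ).reach_iff_eq hx, mul_ite, mul_one, mul_zero]
  rw [reachSum, Finset.sum_congr rfl hterm]
  split_ifs
  · rfl
  · exact Finset.sum_const_zero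

lemma forestSum_eq_sum_insert {A : Finset V} {y : V} (hy : y ∉ A) :
    forestSum c A = ∑ z, c y z * (forestSum c (insert y A) - reachSum c (insert y A) y z) := by
  have hsplit := sum_forests_eq_sum_insert c hy fun _ => 1
  simp only [mul_one] at hsplit
  rw [forestSum, hsplit]
  simp only [forestSum, reachSum, ← Finset.sum_sub_distrib, Finset.mul_sum]
  rw [Finset.sum_comm]
  refine Finset.sum_congr rfl fun σ _ => ?_
  rw [Finset.sum_filter]
  refine Finset.sum_congr rfl fun w _ => ?_
  by_cases hw : Reach σ w y
  · simp [hw]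
  · simp [hw, mul_comm]

variable {c}

lemma IsNetwork.forestWeight_nonneg (hc : IsNetwork c) (A : Finset V) (σ : V → V) :
    0 ≤ forestWeight c A σ :=
  Finset.prod_nonneg fun _ _ => hc.nonneg _ _

lemma IsNetwork.forestSum_pos (hc : IsNetwork c) {A : Finset V} (hA : A.Nonempty) :
    0 < forestSum c A := by
  obtain ⟨σ, hσ, hpos⟩ := hc.exists_forest hA
  refine Finset.sum_pos' (fun σ _ => hc.forestWeight_nonneg A σ) ⟨σ, mem_forests.2 hσ, ?_⟩
  exact Finset.prod_pos fun x hx => hpos x (Finset.mem_compl.1 hx)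

open Classical in
lemma IsForest.sum_mul_reach_update {B : Finset V} {σ : V → V} {z b : V}
    (h : IsForest (insert z B) σ) (hz : z ∉ B) (hb : b ∈ B) (k : V → ℝ) :
    ∑ w, k w * ∑ w' with ¬ Reach σ w' z,
      k w' * ((if Reach (Function.update σ z w') z b then 1 else 0) -
        if Reach (Function.update σ z w') w b then 1 else 0) = 0 := by
  set reachInd : V → ℝ := fun w => if Reach σ w b then 1 else 0
  have inner_sum : ∀ w, ∑ w' with ¬ Reach σ w' z,
      k w' * ((if Reach (Function.update σ z w') z b then 1 else 0) -
        if Reach (Function.update σ z w') w b then 1 else 0) =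
      if Reach σ w z then 0
        else ∑ w' with ¬ Reach σ w' z, k w' * (reachInd w' - reachInd w) := by
    intro w
    by_cases hw : Reach σ w z
    · rw [if_pos hw]
      refine Finset.sum_eq_zero fun w' hw' => ?_
      have hw'z : ¬ Reach σ w' z := (Finset.mem_filter.1 hw').2
      simp only [h.reach_update_iff_of_reach hz hw'z hb (Reach.refl _ _),
        h.reach_update_iff_of_reach hz hw'z hb hw, sub_self, mul_zero]
    · rw [if_neg hw]
      refine Finset.sum_congr rfl fun w' hw' => ?_
      have hw'z : ¬ Reach σ w' z := (Finset.mem_filter.1 hw').2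
      simp only [h.reach_update_iff_of_reach hz hw'z hb (Reach.refl _ _),
        reach_update_iff_of_not_reach hw, reachInd]
  have restrict_sum : ∀ F : V → ℝ, ∑ w, k w * (if Reach σ w z then 0 else F w) =
      ∑ w with ¬ Reach σ w z, k w * F w := by
    intro F
    simp only [Finset.sum_filter, ite_not, mul_ite, mul_zero]
  simp only [inner_sum, restrict_sum, Finset.mul_sum]
  exact sum_sum_eq_zero_of_antisymm _ fun w w' => by ring

lemma laplacian_reachSum {B : Finset V} {z b : V} (hz : z ∉ B) (hb : b ∈ B) :
    laplacian c (reachSum c B b) z = 0 := by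
  classical
  have hdiff : ∀ w, reachSum c B b z - reachSum c B b w =
      ∑ σ ∈ forests (insert z B), forestWeight c (insert z B) σ * ∑ w' with ¬ Reach σ w' z,
        c z w' * ((if Reach (Function.update σ z w') z b then 1 else 0) -
          if Reach (Function.update σ z w') w b then 1 else 0) := by
    intro w
    simp only [reachSum, sum_forests_eq_sum_insert c hz, ← Finset.sum_sub_distrib, ← mul_sub,
      Finset.mul_sum, mul_assoc]
  simp only [laplacian_apply, hdiff, Finset.mul_sum (forests _)]
  rw [Finset.sum_comm]
  refine Finset.sum_eq_zero fun σ hσ => ?_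
  simp only [mul_left_comm (c z _), ← Finset.mul_sum Finset.univ]
  rw [(mem_forests.1 hσ).sum_mul_reach_update hz hb, mul_zero]

/-! ### The forests extending a given tree -/

variable {S : Type*} [Fintype S] {p : S → S} {x : S} {f : S → V}

omit [Fintype V] in
lemma IsForest.isParentMap_extend (hp : IsParentMap p x) (hf : Function.Injective f) {σ : V → V}
    (hσ : IsForest (Finset.univ.image f) σ) :
    IsParentMap (Function.extend f (f ∘ p) σ) (f x) := by
  have hext : ∀ s, Function.extend f (f ∘ p) σ (f s) = f (p s) := hf.extend_apply _ _
  refine ⟨(hext x).trans (congrArg f hp.root), fun u => ?_⟩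
  have reach_of_range : ∀ s, Reach (Function.extend f (f ∘ p) σ) (f s) (f x) :=
    hp.induction (Reach.refl _ _) fun s _ ih => Reach.trans ⟨1, hext s⟩ ih
  obtain ⟨a, ha, n, hn⟩ := hσ.reach u
  induction n generalizing u with
  | zero =>
    obtain ⟨s, -, rfl⟩ := Finset.mem_image.1 ha
    rw [show u = f s from hn]
    exact reach_of_range s
  | succ n ih =>
    by_cases hu : ∃ s, f s = u
    · obtain ⟨s, rfl⟩ := hu
      exact reach_of_range s
    · exact Reach.trans ⟨1, Function.extend_apply' _ _ _ hu⟩ (ih (σ u) hn)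

variable [DecidableEq S]

lemma forestWeight_singleton_eq (hf : Function.Injective f) {σ τ : V → V}
    (hσ : Function.Semiconj f p σ) (hτ : ∀ u, u ∉ Finset.univ.image f → τ u = σ u) :
    forestWeight c {f x} σ =
      (∏ s ∈ Finset.univ.erase x, c (f s) (f (p s))) * forestWeight c (Finset.univ.image f) τ := by
  have hsubset : (Finset.univ.erase x).image f ⊆ {f x}ᶜ := by
    intro u hu
    obtain ⟨s, hs, rfl⟩ := Finset.mem_image.1 hu
    simpa [hf.eq_iff] using hs
  have hsdiff : ({f x}ᶜ : Finset V) \ (Finset.univ.erase x).image f = (Finset.univ.image f)ᶜ := by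
    ext u
    simp only [Finset.mem_sdiff, Finset.mem_compl, Finset.mem_singleton, Finset.mem_image,
      Finset.mem_erase, Finset.mem_univ, and_true, true_and]
    grind
  rw [forestWeight, ← Finset.prod_sdiff hsubset, hsdiff, mul_comm,
    Finset.prod_image fun a _ b _ hab => hf hab, forestWeight]
  congr 1
  · exact Finset.prod_congr rfl fun s _ => by rw [hσ.eq]
  · exact Finset.prod_congr rfl fun u hu => by rw [hτ u (Finset.mem_compl.1 hu)]

open Classical in
lemma sum_forestWeight_of_semiconj (hp : IsParentMap p x) (hf : Function.Injective f) :
    (∑ σ ∈ forests {f x} with Function.Semiconj f p σ, forestWeight c {f x} σ) =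
      (∏ s ∈ Finset.univ.erase x, c (f s) (f (p s))) * forestSum c (Finset.univ.image f) := by
  rw [forestSum, Finset.mul_sum]
  refine Finset.sum_bij' (fun σ _ u => if u ∈ Finset.univ.image f then u else σ u)
    (fun σ _ => Function.extend f (f ∘ p) σ) ?_ ?_ ?_ ?_ ?_
  · intro σ hσ
    simp only [Finset.mem_filter, mem_forests] at hσ ⊢
    exact hσ.1.isParentMap.isForest_ite (Finset.mem_image_of_mem f (Finset.mem_univ x))
  · intro σ hσ
    simp only [Finset.mem_filter, mem_forests] at hσ ⊢
    exact ⟨(hσ.isParentMap_extend hp hf).isForest, fun s => (hf.extend_apply (f ∘ p) σ s).symm⟩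
  · intro σ hσ
    funext u
    by_cases hu : ∃ s, f s = u
    · obtain ⟨s, rfl⟩ := hu
      rw [hf.extend_apply]
      exact (Finset.mem_filter.1 hσ).2 s
    · rw [Function.extend_apply' _ _ _ hu]
      exact if_neg fun h => hu (by simpa using h)
  · intro σ hσ
    funext u
    by_cases hu : u ∈ Finset.univ.image f
    · rw [if_pos hu, (mem_forests.1 hσ).fixed u hu]
    · rw [if_neg hu]
      exact Function.extend_apply' _ _ _ fun h => hu (by simpa using h)
  · intro σ hσ
    exact forestWeight_singleton_eq hf (Finset.mem_filter.1 hσ).2 fun u hu => if_neg hu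

end Forest

/-! ### Balanced networks -/

section Regular

variable {V : Type*} [Fintype V]

/-- The total conductance at a vertex. -/
def deg (c : V → V → ℝ) (x : V) : ℝ := ∑ y, c x y

variable {c : V → V → ℝ}

lemma IsNetwork.deg_nonneg (hc : IsNetwork c) (x : V) : 0 ≤ deg c x :=
  Finset.sum_nonneg fun y _ => hc.nonneg x y

lemma IsNetwork.deg_pos (hc : IsNetwork c) (hcard : 2 ≤ Fintype.card V) (x : V) : 0 < deg c x := by
  obtain ⟨y, hy⟩ := Fintype.exists_ne_of_one_lt_card hcard x
  obtain ⟨σ, -, hσ⟩ := hc.conn y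
  exact (hσ x hy.symm).trans_le
    (Finset.single_le_sum (fun z _ => hc.nonneg x z) (Finset.mem_univ (σ x)))

lemma IsNetwork.abs_laplacian_le (hc : IsNetwork c) {e : V → ℝ} {ε : ℝ} (he : ∀ w, |e w| ≤ ε)
    (x : V) : |laplacian c e x| ≤ (|e x| + ε) * deg c x := by
  rw [laplacian_apply, deg, Finset.mul_sum]
  refine (Finset.abs_sum_le_sum_abs _ _).trans (Finset.sum_le_sum fun w _ => ?_)
  rw [abs_mul, abs_of_nonneg (hc.nonneg x w), mul_comm]
  exact mul_le_mul_of_nonneg_right ((abs_sub _ _).trans (add_le_add_right (he w) _))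
    (hc.nonneg x w)

variable [DecidableEq V]

variable (c) in
/-- The probability that `x` belongs to the tree of `a` in a random spanning forest with set of
roots `A`, drawn with probability proportional to its weight. -/
def reachProb (A : Finset V) (a x : V) : ℝ := reachSum c A a x / forestSum c A

variable (c) in
/-- The probability that `x` belongs to the tree of `y` in a random spanning forest with roots
`y` and `z`. -/
def pairProb (y z : V) : V → ℝ := reachProb c {y, z} y

variable (c) in
/-- All three-point connection probabilities are within `ε` of one half. -/
def IsBalanced (ε : ℝ) : Prop :=
  ∀ x y z, x ≠ y → x ≠ z → y ≠ z → |pairProb c y z x - 1 / 2| ≤ ε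

/-- The function equal to `1` at `y`, to `0` at `z` and to `1 / 2` elsewhere: the limiting shape of
`pairProb c y z` in a balanced network. -/
def balancedPotential (y z : V) : V → ℝ :=
  (fun _ => 1 / 2) + (1 / 2 : ℝ) • (Pi.single y 1 - Pi.single z 1)

lemma laplacian_reachProb {B : Finset V} {z b : V} (hz : z ∉ B) (hb : b ∈ B) :
    laplacian c (reachProb c B b) z = 0 := by
  have hsmul : reachProb c B b = (forestSum c B)⁻¹ • reachSum c B b := by
    ext w
    rw [reachProb, div_eq_inv_mul, Pi.smul_apply, smul_eq_mul]
  rw [hsmul, map_smul, Pi.smul_apply, laplacian_reachSum hz hb, smul_zero]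

lemma laplacian_pairProb {y z u : V} (huy : u ≠ y) (huz : u ≠ z) :
    laplacian c (pairProb c y z) u = 0 :=
  laplacian_reachProb (by simp [huy, huz]) (by simp)

lemma IsNetwork.reachProb_of_mem (hc : IsNetwork c) {A : Finset V} {a x : V} (hx : x ∈ A) :
    reachProb c A a x = if a = x then 1 else 0 := by
  rw [reachProb, reachSum_of_mem c hx]
  split_ifs
  · exact div_self (hc.forestSum_pos ⟨x, hx⟩).ne'
  · exact zero_div _

lemma IsNetwork.sum_reachProb (hc : IsNetwork c) {A : Finset V} (hA : A.Nonempty) (x : V) :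
    ∑ a ∈ A, reachProb c A a x = 1 := by
  simp only [reachProb]
  rw [← Finset.sum_div, sum_reachSum, div_self (hc.forestSum_pos hA).ne']

lemma IsNetwork.reachProb_nonneg (hc : IsNetwork c) (A : Finset V) (a x : V) :
    0 ≤ reachProb c A a x := by
  refine div_nonneg (Finset.sum_nonneg fun σ _ => ?_)
    (Finset.sum_nonneg fun σ _ => hc.forestWeight_nonneg A σ)
  exact mul_nonneg (hc.forestWeight_nonneg A σ) (by split_ifs <;> norm_num)

lemma IsNetwork.pairProb_nonneg (hc : IsNetwork c) (y z x : V) : 0 ≤ pairProb c y z x :=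
  hc.reachProb_nonneg _ _ _

lemma IsNetwork.pairProb_left (hc : IsNetwork c) (y z : V) : pairProb c y z y = 1 := by
  rw [pairProb, hc.reachProb_of_mem (by simp), if_pos rfl]

lemma IsNetwork.pairProb_right (hc : IsNetwork c) {y z : V} (hyz : y ≠ z) :
    pairProb c y z z = 0 := by
  rw [pairProb, hc.reachProb_of_mem (by simp), if_neg hyz]

lemma IsNetwork.pairProb_add (hc : IsNetwork c) {y z : V} (hyz : y ≠ z) (x : V) :
    pairProb c y z x + pairProb c z y x = 1 := by
  have hsum := hc.sum_reachProb (A := {y, z}) ⟨y, by simp⟩ x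
  rw [Finset.sum_pair hyz] at hsum
  rwa [pairProb, pairProb, Finset.pair_comm z y]

omit [Fintype V] in
lemma balancedPotential_left {y z : V} (hyz : y ≠ z) : balancedPotential y z y = 1 := by
  norm_num [balancedPotential, hyz]

omit [Fintype V] in
lemma balancedPotential_right {y z : V} (hyz : y ≠ z) : balancedPotential y z z = 0 := by
  norm_num [balancedPotential, hyz.symm]

omit [Fintype V] in
lemma balancedPotential_of_ne {y z w : V} (hwy : w ≠ y) (hwz : w ≠ z) :
    balancedPotential y z w = 1 / 2 := by
  simp [balancedPotential, hwy, hwz]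

lemma laplacian_single (y x : V) :
    laplacian c (Pi.single y 1) x = (if x = y then deg c x else 0) - c x y := by
  simp [laplacian_apply, mul_sub, deg, Pi.single_apply]

lemma laplacian_balancedPotential (y z x : V) :
    laplacian c (balancedPotential y z) x =
      ((if x = y then deg c x else 0) - (if x = z then deg c x else 0) - c x y + c x z) / 2 := by
  simp only [balancedPotential, map_add, map_smul, map_sub, Pi.add_apply, Pi.smul_apply,
    Pi.sub_apply, laplacian_const, laplacian_single, smul_eq_mul]
  ring

namespace IsBalanced

variable {ε : ℝ}

lemma abs_pairProb_sub_le (h : IsBalanced c ε) (hc : IsNetwork c) (hε : 0 ≤ ε) {y z : V}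
    (hyz : y ≠ z) (w : V) : |(pairProb c y z - balancedPotential y z) w| ≤ ε := by
  rw [Pi.sub_apply]
  by_cases hwy : w = y
  · rwa [hwy, hc.pairProb_left, balancedPotential_left hyz, sub_self, abs_zero]
  by_cases hwz : w = z
  · rwa [hwz, hc.pairProb_right hyz, balancedPotential_right hyz, sub_self, abs_zero]
  rw [balancedPotential_of_ne hwy hwz]
  exact h w y z hwy hwz hyz

lemma abs_conductance_sub_le (h : IsBalanced c ε) (hc : IsNetwork c) (hε : 0 ≤ ε) {x y z : V}
    (hxy : x ≠ y) (hxz : x ≠ z) (hyz : y ≠ z) : |c x y - c x z| ≤ 4 * ε * deg c x := by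
  have hdev := h.abs_pairProb_sub_le hc hε hyz
  have hlap : laplacian c (pairProb c y z - balancedPotential y z) x = (c x y - c x z) / 2 := by
    rw [map_sub, Pi.sub_apply, laplacian_pairProb hxy hxz, laplacian_balancedPotential,
      if_neg hxy, if_neg hxz]
    ring
  have hbound := hc.abs_laplacian_le hdev x
  rw [hlap, abs_div, abs_two, div_le_iff₀ two_pos] at hbound
  have hslack := mul_le_mul_of_nonneg_right (hdev x) (hc.deg_nonneg x)
  linarith

lemma conductance_le (h : IsBalanced c ε) (hc : IsNetwork c) (hε : 0 ≤ ε)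
    (hcard : 2 ≤ Fintype.card V) (x y : V) :
    c x y ≤ (4 * ε + 1 / (Fintype.card V - 1)) * deg c x := by
  have hpos : (0 : ℝ) < Fintype.card V - 1 := by
    rw [sub_pos]
    exact_mod_cast hcard
  have hd := hc.deg_nonneg x
  by_cases hxy : x = y
  · rw [← hxy, hc.self]
    positivity
  have hle : ∀ z ∈ Finset.univ.erase x, c x y - 4 * ε * deg c x ≤ c x z := by
    intro z hz
    by_cases hyz : y = z
    · subst hyz
      exact sub_le_self _ (by positivity)
    · linarith [(abs_le.1 (h.abs_conductance_sub_le hc hε hxy (Finset.ne_of_mem_erase hz).symm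
        hyz)).2]
  have hsum : (Fintype.card V - 1) * (c x y - 4 * ε * deg c x) ≤ deg c x := by
    calc (Fintype.card V - 1) * (c x y - 4 * ε * deg c x)
        = ∑ _z ∈ Finset.univ.erase x, (c x y - 4 * ε * deg c x) := by
          rw [Finset.sum_const, Finset.card_erase_of_mem (Finset.mem_univ x), Finset.card_univ,
            nsmul_eq_mul, Nat.cast_sub (by omega), Nat.cast_one]
      _ ≤ ∑ z ∈ Finset.univ.erase x, c x z := Finset.sum_le_sum hle
      _ ≤ deg c x := Finset.sum_le_sum_of_subset_of_nonneg (Finset.erase_subset _ _)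
          fun z _ _ => hc.nonneg x z
  rw [add_mul, one_div_mul_eq_div]
  linarith [(le_div_iff₀' hpos).2 hsum]

lemma abs_deg_sub_le (h : IsBalanced c ε) (hc : IsNetwork c) (hε : 0 ≤ ε) (x y : V) :
    |deg c x - deg c y| ≤ 2 * ε * (deg c x + deg c y) := by
  have hdy := hc.deg_nonneg y
  by_cases hxy : x = y
  · rw [hxy, sub_self, abs_zero]
    positivity
  set e := pairProb c x y - balancedPotential x y with he
  have hflow : laplacian c (pairProb c x y) x + laplacian c (pairProb c x y) y = 0 := by
    have hsum := hc.sum_laplacian (pairProb c x y)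
    have hoff : ∀ z ∈ Finset.univ, z ∉ ({x, y} : Finset V) → laplacian c (pairProb c x y) z = 0 :=
      fun z _ hz => laplacian_reachProb hz (Finset.mem_insert_self _ _)
    rwa [← Finset.sum_subset (Finset.subset_univ _) hoff, Finset.sum_pair hxy] at hsum
  have hlap : laplacian c e x + laplacian c e y = -((deg c x - deg c y) / 2) := by
    simp only [he, map_sub, Pi.sub_apply, laplacian_balancedPotential, if_neg hxy,
      if_neg (Ne.symm hxy), if_true, hc.self, hc.symm y x]
    linarith
  have hex : |e x| = 0 := by
    rw [he, Pi.sub_apply, hc.pairProb_left, balancedPotential_left hxy, sub_self, abs_zero]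
  have hey : |e y| = 0 := by
    rw [he, Pi.sub_apply, hc.pairProb_right hxy, balancedPotential_right hxy, sub_self, abs_zero]
  have hdev := h.abs_pairProb_sub_le hc hε hxy
  have hbound := (abs_add_le (laplacian c e x) (laplacian c e y)).trans
    (add_le_add (hc.abs_laplacian_le hdev x) (hc.abs_laplacian_le hdev y))
  rw [hlap, abs_neg, abs_div, abs_two, div_le_iff₀ two_pos, hex, hey] at hbound
  linarith

lemma abs_reachProb_sub_reachProb_le (h : IsBalanced c ε) (hc : IsNetwork c) (hε : 0 ≤ ε)
    {A : Finset V} {a b x : V} (ha : a ∈ A) (hb : b ∈ A) (hx : x ∉ A) :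
    |reachProb c A a x - reachProb c A b x| ≤ 4 * ε := by
  by_cases hab : a = b
  · rw [hab, sub_self, abs_zero]
    positivity
  -- `pairProb c a b` and `(1 + reachProb c A a - reachProb c A b) / 2` are harmonic off `A` and
  -- nearly agree on `A`.
  set g : V → ℝ := pairProb c a b - (fun _ => 1 / 2) -
    (1 / 2 : ℝ) • (reachProb c A a - reachProb c A b) with hg
  have hharmonic : ∀ z, z ∉ A → laplacian c g z = 0 := by
    intro z hz
    simp only [hg, map_sub, map_smul, Pi.sub_apply, Pi.smul_apply, laplacian_const,
      laplacian_pairProb (ne_of_mem_of_not_mem ha hz).symm (ne_of_mem_of_not_mem hb hz).symm,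
      laplacian_reachProb hz ha, laplacian_reachProb hz hb, sub_zero, smul_zero]
  have hboundary : ∀ w ∈ A, |g w| ≤ ε := by
    intro w hw
    have hgw : g w = (pairProb c a b - balancedPotential a b) w := by
      simp only [hg, balancedPotential, Pi.sub_apply, Pi.add_apply, Pi.smul_apply,
        hc.reachProb_of_mem hw, Pi.single_apply, eq_comm (a := w)]
      ring
    exact hgw ▸ h.abs_pairProb_sub_le hc hε hab w
  have hgx := abs_le.1 (hc.abs_le_of_laplacian_eq_zero ⟨a, ha⟩ hharmonic hboundary x)
  have hpair := abs_le.1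
    (h x a b (ne_of_mem_of_not_mem ha hx).symm (ne_of_mem_of_not_mem hb hx).symm hab)
  simp only [hg, Pi.sub_apply, Pi.smul_apply, smul_eq_mul] at hgx
  rw [abs_le]
  constructor <;> linarith [hgx.1, hgx.2, hpair.1, hpair.2]

lemma abs_reachProb_sub_le (h : IsBalanced c ε) (hc : IsNetwork c) (hε : 0 ≤ ε) {A : Finset V}
    {a x : V} (ha : a ∈ A) (hx : x ∉ A) : |reachProb c A a x - 1 / A.card| ≤ 4 * ε := by
  have hcard : (0 : ℝ) < A.card := by exact_mod_cast Finset.card_pos.2 ⟨a, ha⟩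
  have havg : reachProb c A a x - 1 / A.card =
      (∑ b ∈ A, (reachProb c A a x - reachProb c A b x)) / A.card := by
    rw [Finset.sum_sub_distrib, hc.sum_reachProb ⟨a, ha⟩, Finset.sum_const, nsmul_eq_mul]
    field_simp
  rw [havg, abs_div, abs_of_pos hcard, div_le_iff₀ hcard]
  refine (Finset.abs_sum_le_sum_abs _ _).trans ((Finset.sum_le_sum fun b hb =>
    h.abs_reachProb_sub_reachProb_le hc hε ha hb hx).trans ?_)
  rw [Finset.sum_const, nsmul_eq_mul, mul_comm]

end IsBalanced

variable (c) in
/-- A balanced network in which all the degrees are close to `D` and all the conductances are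
small compared to `D`. -/
structure IsRegular (D ε : ℝ) : Prop where
  pos : 0 < D
  abs_deg_sub_le : ∀ x, |deg c x - D| ≤ ε * D
  conductance_le : ∀ x y, c x y ≤ ε * D
  balanced : IsBalanced c ε

lemma IsRegular.mono {D ε δ : ℝ} (h : IsRegular c D ε) (hεδ : ε ≤ δ) : IsRegular c D δ := by
  have hD := mul_le_mul_of_nonneg_right hεδ h.pos.le
  exact ⟨h.pos, fun x => (h.abs_deg_sub_le x).trans hD, fun x y => (h.conductance_le x y).trans hD,
    fun x y z hxy hxz hyz => (h.balanced x y z hxy hxz hyz).trans hεδ⟩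

lemma IsBalanced.isRegular {ε : ℝ} (h : IsBalanced c ε) (hc : IsNetwork c) (hε : 0 ≤ ε)
    (hε' : ε ≤ 1 / 6) (hcard : 2 ≤ Fintype.card V) (v : V) :
    IsRegular c (deg c v) (8 * ε + 2 / (Fintype.card V - 1)) := by
  have hcard' : (2 : ℝ) ≤ Fintype.card V := by exact_mod_cast hcard
  have hD := hc.deg_pos hcard v
  have deg_le : ∀ x, deg c x ≤ 2 * deg c v := by
    intro x
    have hdiff := (abs_le.1 (h.abs_deg_sub_le hc hε x v)).2
    nlinarith [hc.deg_nonneg x]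
  set δ : ℝ := 1 / (Fintype.card V - 1) with hδ
  have hδ0 : 0 ≤ δ := div_nonneg zero_le_one (by linarith)
  have hconst : 8 * ε + 2 / ((Fintype.card V : ℝ) - 1) = 2 * (4 * ε + δ) := by
    rw [hδ]
    ring
  rw [hconst]
  refine ⟨hD, fun x => ?_, fun x y => ?_, fun x y z hxy hxz hyz => ?_⟩
  · refine (h.abs_deg_sub_le hc hε x v).trans ?_
    nlinarith [deg_le x, mul_nonneg hδ0 hD.le, mul_nonneg hε hD.le]
  · refine (h.conductance_le hc hε hcard x y).trans ?_
    nlinarith [mul_le_mul_of_nonneg_left (deg_le x) (by positivity : 0 ≤ 4 * ε + δ)]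
  · refine (h x y z hxy hxz hyz).trans ?_
    linarith

lemma IsNetwork.forestSum_div_eq_sum (hc : IsNetwork c) {A : Finset V} {y : V} (hy : y ∉ A) :
    forestSum c A / forestSum c (insert y A) =
      ∑ z, c y z * (1 - reachProb c (insert y A) y z) := by
  have hpos := hc.forestSum_pos (Finset.insert_nonempty y A)
  rw [forestSum_eq_sum_insert c hy, Finset.sum_div]
  refine Finset.sum_congr rfl fun z _ => ?_
  rw [reachProb, mul_div_assoc, sub_div, div_self hpos.ne']

namespace IsRegular

variable {D ε : ℝ}

lemma mul_abs_reachProb_sub_le (h : IsRegular c D ε) (hc : IsNetwork c) (hε : 0 ≤ ε)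
    {A : Finset V} {y : V} (hy : y ∉ A) (z : V) :
    c y z * |1 - reachProb c (insert y A) y z - A.card / (A.card + 1)| ≤
      4 * ε * c y z + if z ∈ A then ε * D else 0 := by
  have hcz := hc.nonneg y z
  by_cases hzy : z = y
  · rw [hzy, hc.self, if_neg hy]
    simp
  have hcompl : 1 - (A.card : ℝ) / (A.card + 1) = 1 / (A.card + 1) := by
    field_simp
    ring
  rw [sub_right_comm, hcompl]
  by_cases hz : z ∈ A
  · rw [if_pos hz, hc.reachProb_of_mem (Finset.mem_insert_of_mem hz), if_neg (Ne.symm hzy),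
      sub_zero, abs_of_nonneg (by positivity)]
    have hle_one : 1 / ((A.card : ℝ) + 1) ≤ 1 := by
      rw [div_le_one (by positivity)]
      exact le_add_of_nonneg_left (Nat.cast_nonneg _)
    have hweight := mul_le_of_le_one_right hcz hle_one
    linarith [h.conductance_le y z, mul_nonneg hε hcz]
  · have hreach := h.balanced.abs_reachProb_sub_le hc hε (Finset.mem_insert_self y A)
      (x := z) (by simp [hz, hzy])
    rw [Finset.card_insert_of_notMem hy, Nat.cast_add, Nat.cast_one, abs_sub_comm] at hreach
    rw [if_neg hz, add_zero, mul_comm]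
    exact mul_le_mul_of_nonneg_right hreach hcz

lemma abs_forestSum_div_sub_deg_mul_le (h : IsRegular c D ε) (hc : IsNetwork c) (hε : 0 ≤ ε)
    {A : Finset V} {y : V} (hy : y ∉ A) :
    |forestSum c A / forestSum c (insert y A) - deg c y * (A.card / (A.card + 1))| ≤
      4 * ε * deg c y + A.card * (ε * D) := by
  rw [hc.forestSum_div_eq_sum hy, deg, Finset.sum_mul, ← Finset.sum_sub_distrib]
  simp only [← mul_sub]
  refine (Finset.abs_sum_le_sum_abs _ _).trans ?_
  simp only [abs_mul, abs_of_nonneg (hc.nonneg y _)]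
  refine (Finset.sum_le_sum fun z _ => h.mul_abs_reachProb_sub_le hc hε hy z).trans ?_
  rw [Finset.sum_add_distrib, ← Finset.mul_sum, ← Finset.sum_filter, Finset.sum_const,
    Finset.filter_mem_eq_inter, Finset.univ_inter, nsmul_eq_mul]

lemma abs_forestSum_div_sub_le (h : IsRegular c D ε) (hc : IsNetwork c) (hε : 0 ≤ ε)
    (hε' : ε ≤ 1) {A : Finset V} {y : V} (hy : y ∉ A) :
    |forestSum c A / (D * forestSum c (insert y A)) - A.card / (A.card + 1)| ≤
      (A.card + 9) * ε := by
  have hD := h.pos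
  set q : ℝ := A.card / (A.card + 1)
  have hq0 : 0 ≤ q := by positivity
  have hq1 : q ≤ 1 := (div_le_one (by positivity)).2 (by linarith)
  have hsplit : forestSum c A / (D * forestSum c (insert y A)) - q =
      (forestSum c A / forestSum c (insert y A) - deg c y * q + (deg c y - D) * q) / D := by
    field_simp
    ring
  have hdeg : |(deg c y - D) * q| ≤ ε * D := by
    rw [abs_mul, abs_of_nonneg hq0]
    exact (mul_le_of_le_one_right (abs_nonneg _) hq1).trans (h.abs_deg_sub_le y)
  have hdeg_le : deg c y ≤ 2 * D := by nlinarith [(abs_le.1 (h.abs_deg_sub_le y)).2]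
  rw [hsplit, abs_div, abs_of_pos hD, div_le_iff₀ hD]
  refine (abs_add_le _ _).trans
    ((add_le_add (h.abs_forestSum_div_sub_deg_mul_le hc hε hy) hdeg).trans ?_)
  nlinarith [mul_le_mul_of_nonneg_left hdeg_le hε]

end IsRegular

end Regular

/-! ### Weighted embeddings of a fixed tree -/

section Embeddings

variable {S : Type*} {p : S → S} {x s₀ : S}

lemma IsParentMap.exists_notMem_range [Finite S] [Nontrivial S] (hp : IsParentMap p x) :
    ∃ s, s ∉ Set.range p := by
  by_contra! hsurj
  have hinj : Function.Injective p := Finite.injective_iff_surjective.2 hsurj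
  obtain ⟨s, hs⟩ := exists_ne x
  obtain ⟨n, hn⟩ := hp.reach s
  exact hs (hinj.iterate n (hn.trans (Function.iterate_fixed hp.root n).symm))

/-- The parent map of a tree from which the leaf `s₀` has been removed. -/
def removeLeaf (hs : s₀ ∉ Set.range p) (s : {s // s ≠ s₀}) : {s // s ≠ s₀} :=
  ⟨p s, fun e => hs ⟨s, e⟩⟩

lemma IsParentMap.removeLeaf (hp : IsParentMap p x) (hs : s₀ ∉ Set.range p) (hx : x ≠ s₀) :
    IsParentMap (removeLeaf hs) ⟨x, hx⟩ := by
  refine ⟨Subtype.ext hp.root, fun u => ?_⟩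
  obtain ⟨n, hn⟩ := hp.reach u
  have hval : Function.Semiconj Subtype.val (UST.removeLeaf hs) p := fun _ => rfl
  exact ⟨n, Subtype.ext ((hval.iterate_right n u).trans hn)⟩

lemma injective_funSplitAt_symm_iff {V : Type*} [DecidableEq S] {y : V}
    {f : {s // s ≠ s₀} → V} :
    Function.Injective ((Equiv.funSplitAt s₀ V).symm (y, f)) ↔
      Function.Injective f ∧ ∀ s, f s ≠ y := by
  set g := (Equiv.funSplitAt s₀ V).symm (y, f)
  have hleaf : g s₀ = y := by simp [g]
  have hrest : ∀ s : {s // s ≠ s₀}, g s = f s := fun s => by simp [g, s.2]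
  constructor
  · refine fun hg => ⟨fun a b hab => Subtype.ext (hg ?_), fun s hs => s.2 (hg ?_)⟩
    · rw [hrest, hrest, hab]
    · rw [hrest, hleaf, hs]
  · rintro ⟨hf, hy⟩ a b hab
    by_cases ha : a = s₀ <;> by_cases hb : b = s₀
    · rw [ha, hb]
    · rw [ha, hleaf, hrest ⟨b, hb⟩] at hab
      exact absurd hab.symm (hy _)
    · rw [hb, hleaf, hrest ⟨a, ha⟩] at hab
      exact absurd hab (hy _)
    · rw [hrest ⟨a, ha⟩, hrest ⟨b, hb⟩] at hab
      exact congrArg Subtype.val (hf hab)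

variable [Fintype S] [DecidableEq S]

lemma prod_erase_funSplitAt_symm {V : Type*} (c : V → V → ℝ) (hs : s₀ ∉ Set.range p)
    (hx : x ≠ s₀) (y : V) (f : {s // s ≠ s₀} → V) :
    ∏ s ∈ Finset.univ.erase x, c ((Equiv.funSplitAt s₀ V).symm (y, f) s)
        ((Equiv.funSplitAt s₀ V).symm (y, f) (p s)) =
      (∏ s ∈ Finset.univ.erase ⟨x, hx⟩, c (f s) (f (removeLeaf hs s))) *
        c y (f ⟨p s₀, fun e => hs ⟨s₀, e⟩⟩) := by
  set g := (Equiv.funSplitAt s₀ V).symm (y, f)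
  have hleaf : g s₀ = y := by simp [g]
  have hrest : ∀ s : {s // s ≠ s₀}, g s = f s := fun s => by simp [g, s.2]
  have herase : Finset.univ.erase x = insert s₀
      ((Finset.univ.erase (⟨x, hx⟩ : {s // s ≠ s₀})).map (Function.Embedding.subtype _)) := by
    ext s
    by_cases h : s = s₀ <;> simp [h, hx.symm]
  rw [herase, Finset.prod_insert (by simp), Finset.prod_map, mul_comm, hleaf,
    hrest ⟨p s₀, fun e => hs ⟨s₀, e⟩⟩]
  congr 1
  refine Finset.prod_congr rfl fun s _ => ?_
  rw [Function.Embedding.subtype_apply, hrest, ← hrest (removeLeaf hs s)]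
  rfl

variable {V : Type*} [Fintype V] {c : V → V → ℝ}

open Classical in
/-- The sum of `F` over the embeddings of a rooted tree which map the root to `v`, weighted by the
conductances. -/
def embeddingSum (c : V → V → ℝ) (p : S → S) (x : S) (v : V) (F : (S → V) → ℝ) : ℝ :=
  ∑ f : S → V with Function.Injective f ∧ f x = v,
    (∏ s ∈ Finset.univ.erase x, c (f s) (f (p s))) * F f

/-- The total weight of the embeddings of a rooted tree which map the root to `v`. -/
def embeddingWeight (c : V → V → ℝ) (p : S → S) (x : S) (v : V) : ℝ :=
  embeddingSum c p x v fun _ => 1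

/-- The expected number of embeddings of a rooted tree into the random spanning tree, with the
root mapped to `v`. -/
def expectedEmbeddings [DecidableEq V] (c : V → V → ℝ) (p : S → S) (x : S) (v : V) :
    ℝ :=
  embeddingSum c p x v fun f => forestSum c (Finset.univ.image f) / forestSum c {v}

lemma IsNetwork.embeddingSum_mono (hc : IsNetwork c) {v : V} {F F' : (S → V) → ℝ}
    (h : ∀ f, Function.Injective f → f x = v → F f ≤ F' f) :
    embeddingSum c p x v F ≤ embeddingSum c p x v F' := by
  classical
  refine Finset.sum_le_sum fun f hf => ?_
  obtain ⟨hinj, hroot⟩ := (Finset.mem_filter.1 hf).2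
  exact mul_le_mul_of_nonneg_left (h f hinj hroot) (Finset.prod_nonneg fun s _ => hc.nonneg _ _)

lemma embeddingSum_const (v : V) (a : ℝ) :
    (embeddingSum c p x v fun _ => a) = a * embeddingWeight c p x v := by
  rw [embeddingWeight, embeddingSum, embeddingSum, Finset.mul_sum]
  exact Finset.sum_congr rfl fun f _ => by ring

lemma embeddingSum_sub (v : V) (F F' : (S → V) → ℝ) :
    (embeddingSum c p x v fun f => F f - F' f) =
      embeddingSum c p x v F - embeddingSum c p x v F' := by
  simp only [embeddingSum, mul_sub, Finset.sum_sub_distrib]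

lemma embeddingWeight_eq_of_subsingleton [Subsingleton S] (v : V) :
    embeddingWeight c p x v = 1 := by
  classical
  have herase : (Finset.univ.erase x : Finset S) = ∅ :=
    Finset.eq_empty_of_forall_notMem fun s hs => Finset.ne_of_mem_erase hs (Subsingleton.elim s x)
  rw [embeddingWeight, embeddingSum, herase, Finset.sum_eq_single_of_mem fun _ => v,
    Finset.prod_empty, mul_one]
  · exact (Finset.mem_filter_univ _).2 ⟨Function.injective_of_subsingleton _, rfl⟩
  · intro f hf hne
    refine absurd (funext fun s => ?_) hne
    exact (congrArg f (Subsingleton.elim s x)).trans ((Finset.mem_filter_univ _).1 hf).2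

lemma embeddingWeight_eq_embeddingSum_removeLeaf [DecidableEq V] (v : V)
    (hs : s₀ ∉ Set.range p) (hx : x ≠ s₀) :
    embeddingWeight c p x v = embeddingSum c (removeLeaf hs) ⟨x, hx⟩ v
      fun f => ∑ y ∈ (Finset.univ.image f)ᶜ, c y (f ⟨p s₀, fun e => hs ⟨s₀, e⟩⟩) := by
  classical
  have hroot : ∀ y f, (Equiv.funSplitAt s₀ V).symm (y, f) x = f ⟨x, hx⟩ :=
    fun y f => by simp [hx]
  rw [embeddingWeight, embeddingSum, embeddingSum, Finset.sum_filter, Finset.sum_filter,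
    ← (Equiv.funSplitAt s₀ V).symm.sum_comp, Fintype.sum_prod_type_right]
  refine Finset.sum_congr rfl fun f _ => ?_
  have hcompl : (Finset.univ.image f)ᶜ = ({y | ∀ s, f s ≠ y} : Finset V) := by ext; simp
  simp only [injective_funSplitAt_symm_iff, hroot, prod_erase_funSplitAt_symm c hs hx, mul_one]
  split_ifs with hf
  · rw [hcompl, Finset.sum_filter, Finset.mul_sum]
    refine Finset.sum_congr rfl fun y _ => ?_
    rw [mul_ite, mul_zero]
    exact if_congr ⟨fun h => h.1.2, fun h => ⟨⟨hf.1, h⟩, hf.2⟩⟩ rfl rfl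
  · exact Finset.sum_eq_zero fun y _ => if_neg fun h => hf ⟨h.1.1, h.2⟩

lemma IsNetwork.embeddingWeight_mem_Icc [DecidableEq V] (hc : IsNetwork c) {lo hi : ℝ}
    (hlo : 0 ≤ lo) (hhi : 0 ≤ hi) {K : ℕ}
    (hout : ∀ z, ∀ R : Finset V, R.card ≤ K → lo ≤ ∑ y ∈ Rᶜ, c y z)
    (hdeg : ∀ z, deg c z ≤ hi) (v : V) (hp : IsParentMap p x) {k : ℕ} (hk : k ≤ K)
    (hS : Fintype.card S = k + 1) :
    embeddingWeight c p x v ∈ Set.Icc (lo ^ k) (hi ^ k) := by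
  induction k generalizing S with
  | zero =>
    have : Subsingleton S := Fintype.card_le_one_iff_subsingleton.1 hS.le
    rw [embeddingWeight_eq_of_subsingleton]
    simp
  | succ k ih =>
    have : Nontrivial S := Fintype.one_lt_card_iff_nontrivial.1 (by omega)
    obtain ⟨s₀, hs⟩ := hp.exists_notMem_range
    have hx : x ≠ s₀ := fun e => hs ⟨x, hp.root.trans e⟩
    have hcard : Fintype.card {s // s ≠ s₀} = k + 1 := by
      rw [Fintype.card_subtype_compl, hS, Fintype.card_subtype_eq]
      rfl
    obtain ⟨ihlo, ihhi⟩ := ih (hp.removeLeaf hs hx) (by omega) hcard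
    rw [embeddingWeight_eq_embeddingSum_removeLeaf v hs hx, pow_succ', pow_succ']
    constructor
    · refine (mul_le_mul_of_nonneg_left ihlo hlo).trans ?_
      rw [← embeddingSum_const]
      refine hc.embeddingSum_mono fun f _ _ => hout _ _ (Finset.card_image_le.trans ?_)
      rwa [Finset.card_univ, hcard]
    · refine le_trans ?_ (mul_le_mul_of_nonneg_left ihhi hhi)
      rw [← embeddingSum_const]
      refine hc.embeddingSum_mono fun f _ _ => le_trans ?_ (hdeg (f ⟨p s₀, fun e => hs ⟨s₀, e⟩⟩))
      simp only [hc.symm _ (f ⟨p s₀, fun e => hs ⟨s₀, e⟩⟩)]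
      exact Finset.sum_le_sum_of_subset_of_nonneg (Finset.subset_univ _)
        fun y _ _ => hc.nonneg _ _

lemma IsRegular.embeddingWeight_div_mem_Icc [DecidableEq V] {D ε : ℝ} (h : IsRegular c D ε)
    (hc : IsNetwork c) (hε : 0 ≤ ε) (v : V) (hp : IsParentMap p x) {k : ℕ}
    (hS : Fintype.card S = k + 1) (hk : (k + 1) * ε ≤ 1) :
    embeddingWeight c p x v / D ^ k ∈ Set.Icc ((1 - (k + 1) * ε) ^ k) ((1 + ε) ^ k) := by
  have hD := h.pos
  have hdeg := fun z => abs_le.1 (h.abs_deg_sub_le z)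
  have hout : ∀ z, ∀ R : Finset V, R.card ≤ k → (1 - (k + 1) * ε) * D ≤ ∑ y ∈ Rᶜ, c y z := by
    intro z R hR
    have hsplit : ∑ y ∈ R, c y z + ∑ y ∈ Rᶜ, c y z = deg c z := by
      rw [deg, Finset.sum_add_sum_compl]
      exact Finset.sum_congr rfl fun y _ => hc.symm _ _
    have hin : ∑ y ∈ R, c y z ≤ k * (ε * D) := by
      refine (Finset.sum_le_card_nsmul R _ _ fun y _ => h.conductance_le y z).trans ?_
      rw [nsmul_eq_mul]
      gcongr
    linarith [(hdeg z).1]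
  have hmem := hc.embeddingWeight_mem_Icc (mul_nonneg (by linarith) hD.le)
    (by positivity : 0 ≤ (1 + ε) * D) hout (fun z => by linarith [(hdeg z).2]) v hp le_rfl hS
  rwa [Set.mem_Icc, mul_pow, mul_pow, ← le_div_iff₀ (pow_pos hD k), ← div_le_iff₀ (pow_pos hD k)]
    at hmem

lemma IsNetwork.abs_expectedEmbeddings_sub_le [DecidableEq V] (hc : IsNetwork c) {v : V} {a b : ℝ}
    (h : ∀ A : Finset V, v ∈ A → A.card = Fintype.card S →
      |forestSum c A / forestSum c {v} - a| ≤ b) :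
    |expectedEmbeddings c p x v - a * embeddingWeight c p x v| ≤ b * embeddingWeight c p x v := by
  have hratio : ∀ f : S → V, Function.Injective f → f x = v →
      |forestSum c (Finset.univ.image f) / forestSum c {v} - a| ≤ b := by
    rintro f hf rfl
    refine h _ (Finset.mem_image_of_mem f (Finset.mem_univ x)) ?_
    rw [Finset.card_image_of_injective _ hf, Finset.card_univ]
  rw [expectedEmbeddings, ← embeddingSum_const, ← embeddingSum_sub, abs_le, ← neg_mul,
    ← embeddingSum_const, ← embeddingSum_const]
  exact ⟨hc.embeddingSum_mono fun f hf hfx => (abs_le.1 (hratio f hf hfx)).1,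
    hc.embeddingSum_mono fun f hf hfx => (abs_le.1 (hratio f hf hfx)).2⟩

end Embeddings

section Sequences

lemma exists_abs_div_sub_le (m : ℕ) {δ : ℝ} (hδ : 0 < δ) :
    ∃ η : ℝ, 0 < η ∧ ∀ a b : ℝ, |a - (m + 1)| < η → |b - (m + 1) / (m + 2)| < η →
      |a / b - (m + 2)| ≤ δ := by
  have hcont : ContinuousAt (fun q : ℝ × ℝ => q.1 / q.2) ((m + 1 : ℝ), (m + 1 : ℝ) / (m + 2)) :=
    continuousAt_fst.div continuousAt_snd (by positivity)
  obtain ⟨η, hη, hball⟩ := Metric.continuousAt_iff.1 hcont δ hδ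
  refine ⟨η, hη, fun a b ha hb => ?_⟩
  have hdist := hball (x := (a, b)) (by rw [Prod.dist_eq]; exact max_lt ha hb)
  rw [Real.dist_eq, div_div_cancel₀ (by positivity)] at hdist
  exact hdist.le

variable {V : ℕ → Type*} [∀ n, Fintype (V n)] [∀ n, DecidableEq (V n)] {c : ∀ n, V n → V n → ℝ}
  {D : ℕ → ℝ}

lemma eventually_abs_forestSum_div_sub_le (hc : ∀ n, IsNetwork (c n))
    (hreg : ∀ ε : ℝ, 0 < ε → ∀ᶠ n in atTop, IsRegular (c n) (D n) ε) (m : ℕ) {δ : ℝ}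
    (hδ : 0 < δ) :
    ∀ᶠ n in atTop, ∀ (A : Finset (V n)) (v : V n), v ∈ A → A.card = m + 1 →
      |forestSum (c n) A / forestSum (c n) {v} * D n ^ m - (m + 1)| ≤ δ := by
  induction m generalizing δ with
  | zero =>
    refine Eventually.of_forall fun n A v hv hA => ?_
    obtain ⟨w, rfl⟩ := Finset.card_eq_one.1 hA
    rw [Finset.mem_singleton.1 hv,
      div_self ((hc n).forestSum_pos (Finset.singleton_nonempty w)).ne']
    simpa using hδ.le
  | succ m ih =>
    obtain ⟨η, hη, hquot⟩ := exists_abs_div_sub_le m hδ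
    set ε : ℝ := min 1 (η / 2 / (m + 1 + 9))
    have hε : 0 < ε := by positivity
    have hεη : (m + 1 + 9) * ε ≤ η / 2 := (le_div_iff₀' (by positivity)).1 (min_le_right _ _)
    filter_upwards [ih (half_pos hη), hreg ε hε] with n hind hn A v hv hA
    obtain ⟨y, hy, hyv⟩ : ∃ y ∈ A, y ≠ v := Finset.exists_mem_ne (by omega) v
    have hvA : v ∈ A.erase y := Finset.mem_erase.2 ⟨hyv.symm, hv⟩
    have hcard : (A.erase y).card = m + 1 := by rw [Finset.card_erase_of_mem hy, hA]; rfl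
    have hadd := hn.abs_forestSum_div_sub_le (hc n) hε.le (min_le_left _ _)
      (Finset.notMem_erase y A)
    rw [hcard, Finset.insert_erase hy] at hadd
    push_cast at hadd ⊢
    have hD := hn.pos
    have hA0 := (hc n).forestSum_pos ⟨v, hv⟩
    have hA1 := (hc n).forestSum_pos ⟨v, hvA⟩
    have hv0 := (hc n).forestSum_pos (Finset.singleton_nonempty v)
    have htele : forestSum (c n) A / forestSum (c n) {v} * D n ^ (m + 1) =
        forestSum (c n) (A.erase y) / forestSum (c n) {v} * D n ^ m /
          (forestSum (c n) (A.erase y) / (D n * forestSum (c n) A)) := by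
      field_simp
      rw [pow_succ]
    rw [htele, add_assoc, one_add_one_eq_two]
    refine hquot _ _ ((hind _ v hvA hcard).trans_lt (half_lt_self hη)) ?_
    rw [add_assoc (m : ℝ) 1 1, one_add_one_eq_two] at hadd
    linarith

variable {S : Type*} [Fintype S] [DecidableEq S] {p : S → S} {x : S}

lemma tendsto_embeddingWeight_div_pow (hc : ∀ n, IsNetwork (c n))
    (hreg : ∀ ε : ℝ, 0 < ε → ∀ᶠ n in atTop, IsRegular (c n) (D n) ε) (v : ∀ n, V n)
    (hp : IsParentMap p x) {k : ℕ} (hS : Fintype.card S = k + 1) :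
    Tendsto (fun n => embeddingWeight (c n) p x (v n) / D n ^ k) atTop (𝓝 1) := by
  have hbound : ∀ᶠ ε : ℝ in 𝓝[>] 0, ∀ᶠ n in atTop, embeddingWeight (c n) p x (v n) / D n ^ k ∈
      Set.Icc ((1 - (k + 1) * ε) ^ k) ((1 + ε) ^ k) := by
    have hsmall : Tendsto (fun ε : ℝ => (k + 1) * ε) (𝓝[>] 0) (𝓝 ((k + 1) * 0)) :=
      (continuous_const_mul _).continuousWithinAt
    rw [mul_zero] at hsmall
    filter_upwards [self_mem_nhdsWithin, hsmall.eventually_le_const one_pos] with ε hε hk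
    filter_upwards [hreg ε hε] with n hn
    exact hn.embeddingWeight_div_mem_Icc (hc n) (le_of_lt hε) (v n) hp hS hk
  have hlo : Tendsto (fun ε : ℝ => (1 - (k + 1) * ε) ^ k) (𝓝[>] 0) (𝓝 1) := by
    have hcont : Continuous fun ε : ℝ => (1 - (k + 1) * ε) ^ k := by fun_prop
    simpa using (hcont.tendsto 0).mono_left nhdsWithin_le_nhds
  have hhi : Tendsto (fun ε : ℝ => (1 + ε) ^ k) (𝓝[>] 0) (𝓝 1) := by
    have hcont : Continuous fun ε : ℝ => (1 + ε) ^ k := by fun_prop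
    simpa using (hcont.tendsto 0).mono_left nhdsWithin_le_nhds
  refine tendsto_order.2 ⟨fun a ha => ?_, fun a ha => ?_⟩
  · obtain ⟨ε, hε, hn⟩ := (hbound.and (hlo.eventually_const_lt ha)).exists
    filter_upwards [hε] with n hmem using hn.trans_le hmem.1
  · obtain ⟨ε, hε, hn⟩ := (hbound.and (hhi.eventually_lt_const ha)).exists
    filter_upwards [hε] with n hmem using hmem.2.trans_lt hn

lemma tendsto_expectedEmbeddings (hc : ∀ n, IsNetwork (c n))
    (hreg : ∀ ε : ℝ, 0 < ε → ∀ᶠ n in atTop, IsRegular (c n) (D n) ε) (v : ∀ n, V n)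
    (hp : IsParentMap p x) :
    Tendsto (fun n => expectedEmbeddings (c n) p x (v n)) atTop (𝓝 (Fintype.card S)) := by
  obtain ⟨k, hS⟩ : ∃ k, Fintype.card S = k + 1 :=
    Nat.exists_eq_succ_of_ne_zero ((Fintype.card_pos_iff.2 ⟨x⟩).ne')
  have hweight := tendsto_embeddingWeight_div_pow hc hreg v hp hS
  have hdiff : Tendsto (fun n => expectedEmbeddings (c n) p x (v n) -
      (k + 1) * (embeddingWeight (c n) p x (v n) / D n ^ k)) atTop (𝓝 0) := by
    rw [Metric.tendsto_nhds]
    intro δ hδ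
    filter_upwards [eventually_abs_forestSum_div_sub_le hc hreg k (half_pos hδ),
      hreg 1 one_pos, hweight.eventually_lt_const one_lt_two] with n hratio hn htwo
    have hD : 0 < D n ^ k := pow_pos hn.pos k
    have habs := (hc n).abs_expectedEmbeddings_sub_le (p := p) (x := x) (v := v n)
      (a := (k + 1) / D n ^ k) (b := δ / 2 / D n ^ k) fun A hv hA => by
        rw [le_div_iff₀ hD, ← abs_of_pos hD, ← abs_mul, abs_of_pos hD, sub_mul,
          div_mul_cancel₀ _ hD.ne']
        exact hratio A (v n) hv (hA.trans hS)
    rw [div_mul_eq_mul_div, div_mul_eq_mul_div, mul_div_assoc, mul_div_assoc] at habs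
    rw [Real.dist_eq, sub_zero]
    nlinarith
  have hsum := hdiff.add (hweight.const_mul ((k : ℝ) + 1))
  simp only [sub_add_cancel, zero_add, mul_one] at hsum
  rwa [hS, Nat.cast_succ]

end Sequences

/-! ### Counting saturated embeddings by inclusion and exclusion -/

section Extensions

variable {V W : Type*} {p : W → W} {x : W} {σ : V → V} {v : V}

/-- The number of embeddings of a rooted tree into another one. -/
def embeddingCount (p : W → W) (x : W) (σ : V → V) (v : V) : ℕ :=
  Nat.card {f : W → V // IsTreeEmbedding p x σ v f}

/-- The parent map of the tree obtained by adding `m` leaves with parents `i 0, …, i (m - 1)`. -/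
def addLeaves (p : W → W) {m : ℕ} (i : Fin m → W) : W ⊕ Fin m → W ⊕ Fin m :=
  Sum.elim (fun w => Sum.inl (p w)) fun j => Sum.inl (i j)

lemma IsParentMap.addLeaves (hp : IsParentMap p x) {m : ℕ} (i : Fin m → W) :
    IsParentMap (addLeaves p i) (Sum.inl x) := by
  have hinl : Function.Semiconj Sum.inl p (UST.addLeaves p i) := fun _ => rfl
  have reach_inl : ∀ w, Reach (UST.addLeaves p i) (Sum.inl w) (Sum.inl x) := fun w =>
    (hp.reach w).imp fun n hn => (hinl.iterate_right n w).symm.trans (congrArg Sum.inl hn)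
  refine ⟨congrArg Sum.inl hp.root, Sum.rec reach_inl fun j => ?_⟩
  exact Reach.trans ⟨1, rfl⟩ (reach_inl (i j))

/-- The children of the vertices in `f '' I` which are missed by `f`, each of them paired with the
vertex of `I` that its parent comes from. -/
def extraChildren (I : Finset W) (σ : V → V) (f : W → V) : Set (I × V) :=
  {q | q.2 ∉ Set.range f ∧ f q.1 = σ q.2}

lemma isTreeEmbedding_addLeaves_iff {m : ℕ} {i : Fin m → W} {f : W → V} {g : Fin m → V} :
    IsTreeEmbedding (addLeaves p i) (Sum.inl x) σ v (Sum.elim f g) ↔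
      IsTreeEmbedding p x σ v f ∧ Function.Injective g ∧
        ∀ j, g j ∉ Set.range f ∧ f (i j) = σ (g j) := by
  constructor
  · intro h
    refine ⟨⟨h.inj.comp Sum.inl_injective, h.map_root, fun w => h.map_parent (Sum.inl w)⟩,
      h.inj.comp Sum.inr_injective, fun j => ⟨?_, h.map_parent (Sum.inr j)⟩⟩
    rintro ⟨w, hw⟩
    exact Sum.inl_ne_inr (h.inj (a₁ := Sum.inl w) (a₂ := Sum.inr j) hw)
  · rintro ⟨hf, hg, hextra⟩
    refine ⟨hf.inj.sumElim hg fun w j hw => (hextra j).1 ⟨w, hw⟩, hf.map_root, ?_⟩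
    rintro (w | j)
    · exact hf.map_parent w
    · exact (hextra j).2

/-- An embedding with `m` added leaves amounts to an embedding and `m` of its extra children. -/
def addLeavesEmbeddingEquiv (p : W → W) (x : W) (σ : V → V) (v : V) (I : Finset W) (m : ℕ) :
    (Σ i : Fin m → I,
        {f // IsTreeEmbedding (addLeaves p fun j => (i j : W)) (Sum.inl x) σ v f}) ≃
      Σ f : {f : W → V // IsTreeEmbedding p x σ v f}, Fin m ↪ extraChildren I σ f.1 where
  toFun q :=
    have h := isTreeEmbedding_addLeaves_iff.1
      ((Sum.elim_comp_inl_inr q.2.1).symm ▸ q.2.2 :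
        IsTreeEmbedding _ _ σ v (Sum.elim (q.2.1 ∘ Sum.inl) (q.2.1 ∘ Sum.inr)))
    ⟨⟨q.2.1 ∘ Sum.inl, h.1⟩, fun j => ⟨(q.1 j, q.2.1 (Sum.inr j)), h.2.2 j⟩,
      fun _ _ hab => h.2.1 (congrArg (fun q => q.1.2) hab)⟩
  invFun q := ⟨fun j => (q.2 j).1.1, Sum.elim q.1.1 fun j => (q.2 j).1.2,
    isTreeEmbedding_addLeaves_iff.2 ⟨q.1.2, fun a b hab => q.2.injective (Subtype.ext (Prod.ext
      (Subtype.ext (q.1.2.inj ((q.2 a).2.2.trans ((congrArg σ hab).trans (q.2 b).2.2.symm)))) hab)),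
      fun j => (q.2 j).2⟩⟩
  left_inv q := by
    obtain ⟨i, f, hf⟩ := q
    exact Sigma.ext rfl (heq_of_eq (Subtype.ext (Sum.elim_comp_inl_inr f)))
  right_inv _ := rfl

lemma IsTreeEmbedding.isSaturatedEmbedding_iff {f : W → V} (hf : IsTreeEmbedding p x σ v f)
    {I : Finset W} : IsSaturatedEmbedding p x I σ v f ↔ extraChildren I σ f = ∅ := by
  refine ⟨fun h => Set.eq_empty_of_forall_notMem fun q hq => ?_, fun h => ⟨hf, fun u hu => ?_⟩⟩
  · exact hq.1 (h.mem_range q.2 ⟨q.1, q.1.2, hq.2⟩)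
  · obtain ⟨w, hw, hwu⟩ := hu
    by_contra hrange
    exact Set.eq_empty_iff_forall_notMem.1 h (⟨w, hw⟩, u) ⟨hrange, hwu⟩

/-- The sum over the embeddings of a tree of the number of ways to choose `m` extra children of the
vertices in `I`. -/
def extraChildrenMoment (p : W → W) (x : W) (I : Finset W) (σ : V → V) (v : V) (m : ℕ) : ℝ :=
  (∑ i : Fin m → I, (embeddingCount (addLeaves p fun j => (i j : W)) (Sum.inl x) σ v : ℝ)) /
    m.factorial

variable [Fintype V] [Fintype W] [DecidableEq W]

open Classical in
lemma sum_embeddingCount_addLeaves (I : Finset W) (m : ℕ) :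
    ∑ i : Fin m → I, embeddingCount (addLeaves p fun j => (i j : W)) (Sum.inl x) σ v =
      ∑ f : W → V with IsTreeEmbedding p x σ v f,
        (extraChildren I σ f).ncard.descFactorial m := by
  have hcard := Nat.card_congr (addLeavesEmbeddingEquiv p x σ v I m)
  rw [Nat.card_sigma, Nat.card_sigma] at hcard
  refine hcard.trans ?_
  rw [Finset.sum_subtype _ fun f => Finset.mem_filter_univ f]
  refine Finset.sum_congr rfl fun f _ => ?_
  rw [Nat.card_eq_fintype_card, Fintype.card_embedding_eq, Fintype.card_fin,
    ← Nat.card_eq_fintype_card, Nat.card_coe_set_eq]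

open Classical in
lemma extraChildrenMoment_eq_sum_choose (I : Finset W) (m : ℕ) :
    extraChildrenMoment p x I σ v m =
      ∑ f : W → V with IsTreeEmbedding p x σ v f, ((extraChildren I σ f).ncard.choose m : ℝ) := by
  rw [extraChildrenMoment, ← Nat.cast_sum, sum_embeddingCount_addLeaves, Nat.cast_sum,
    Finset.sum_div]
  refine Finset.sum_congr rfl fun f _ => ?_
  rw [Nat.descFactorial_eq_factorial_mul_choose, Nat.cast_mul,
    mul_div_cancel_left₀ _ (Nat.cast_ne_zero.2 m.factorial_ne_zero)]

open Classical in
lemma card_isSaturatedEmbedding_eq_sum (I : Finset W) :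
    (Nat.card {f : W → V // IsSaturatedEmbedding p x I σ v f} : ℝ) =
      ∑ f : W → V with IsTreeEmbedding p x σ v f,
        if (extraChildren I σ f).ncard = 0 then 1 else 0 := by
  rw [← Finset.sum_filter, Finset.sum_const, nsmul_one, Finset.filter_filter,
    Nat.card_eq_fintype_card, Fintype.card_subtype]
  congr 2
  refine Finset.filter_congr fun f _ => ⟨fun h => ?_, fun h => ?_⟩
  · exact ⟨h.toIsTreeEmbedding,
      (Set.ncard_eq_zero (Set.toFinite _)).2 (h.toIsTreeEmbedding.isSaturatedEmbedding_iff.1 h)⟩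
  · exact h.1.isSaturatedEmbedding_iff.2 ((Set.ncard_eq_zero (Set.toFinite _)).1 h.2)

lemma abs_indicator_sub_alternating_sum_choose_le (N M : ℕ) :
    |(if N = 0 then (1 : ℝ) else 0) - ∑ m ∈ Finset.range M, (-1) ^ m * (N.choose m : ℝ)| ≤
      N.choose M := by
  rcases N with - | N <;> rcases M with - | M
  · simp
  · simp [Finset.sum_range_succ']
  · simp
  · have halt : ∑ m ∈ Finset.range (M + 1), (-1 : ℝ) ^ m * ((N + 1).choose m : ℝ) =
        (-1) ^ M * (N.choose M : ℝ) := by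
      exact_mod_cast Int.alternating_sum_range_choose_eq_choose (n := N) (m := M)
    rw [halt, if_neg N.succ_ne_zero, zero_sub, abs_neg, abs_mul, abs_pow, abs_neg, abs_one,
      one_pow, one_mul, Nat.abs_cast, Nat.choose_succ_succ, Nat.cast_add]
    exact le_add_of_nonneg_right (Nat.cast_nonneg _)

omit [Fintype V] [Fintype W] [DecidableEq W] in
lemma abs_card_isSaturatedEmbedding_sub_le [Finite V] [Finite W] (I : Finset W) (M : ℕ) :
    |(Nat.card {f : W → V // IsSaturatedEmbedding p x I σ v f} : ℝ) -
        ∑ m ∈ Finset.range M, (-1) ^ m * extraChildrenMoment p x I σ v m| ≤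
      extraChildrenMoment p x I σ v M := by
  classical
  have := Fintype.ofFinite V
  have := Fintype.ofFinite W
  simp only [extraChildrenMoment_eq_sum_choose, card_isSaturatedEmbedding_eq_sum, Finset.mul_sum]
  rw [Finset.sum_comm, ← Finset.sum_sub_distrib]
  exact (Finset.abs_sum_le_sum_abs _ _).trans
    (Finset.sum_le_sum fun f _ => abs_indicator_sub_alternating_sum_choose_le _ _)

end Extensions

section TreeExpectation

variable {V : Type*} [Fintype V] [DecidableEq V] {c : V → V → ℝ} {v : V}

variable (c v) in
/-- The expectation of a function of the parent map towards `v` of a random spanning tree, drawn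
with probability proportional to its weight. -/
def treeExpectation : ((V → V) → ℝ) →ₗ[ℝ] ℝ :=
  (forestSum c {v})⁻¹ • ∑ σ ∈ forests {v}, forestWeight c {v} σ • LinearMap.proj σ

lemma treeExpectation_apply (F : (V → V) → ℝ) :
    treeExpectation c v F =
      (∑ σ ∈ forests {v}, forestWeight c {v} σ * F σ) / forestSum c {v} := by
  simp [treeExpectation, div_eq_inv_mul]

lemma IsNetwork.abs_treeExpectation_le (hc : IsNetwork c) {F F' : (V → V) → ℝ}
    (h : ∀ σ, |F σ| ≤ F' σ) : |treeExpectation c v F| ≤ treeExpectation c v F' := by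
  rw [treeExpectation_apply, treeExpectation_apply, abs_div,
    abs_of_pos (hc.forestSum_pos (Finset.singleton_nonempty v))]
  refine div_le_div_of_nonneg_right ?_ (hc.forestSum_pos (Finset.singleton_nonempty v)).le
  refine (Finset.abs_sum_le_sum_abs _ _).trans (Finset.sum_le_sum fun σ _ => ?_)
  rw [abs_mul, abs_of_nonneg (hc.forestWeight_nonneg _ _)]
  exact mul_le_mul_of_nonneg_left (h σ) (hc.forestWeight_nonneg _ _)

lemma IsNetwork.abs_treeExpectation_sub_sum_le (hc : IsNetwork c) {F F' : (V → V) → ℝ}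
    {ι : Type*} {s : Finset ι} (a : ι → ℝ) {S : ι → (V → V) → ℝ}
    (h : ∀ σ, |F σ - ∑ i ∈ s, a i * S i σ| ≤ F' σ) :
    |treeExpectation c v F - ∑ i ∈ s, a i * treeExpectation c v (S i)| ≤
      treeExpectation c v F' := by
  simp only [← smul_eq_mul, ← map_smul, ← map_sum, ← map_sub]
  exact hc.abs_treeExpectation_le fun σ => by simpa using h σ

variable {W : Type*} [Fintype W] [DecidableEq W] {p : W → W} {x : W}

lemma treeExpectation_embeddingCount (hp : IsParentMap p x) :
    treeExpectation c v (fun σ => embeddingCount p x σ v) = expectedEmbeddings c p x v := by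
  classical
  have hcount : ∀ σ : V → V, (embeddingCount p x σ v : ℝ) =
      ∑ f : W → V with Function.Injective f ∧ f x = v,
        if Function.Semiconj f p σ then 1 else 0 := by
    intro σ
    rw [← Finset.sum_filter, Finset.sum_const, nsmul_one, Finset.filter_filter, embeddingCount,
      Nat.card_eq_fintype_card, Fintype.card_subtype]
    congr 2
    exact Finset.filter_congr fun f _ =>
      ⟨fun h => ⟨⟨h.inj, h.map_root⟩, h.map_parent⟩, fun h => ⟨h.1.1, h.1.2, h.2⟩⟩
  simp only [treeExpectation_apply, hcount, Finset.mul_sum, mul_ite, mul_one, mul_zero]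
  rw [Finset.sum_comm, expectedEmbeddings, embeddingSum, Finset.sum_div]
  refine Finset.sum_congr (by congr!) fun f hf => ?_
  obtain ⟨hinj, rfl⟩ : Function.Injective f ∧ f x = v := by simpa using hf
  rw [← Finset.sum_filter, sum_forestWeight_of_semiconj hp hinj, mul_div_assoc]

lemma treeExpectation_extraChildrenMoment (hp : IsParentMap p x) (I : Finset W) (m : ℕ) :
    treeExpectation c v (fun σ => extraChildrenMoment p x I σ v m) =
      (∑ i : Fin m → I, expectedEmbeddings c (addLeaves p fun j => (i j : W)) (Sum.inl x) v) /
        m.factorial := by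
  have hsmul : (fun σ => extraChildrenMoment p x I σ v m) = (m.factorial : ℝ)⁻¹ •
      ∑ i : Fin m → I, fun σ : V → V =>
        (embeddingCount (addLeaves p fun j => (i j : W)) (Sum.inl x) σ v : ℝ) := by
    ext σ
    rw [Pi.smul_apply, Finset.sum_apply, smul_eq_mul, extraChildrenMoment, div_eq_inv_mul]
  rw [hsmul, map_smul, map_sum, smul_eq_mul, div_eq_inv_mul]
  simp only [treeExpectation_embeddingCount (hp.addLeaves _)]

end TreeExpectation

section Limit

lemma tendsto_of_alternating_bounds {P : ℕ → ℝ} {S : ℕ → ℕ → ℝ} {L : ℕ → ℝ} {ℓ : ℝ}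
    (h : ∀ M n, |P n - ∑ m ∈ Finset.range M, (-1) ^ m * S m n| ≤ S M n)
    (hS : ∀ m, Tendsto (S m) atTop (𝓝 (L m)))
    (hL : HasSum (fun m => (-1) ^ m * L m) ℓ) : Tendsto P atTop (𝓝 ℓ) := by
  have hL0 : Tendsto L atTop (𝓝 0) := by
    have habs := hL.summable.tendsto_atTop_zero.abs
    simp only [abs_mul, abs_pow, abs_neg, abs_one, one_pow, one_mul, abs_zero] at habs
    exact (tendsto_zero_iff_abs_tendsto_zero L).2 habs
  rw [Metric.tendsto_nhds]
  intro δ hδ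
  have hδ4 : 0 < δ / 4 := by positivity
  obtain ⟨M, hsum, hLM⟩ := ((Metric.tendsto_nhds.1 hL.tendsto_sum_nat _ hδ4).and
    (Metric.tendsto_nhds.1 hL0 _ hδ4)).exists
  have hpartial : Tendsto (fun n => ∑ m ∈ Finset.range M, (-1) ^ m * S m n) atTop
      (𝓝 (∑ m ∈ Finset.range M, (-1) ^ m * L m)) :=
    tendsto_finsetSum _ fun m _ => (hS m).const_mul _
  filter_upwards [Metric.tendsto_nhds.1 hpartial _ hδ4, Metric.tendsto_nhds.1 (hS M) _ hδ4]
    with n hn hSM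
  have hP := h M n
  rw [Real.dist_eq] at *
  grind

lemma hasSum_alternating_pow_mul_div_factorial (k a : ℝ) :
    HasSum (fun m : ℕ => (-1) ^ m * (k ^ m * (a + m) / m.factorial))
      (Real.exp (-k) * (a - k)) := by
  have hexp : HasSum (fun m : ℕ => (-k) ^ m / (m.factorial : ℝ)) (Real.exp (-k)) := by
    rw [Real.exp_eq_exp_ℝ]
    exact NormedSpace.expSeries_div_hasSum_exp (-k)
  have hmul : HasSum (fun m : ℕ => (m : ℝ) * ((-k) ^ m / (m.factorial : ℝ)))
      (-k * Real.exp (-k)) := by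
    rw [← hasSum_nat_add_iff' 1]
    simp only [Finset.range_one, Finset.sum_singleton, Nat.cast_zero, zero_mul, sub_zero]
    refine (hexp.mul_left (-k)).congr_fun fun m => ?_
    rw [Nat.factorial_succ]
    push_cast
    field_simp
    ring
  have hadd := (hexp.mul_left a).add hmul
  rw [show Real.exp (-k) * (a - k) = a * Real.exp (-k) + -k * Real.exp (-k) by ring]
  refine hadd.congr_fun fun m => ?_
  rw [neg_pow k]
  ring

variable {V : ℕ → Type*} [∀ n, Fintype (V n)] [∀ n, DecidableEq (V n)] {c : ∀ n, V n → V n → ℝ}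
  {D : ℕ → ℝ} {W : Type*} [Fintype W] {p : W → W} {x : W}

theorem tendsto_treeExpectation_card_isSaturatedEmbedding (hc : ∀ n, IsNetwork (c n))
    (hreg : ∀ ε : ℝ, 0 < ε → ∀ᶠ n in atTop, IsRegular (c n) (D n) ε) (v : ∀ n, V n)
    (hp : IsParentMap p x) (I : Finset W) :
    Tendsto (fun n => treeExpectation (c n) (v n) fun σ =>
        Nat.card {f : W → V n // IsSaturatedEmbedding p x I σ (v n) f}) atTop
      (𝓝 (Real.exp (-I.card) * (Fintype.card W - I.card))) := by
  classical
  refine tendsto_of_alternating_bounds (S := fun m n => treeExpectation (c n) (v n) fun σ =>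
      extraChildrenMoment p x I σ (v n) m)
    (L := fun m => (I.card : ℝ) ^ m * (Fintype.card W + m) / m.factorial)
    (fun M n => ?_) (fun m => ?_) (hasSum_alternating_pow_mul_div_factorial _ _)
  · exact (hc n).abs_treeExpectation_sub_sum_le _ fun σ =>
      abs_card_isSaturatedEmbedding_sub_le I M
  · simp only [treeExpectation_extraChildrenMoment hp]
    refine Tendsto.div_const ?_ _
    have hsum : Tendsto (fun n => ∑ i : Fin m → I,
        expectedEmbeddings (c n) (addLeaves p fun j => (i j : W)) (Sum.inl x) (v n)) atTop
        (𝓝 (∑ _i : Fin m → I, (Fintype.card (W ⊕ Fin m) : ℝ))) :=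
      tendsto_finsetSum _ fun i _ => tendsto_expectedEmbeddings hc hreg v (hp.addLeaves _)
    simpa [mul_add] using hsum

end Limit

/-! ### The network of a multigraph -/

section Conductance

variable {α β : Type*} (G : Graph α β)

open Classical in
/-- The conductances of the network of a multigraph: the number of edges between two distinct
vertices. Self-edges are discarded; they change neither hitting probabilities nor spanning trees. -/
def conductance (x y : V(G)) : ℝ :=
  if x = y then 0 else ({e | G.IsLink e x y}.ncard : ℝ)

variable {G}

lemma conductance_self (x : V(G)) : conductance G x x = 0 := if_pos rfl

lemma conductance_of_ne {x y : V(G)} (h : x ≠ y) :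
    conductance G x y = ({e | G.IsLink e x y}.ncard : ℝ) := if_neg h

lemma isNetwork_conductance (hE : E(G).Finite) (hconn : IsConnected G) :
    IsNetwork (conductance G) where
  nonneg x y := by
    unfold conductance
    split_ifs <;> positivity
  symm x y := by
    obtain rfl | hxy := eq_or_ne x y
    · rfl
    · rw [conductance_of_ne hxy, conductance_of_ne hxy.symm]
      simp only [Graph.isLink_comm (x := (x : α))]
  self := conductance_self
  conn v := by
    obtain ⟨σ, hσ, hadj⟩ := exists_isParentMap_of_connected hconn v
    refine ⟨σ, hσ, fun u hu => ?_⟩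
    obtain ⟨hne, e, he⟩ := hadj u hu
    rw [conductance_of_ne hne]
    have hfin : {e | G.IsLink e u (σ u)}.Finite := hE.subset fun _ => Graph.IsLink.edge_mem
    exact_mod_cast (Set.ncard_pos hfin).2 ⟨e, he⟩

end Conductance

/-! ### Hitting probabilities -/

section HittingProbability

variable {α β : Type*} {G : Graph α β}

lemma otherEnd_eq_iff {x w : α} {e : β} (he : G.Inc e x) : otherEnd G x e = w ↔ G.IsLink e x w := by
  rw [otherEnd, dif_pos he]
  exact ⟨fun h => h ▸ he.isLink_other, fun h => he.isLink_other.right_unique h⟩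

open Classical in
lemma sum_incidenceSet_otherEnd_eq [Fintype V(G)] {x : V(G)}
    (hfin : (G.incidenceSet (x : α)).Finite) (f : α → ℝ) :
    ∑ e ∈ hfin.toFinset, f (otherEnd G x e) =
      ∑ w : V(G), (hfin.toFinset.filter fun e => G.IsLink e x w).card * f w := by
  have hinc : ∀ e ∈ hfin.toFinset, G.Inc e x := fun e he => by simpa using he
  have hsum : ∀ e ∈ hfin.toFinset, f (otherEnd G x e) =
      ∑ w : V(G), if G.IsLink e x w then f w else 0 := by
    intro e he
    have hlink : G.IsLink e x (otherEnd G x e) := (otherEnd_eq_iff (hinc e he)).1 rfl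
    rw [Finset.sum_eq_single ⟨otherEnd G x e, hlink.right_mem⟩, if_pos hlink]
    · exact fun w _ hw => if_neg fun h => hw (Subtype.ext (h.right_unique hlink))
    · simp
  rw [Finset.sum_congr rfl hsum, Finset.sum_comm]
  exact Finset.sum_congr rfl fun w _ => by rw [← Finset.sum_filter, Finset.sum_const, nsmul_eq_mul]

lemma sum_incidenceSet_of_laplacian_eq_zero [Fintype V(G)] {h : α → ℝ} {x : V(G)}
    (hx : laplacian (conductance G) (fun w => h w) x = 0)
    (hfin : (G.incidenceSet (x : α)).Finite) :
    ∑ e ∈ hfin.toFinset, h (otherEnd G x e) = hfin.toFinset.card * h x := by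
  classical
  have hzero : ∑ e ∈ hfin.toFinset, (h x - h (otherEnd G x e)) = 0 := by
    rw [sum_incidenceSet_otherEnd_eq hfin fun w => h x - h w, ← hx, laplacian_apply]
    refine Finset.sum_congr rfl fun w _ => ?_
    obtain rfl | hw := eq_or_ne x w
    · rw [sub_self, mul_zero, mul_zero]
    · rw [conductance_of_ne hw, ← Set.ncard_coe_finset]
      congr 3
      ext e
      simpa using Graph.IsLink.inc_left
  rw [Finset.sum_sub_distrib, Finset.sum_const, nsmul_eq_mul, sub_eq_zero] at hzero
  exact hzero.symm

lemma tsum_map_mul {γ δ : Type*} (p : PMF γ) (f : γ → δ) (g : δ → ENNReal) :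
    ∑' b, p.map f b * g b = ∑' a, p a * g (f a) := by
  classical
  simp only [PMF.map_apply, ← ENNReal.tsum_mul_right, ite_mul, zero_mul]
  rw [ENNReal.tsum_comm]
  exact tsum_congr fun a => tsum_ite_eq (f a) fun b => p a * g b

lemma tsum_srwStep_mul_ofReal [Fintype V(G)] {h : α → ℝ} (h_nonneg : ∀ w, 0 ≤ h w) {x : V(G)}
    (hx : laplacian (conductance G) (fun w => h w) x = 0) :
    ∑' w, srwStep G x w * ENNReal.ofReal (h w) = ENNReal.ofReal (h x) := by
  rw [srwStep]
  split_ifs with hinc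
  · have hcard : (hinc.1.toFinset.card : ENNReal) ≠ 0 := by
      exact_mod_cast (Finset.card_pos.2 (hinc.1.toFinset_nonempty.2 hinc.2)).ne'
    rw [tsum_map_mul, tsum_eq_sum (s := hinc.1.toFinset) fun e he => by
        rw [PMF.uniformOfFinset_apply_of_notMem _ he, zero_mul],
      Finset.sum_congr rfl fun e he => by rw [PMF.uniformOfFinset_apply_of_mem _ he],
      ← Finset.mul_sum, ← ENNReal.ofReal_sum_of_nonneg fun _ _ => h_nonneg _,
      sum_incidenceSet_of_laplacian_eq_zero hx, ENNReal.ofReal_mul (Nat.cast_nonneg _),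
      ENNReal.ofReal_natCast, ← mul_assoc,
      ENNReal.inv_mul_cancel hcard (ENNReal.natCast_ne_top _), one_mul]
  · rw [tsum_eq_single (x : α) fun w hw => by rw [PMF.pure_apply_of_ne _ _ hw, zero_mul],
      PMF.pure_apply_self, one_mul]

lemma srwStep_of_notMem {x : α} (hx : x ∉ V(G)) : srwStep G x = PMF.pure x :=
  dif_neg fun h => h.2.elim fun _ he => hx (Graph.Inc.vertex_mem he)

lemma hitsBefore_cons {x y z : α} {l : List α} (hxy : x ≠ y) (hxz : x ≠ z) :
    HitsBefore y z (x :: l) ↔ HitsBefore y z l := by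
  constructor
  · rintro ⟨l₁, l₂, h, hz⟩
    cases l₁ with
    | nil => exact absurd (List.cons.inj h).1 hxy
    | cons a l₁ =>
      exact ⟨l₁, l₂, (List.cons.inj h).2, fun hmem => hz (List.mem_cons_of_mem _ hmem)⟩
  · rintro ⟨l₁, l₂, rfl, hz⟩
    exact ⟨x :: l₁, l₂, rfl, List.not_mem_cons_of_ne_of_not_mem hxz.symm hz⟩

lemma not_hitsBefore_cons_self {y z : α} {l : List α} (hyz : y ≠ z) :
    ¬ HitsBefore y z (z :: l) := by
  rintro ⟨l₁, l₂, h, hz⟩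
  cases l₁ with
  | nil => exact hyz (List.cons.inj h).1.symm
  | cons a l₁ => exact hz ((List.cons.inj h).1 ▸ List.mem_cons_self)

lemma not_hitsBefore_nil {y z : α} : ¬ HitsBefore y z [] := by
  rintro ⟨l₁, l₂, h, -⟩
  simp at h

lemma toOuterMeasure_le_one {γ : Type*} (p : PMF γ) (s : Set γ) : p.toOuterMeasure s ≤ 1 := by
  rw [PMF.toOuterMeasure_apply, ← p.tsum_coe]
  exact ENNReal.tsum_le_tsum fun a => Set.indicator_le_self' (fun _ _ => zero_le) a

lemma srwPath_hitsBefore_le {h : α → ENNReal} {y z : α} (hyz : y ≠ z) (hy : 1 ≤ h y)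
    (hsuper : ∀ x, x ≠ y → x ≠ z → ∑' w, srwStep G x w * h w ≤ h x) (k : ℕ) (x : α) :
    (srwPath G k x).toOuterMeasure {l | HitsBefore y z l} ≤ h x := by
  induction k generalizing x with
  | zero =>
    obtain rfl | hxy := eq_or_ne x y
    · exact (toOuterMeasure_le_one _ _).trans hy
    rw [srwPath, PMF.toOuterMeasure_pure_apply, if_neg]
    · exact zero_le
    obtain rfl | hxz := eq_or_ne x z
    · exact not_hitsBefore_cons_self hyz
    · exact fun hl => not_hitsBefore_nil ((hitsBefore_cons hxy hxz).1 hl)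
  | succ k ih =>
    obtain rfl | hxy := eq_or_ne x y
    · exact (toOuterMeasure_le_one _ _).trans hy
    simp only [srwPath, PMF.toOuterMeasure_bind_apply, PMF.toOuterMeasure_map_apply]
    obtain rfl | hxz := eq_or_ne x z
    · have hempty : (x :: ·) ⁻¹' {l | HitsBefore y x l} = ∅ :=
        Set.eq_empty_of_forall_notMem fun _ => not_hitsBefore_cons_self hyz
      simp [hempty]
    · have hpre : (x :: ·) ⁻¹' {l | HitsBefore y z l} = {l | HitsBefore y z l} :=
        Set.ext fun _ => hitsBefore_cons hxy hxz
      rw [hpre]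
      exact (ENNReal.tsum_le_tsum fun w => mul_le_mul_right (ih w) _).trans (hsuper x hxy hxz)

lemma hitProb_le_pairProb [Fintype V(G)] [DecidableEq V(G)] (hE : E(G).Finite)
    (hconn : IsConnected G) {x y z : V(G)} (hyz : y ≠ z) :
    hitProb G x y z ≤ pairProb (conductance G) y z x := by
  have hc := isNetwork_conductance hE hconn
  set h : α → ℝ := Function.extend Subtype.val (pairProb (conductance G) y z) 0
  have hval : ∀ w : V(G), h w = pairProb (conductance G) y z w :=
    Subtype.val_injective.extend_apply _ _
  have h_nonneg : ∀ a, 0 ≤ h a := by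
    intro a
    by_cases ha : a ∈ V(G)
    · exact (hc.pairProb_nonneg y z ⟨a, ha⟩).trans_eq (hval ⟨a, ha⟩).symm
    · have hout : h a = 0 := Function.extend_apply' _ _ _ (by rintro ⟨w, rfl⟩; exact ha w.2)
      exact hout.ge
  rw [← hval x, hitProb]
  refine ENNReal.toReal_le_of_le_ofReal (h_nonneg x) (iSup_le fun k => ?_)
  refine srwPath_hitsBefore_le (h := fun a => ENNReal.ofReal (h a)) (Subtype.coe_injective.ne hyz)
    ?_ (fun u huy huz => ?_) k x
  · rw [hval, hc.pairProb_left, ENNReal.ofReal_one]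
  · by_cases hu : u ∈ V(G)
    · lift u to V(G) using hu
      refine (tsum_srwStep_mul_ofReal h_nonneg ?_).le
      simp only [hval]
      exact laplacian_pairProb (fun e => huy (by rw [e])) fun e => huz (by rw [e])
    · rw [srwStep_of_notMem hu,
        tsum_eq_single u fun w hw => by rw [PMF.pure_apply_of_ne _ _ hw, zero_mul],
        PMF.pure_apply_self, one_mul]

lemma isBalanced_conductance [Fintype V(G)] [DecidableEq V(G)] (hE : E(G).Finite)
    (hconn : IsConnected G) {ε : ℝ}
    (h : ∀ x ∈ V(G), ∀ y ∈ V(G), ∀ z ∈ V(G), x ≠ y → x ≠ z → y ≠ z →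
      |hitProb G x y z - 1 / 2| ≤ ε) : IsBalanced (conductance G) ε := by
  have lower : ∀ x y z : V(G), x ≠ y → x ≠ z → y ≠ z →
      1 / 2 - ε ≤ pairProb (conductance G) y z x := by
    intro x y z hxy hxz hyz
    have hhit := (abs_le.1 (h x x.2 y y.2 z z.2 (Subtype.coe_injective.ne hxy)
      (Subtype.coe_injective.ne hxz) (Subtype.coe_injective.ne hyz))).1
    linarith [hitProb_le_pairProb hE hconn (x := x) hyz]
  intro x y z hxy hxz hyz
  have hadd := (isNetwork_conductance hE hconn).pairProb_add hyz x
  rw [abs_le]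
  constructor <;> linarith [lower x y z hxy hxz hyz, lower x z y hxz hxy hyz.symm]

end HittingProbability

/-! ### Spanning trees of a multigraph -/

section SpanningTrees

variable {α β : Type*} {G : Graph α β}

lemma restrict_isLink_iff {F : Set β} {e : β} {a b : α} :
    (G.restrict F).IsLink e a b ↔ e ∈ F ∧ G.IsLink e a b := Iff.rfl

lemma subgraphOf_adj {F : Set β} {a b : V(G)} :
    (subgraphOf G F).Adj a b ↔ a ≠ b ∧ ∃ e ∈ F, G.IsLink e a b := Iff.rfl

lemma IsSpanningTree.eq_of_isLink {F : Set β} (hF : IsSpanningTree G F) {e e' : β} (he : e ∈ F)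
    (he' : e' ∈ F) {a b : α} (hab : G.IsLink e a b) (hab' : G.IsLink e' a b) : e = e' :=
  have := hF.2.1
  Graph.IsLink.eq (restrict_isLink_iff.2 ⟨he, hab⟩) (restrict_isLink_iff.2 ⟨he', hab'⟩)

variable {v : V(G)} {σ : V(G) → V(G)}

lemma IsParentMap.eq_of_isLink (hσ : IsParentMap σ v) {u u' : V(G)} (hu : u ≠ v) {e : β}
    (h : G.IsLink e u (σ u)) (h' : G.IsLink e u' (σ u')) : u = u' := by
  rcases h.eq_and_eq_or_eq_and_eq h' with ⟨huu, -⟩ | ⟨huσ, hσu⟩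
  · exact Subtype.ext huu
  · refine absurd ?_ (hσ.parent_parent_ne hu)
    rw [Subtype.ext hσu, ← Subtype.ext huσ]

variable (G v σ) in
/-- A choice of an edge between every vertex other than `v` and its parent. -/
abbrev ParentEdges : Type _ := ∀ u : {u : V(G) // u ≠ v}, {e // G.IsLink e (u : V(G)) (σ u)}

/-- The set of the chosen edges. -/
def ParentEdges.edges (g : ParentEdges G v σ) : Set β := Set.range fun u => (g u : β)

namespace ParentEdges

lemma subgraphOf_edges (g : ParentEdges G v σ) (hσ : IsParentMap σ v) :
    subgraphOf G g.edges = parentGraph σ := by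
  ext a b
  rw [subgraphOf_adj, parentGraph_adj, and_congr_right_iff]
  intro hne
  constructor
  · rintro ⟨-, ⟨u, rfl⟩, he⟩
    rcases (g u).2.eq_and_eq_or_eq_and_eq he with ⟨hua, hub⟩ | ⟨hub, hua⟩
    · exact Or.inl (Subtype.ext hua ▸ Subtype.ext hub)
    · exact Or.inr (Subtype.ext hub ▸ Subtype.ext hua)
  · rintro (rfl | rfl)
    · have ha : a ≠ v := fun e => hne (by rw [e, hσ.root])
      exact ⟨_, ⟨⟨a, ha⟩, rfl⟩, (g ⟨a, ha⟩).2⟩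
    · have hb : b ≠ v := fun e => hne (by rw [e, hσ.root])
      exact ⟨_, ⟨⟨b, hb⟩, rfl⟩, (g ⟨b, hb⟩).2.symm⟩

lemma isSpanningTree_edges (g : ParentEdges G v σ) (hσ : IsParentMap σ v) :
    IsSpanningTree G g.edges := by
  refine ⟨?_, ?_, (g.subgraphOf_edges hσ ▸ hσ.isTree : (subgraphOf G g.edges).IsTree)⟩
  · rintro - ⟨u, rfl⟩
    exact (g u).2.edge_mem
  · refine @Graph.Simple.mk _ _ _ ⟨fun e a he => ?_⟩ fun e e' a b he he' => ?_
    · obtain ⟨⟨u, rfl⟩, he⟩ := restrict_isLink_iff.1 he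
      refine hσ.parent_ne u.2 (Subtype.ext ?_)
      rcases (g u).2.eq_and_eq_or_eq_and_eq he with h | h <;> rw [h.1, h.2]
    · obtain ⟨⟨u, rfl⟩, he⟩ := restrict_isLink_iff.1 he
      obtain ⟨⟨u', rfl⟩, he'⟩ := restrict_isLink_iff.1 he'
      have hlink : G.IsLink (g u') (u : V(G)) (σ u) := by
        rcases he.eq_and_eq_or_eq_and_eq (g u).2 with h | h
        · rwa [← h.1, ← h.2]
        · rw [← h.1, ← h.2]
          exact he'.symm
      rw [Subtype.ext (hσ.eq_of_isLink u.2 hlink (g u').2)]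

lemma edges_injective (hσ : IsParentMap σ v) :
    Function.Injective (edges : ParentEdges G v σ → Set β) := by
  intro g g' hgg
  funext u
  obtain ⟨u', hu'⟩ : (g u : β) ∈ g'.edges := hgg ▸ ⟨u, rfl⟩
  have hlink := (g' u').2
  rw [show (g' u' : β) = g u from hu'] at hlink
  obtain rfl : u = u' := Subtype.ext (hσ.eq_of_isLink u.2 (g u).2 hlink)
  exact Subtype.ext hu'.symm

lemma exists_edges_eq (hσ : IsParentMap σ v) {F : Set β} (hF : IsSpanningTree G F)
    (hFσ : subgraphOf G F = parentGraph σ) : ∃ g : ParentEdges G v σ, g.edges = F := by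
  have hadj : ∀ u : {u : V(G) // u ≠ v}, (subgraphOf G F).Adj u (σ u) := fun u =>
    hFσ ▸ (parentGraph_adj.2 ⟨(hσ.parent_ne u.2).symm, Or.inl rfl⟩)
  choose g hgF hg using fun u => (subgraphOf_adj.1 (hadj u)).2
  refine ⟨fun u => ⟨g u, hg u⟩, Set.Subset.antisymm (Set.range_subset_iff.2 hgF) fun e he => ?_⟩
  obtain ⟨u, hu⟩ : ∃ u : {u : V(G) // u ≠ v}, G.IsLink e (u : V(G)) (σ u) := by
    obtain ⟨a, b, hab⟩ := Graph.exists_isLink_of_mem_edgeSet (hF.1 he)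
    have := hF.2.1
    have hne : a ≠ b := Graph.IsLink.ne (restrict_isLink_iff.2 ⟨he, hab⟩)
    lift a to V(G) using hab.left_mem
    lift b to V(G) using hab.right_mem
    have habF : (subgraphOf G F).Adj a b := subgraphOf_adj.2 ⟨ne_of_apply_ne _ hne, e, he, hab⟩
    rw [hFσ, parentGraph_adj] at habF
    obtain ⟨hne, rfl | rfl⟩ := habF
    · exact ⟨⟨a, fun h => hne (by rw [h, hσ.root])⟩, hab⟩
    · exact ⟨⟨b, fun h => hne (by rw [h, hσ.root])⟩, hab.symm⟩
  exact ⟨u, hF.eq_of_isLink (hgF u) he (hg u) hu⟩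

end ParentEdges

lemma card_spanningTrees_parentGraph [Fintype V(G)] [DecidableEq V(G)] (hσ : IsParentMap σ v) :
    (Nat.card {F : Set β // IsSpanningTree G F ∧ subgraphOf G F = parentGraph σ} : ℝ) =
      forestWeight (conductance G) {v} σ := by
  have hbij : Function.Bijective fun g : ParentEdges G v σ =>
      (⟨g.edges, g.isSpanningTree_edges hσ, g.subgraphOf_edges hσ⟩ :
        {F : Set β // IsSpanningTree G F ∧ subgraphOf G F = parentGraph σ}) :=
    ⟨fun _ _ h => ParentEdges.edges_injective hσ (congrArg Subtype.val h), fun F =>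
      (ParentEdges.exists_edges_eq hσ F.2.1 F.2.2).imp fun _ => Subtype.ext⟩
  rw [← Nat.card_congr (Equiv.ofBijective _ hbij), Nat.card_pi, Nat.cast_prod, forestWeight,
    Finset.prod_subtype (p := fun u => u ≠ v) _ (by simp)]
  refine Finset.prod_congr rfl fun u _ => ?_
  rw [conductance_of_ne (hσ.parent_ne u.2).symm, ← Nat.card_coe_set_eq]
  rfl

open Classical in
lemma ncard_spanningTrees [Fintype V(G)] [DecidableEq V(G)] (hE : E(G).Finite) (v : V(G))
    (P : SimpleGraph V(G) → Prop) :
    ({F : Set β | IsSpanningTree G F ∧ P (subgraphOf G F)}.ncard : ℝ) =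
      ∑ σ ∈ forests {v}, if P (parentGraph σ) then forestWeight (conductance G) {v} σ else 0 := by
  have hbij : Function.Bijective
      (fun q : (σ : {σ : V(G) → V(G) // IsParentMap σ v ∧ P (parentGraph σ)}) ×
          {F : Set β // IsSpanningTree G F ∧ subgraphOf G F = parentGraph σ.1} =>
        (⟨q.2.1, q.2.2.1, by rw [q.2.2.2]; exact q.1.2.2⟩ :
          {F : Set β | IsSpanningTree G F ∧ P (subgraphOf G F)})) := by
    constructor
    · rintro ⟨⟨σ, hσ⟩, F, hF⟩ ⟨⟨σ', hσ'⟩, F', hF'⟩ h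
      obtain rfl : F = F' := congrArg Subtype.val h
      obtain rfl : σ = σ' := hσ.1.eq_of_parentGraph_eq hσ'.1 (hF.2.symm.trans hF'.2)
      rfl
    · rintro ⟨F, hF, hP⟩
      obtain ⟨σ, hσ, hT⟩ := exists_eq_parentGraph (T := subgraphOf G F) hF.2.2 v
      exact ⟨⟨⟨σ, hσ, hT ▸ hP⟩, F, hF, hT⟩, rfl⟩
  have hfin : ∀ σ : V(G) → V(G),
      Finite {F : Set β // IsSpanningTree G F ∧ subgraphOf G F = parentGraph σ} := fun σ =>
    Set.Finite.to_subtype (s := {F | IsSpanningTree G F ∧ subgraphOf G F = parentGraph σ})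
      (hE.finite_subsets.subset fun F hF => hF.1.1)
  rw [← Nat.card_coe_set_eq, ← Nat.card_congr (Equiv.ofBijective _ hbij), Nat.card_sigma,
    Nat.cast_sum, ← Finset.sum_filter,
    Finset.sum_subtype (p := fun σ => IsParentMap σ v ∧ P (parentGraph σ)) _ fun σ => by
      rw [Finset.mem_filter, mem_forests, isForest_singleton_iff]]
  exact Finset.sum_congr rfl fun σ _ => card_spanningTrees_parentGraph σ.2.1

lemma ustTruncProb_mul_autCard [Fintype V(G)] [DecidableEq V(G)] (hE : E(G).Finite) (v : V(G))
    {W : Type*} {p : W → W} {x : W} (hp : IsParentMap p x) {r : ℕ} (hr : ∀ w, depth p x w ≤ r) :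
    ustTruncProb G v r (parentGraph p) x * autCard (parentGraph p) x =
      treeExpectation (conductance G) v fun σ =>
        Nat.card {f : W → V(G) // IsSaturatedEmbedding p x {w | depth p x w < r} σ v f} := by
  classical
  have hnum := ncard_spanningTrees hE v fun T => TruncationIs T v r (parentGraph p) x
  have hden := ncard_spanningTrees hE v fun _ => True
  simp only [and_true, if_true] at hden
  rw [ustTruncProb, hnum, hden, treeExpectation_apply, div_mul_eq_mul_div, Finset.sum_mul,
    forestSum]
  congr 1
  refine Finset.sum_congr rfl fun σ hσ => ?_
  rw [card_isSaturatedEmbedding hp (mem_forests.1 hσ).isParentMap hr]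
  split_ifs <;> simp

end SpanningTrees

section GinoRegular

variable {α β : ℕ → Type*} {G : ∀ n, Graph (α n) (β n)}

lemma IsGinoRegular.eventually_isRegular [∀ n, Fintype V(G n)] [∀ n, DecidableEq V(G n)]
    (hG : IsGinoRegular G) (hE : ∀ n, E(G n).Finite) (hconn : ∀ n, IsConnected (G n))
    (hsize : Tendsto (fun n => Fintype.card V(G n)) atTop atTop) (v : ∀ n, V(G n))
    {ε : ℝ} (hε : 0 < ε) :
    ∀ᶠ n in atTop, IsRegular (conductance (G n)) (deg (conductance (G n)) (v n)) ε := by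
  obtain ⟨-, -, hhit⟩ := hG
  have hlim : Tendsto (fun n => 2 / ((Fintype.card V(G n) : ℝ) - 1)) atTop (𝓝 0) :=
    (tendsto_atTop_add_const_right _ (-1) (tendsto_natCast_atTop_atTop.comp hsize)).const_div_atTop
      2
  obtain ⟨δ, hδ, hδ6, hδε⟩ : ∃ δ : ℝ, 0 < δ ∧ δ ≤ 1 / 6 ∧ δ ≤ ε / 16 :=
    ⟨min (1 / 6) (ε / 16), by positivity, min_le_left _ _, min_le_right _ _⟩
  filter_upwards [hhit δ hδ, hsize.eventually_ge_atTop 2,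
    hlim.eventually_lt_const (half_pos hε)] with n hn hcard hsmall
  exact ((isBalanced_conductance (hE n) (hconn n) hn).isRegular
    (isNetwork_conductance (hE n) (hconn n)) hδ.le hδ6 hcard (v n)).mono (by linarith)

theorem tendsto_ustTruncProb_mul_autCard (hV : ∀ n, V(G n).Finite) (hE : ∀ n, E(G n).Finite)
    (hconn : ∀ n, IsConnected (G n)) (hsize : Tendsto (fun n => V(G n).ncard) atTop atTop)
    (hG : IsGinoRegular G) (v : ∀ n, V(G n)) {W : Type*} [Fintype W] {p : W → W} {x : W}
    (hp : IsParentMap p x) {r : ℕ} (hr : ∀ w, depth p x w ≤ r) :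
    Tendsto (fun n => ustTruncProb (G n) (v n) r (parentGraph p) x * autCard (parentGraph p) x)
      atTop (𝓝 (Real.exp (-{w | depth p x w < r}.ncard) *
        (Fintype.card W - {w | depth p x w < r}.ncard))) := by
  classical
  have : ∀ n, Fintype V(G n) := fun n => (hV n).fintype
  simp only [← Nat.card_coe_set_eq, Nat.card_eq_fintype_card] at hsize
  have hlim := tendsto_treeExpectation_card_isSaturatedEmbedding
    (fun n => isNetwork_conductance (hE n) (hconn n))
    (fun _ => hG.eventually_isRegular hE hconn hsize v) v hp ({w | depth p x w < r} : Finset W)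
  rw [← Set.ncard_coe_finset] at hlim
  simpa only [Finset.coe_filter_univ, ustTruncProb_mul_autCard (hE _) (v _) hp hr] using hlim

end GinoRegular

/-! ### Placements of a finite tree -/

section Placements

variable {W : Type*}

/-- `Q` is (the vertex set of) a path that starts at the root `x` and leads away from it. -/
structure IsSpine (p : W → W) (x : W) (Q : Set W) : Prop where
  root : x ∈ Q
  parent : ∀ w ∈ Q, p w ∈ Q
  inj : Set.InjOn (depth p x) Q

/-- `f` embeds a rooted tree into the tree whose vertices are positions `(i, u)`: the `i`-th vertex
of a line and a descendant of it, encoded by the word `u`, where position `s` has `ω s` children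
besides the next vertex of the line. The path `Q` is placed on the line, and all the children of
the position of a vertex at depth less than `r` are in the image. -/
structure IsPlacement (p : W → W) (x : W) (r : ℕ) (Q : Set W) (ω : ℕ × List ℕ → ℕ)
    (f : W → ℕ × List ℕ) : Prop where
  inj : Function.Injective f
  spine : ∀ w ∈ Q, f w = (depth p x w, [])
  child : ∀ u, u ∉ Q → ∃ k < ω (f (p u)), f u = ((f (p u)).1, (f (p u)).2 ++ [k])
  surj : ∀ w, depth p x w < r → ∀ k < ω (f w),
    ∃ u, u ∉ Q ∧ p u = w ∧ f u = ((f w).1, (f w).2 ++ [k])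

/-- The children of `w` outside the path `Q`. -/
abbrev SideChildren (p : W → W) (Q : Set W) (w : W) : Type _ := {u : W // u ∉ Q ∧ p u = w}

/-- The number of children of `w` outside the path `Q`. -/
def sideCard (p : W → W) (Q : Set W) (w : W) : ℕ := Nat.card (SideChildren p Q w)

/-- A numbering of the children outside `Q` of every vertex, that is, a plane tree structure. -/
abbrev Labelling (p : W → W) (Q : Set W) : Type _ :=
  (w : W) → SideChildren p Q w ≃ Fin (sideCard p Q w)

variable {p : W → W} {x : W} {r : ℕ} {Q : Set W}

open Classical in
/-- The number of a vertex among its siblings outside `Q` (`0` for a vertex of `Q`). -/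
def Labelling.label (e : Labelling p Q) (u : W) : ℕ :=
  if h : u ∈ Q then 0 else e (p u) ⟨u, h, rfl⟩

open Classical in
/-- The position of a vertex of depth `n`, found by following its ancestors up to the path `Q`. -/
def placeOfDepth (p : W → W) (Q : Set W) (ℓ : W → ℕ) : ℕ → W → ℕ × List ℕ
  | 0, _ => (0, [])
  | n + 1, w => if w ∈ Q then (n + 1, []) else
      ((placeOfDepth p Q ℓ n (p w)).1, (placeOfDepth p Q ℓ n (p w)).2 ++ [ℓ w])

/-- The placement determined by a labelling. -/
def Labelling.place (x : W) (e : Labelling p Q) (w : W) : ℕ × List ℕ :=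
  placeOfDepth p Q e.label (depth p x w) w

namespace Labelling

lemma place_of_mem (e : Labelling p Q) {w : W} (hw : w ∈ Q) :
    e.place x w = (depth p x w, []) := by
  rw [Labelling.place]
  cases depth p x w with
  | zero => rfl
  | succ n => rw [placeOfDepth, if_pos hw]

lemma place_of_notMem (hp : IsParentMap p x) (hQ : IsSpine p x Q) (e : Labelling p Q) {w : W}
    (hw : w ∉ Q) :
    e.place x w = ((e.place x (p w)).1, (e.place x (p w)).2 ++ [e.label w]) := by
  have hne : w ≠ x := fun h => hw (h ▸ hQ.root)
  rw [Labelling.place, hp.depth_eq_succ hne, placeOfDepth, if_neg hw]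
  rfl

lemma label_of_notMem (e : Labelling p Q) {u w : W} (hu : u ∉ Q) (hw : p u = w) :
    e.label u = e w ⟨u, hu, hw⟩ := by
  subst hw
  exact dif_neg hu

end Labelling

lemma fst_add_length_eq_depth (hp : IsParentMap p x) (hQ : IsSpine p x Q) {f : W → ℕ × List ℕ}
    (hspine : ∀ w ∈ Q, f w = (depth p x w, []))
    (hchild : ∀ u, u ∉ Q → ∃ k, f u = ((f (p u)).1, (f (p u)).2 ++ [k])) (w : W) :
    (f w).1 + (f w).2.length = depth p x w := by
  induction w using hp.induction with
  | root => rw [hspine x hQ.root, List.length_nil, add_zero]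
  | parent u hu ih =>
    by_cases huQ : u ∈ Q
    · rw [hspine u huQ, List.length_nil, add_zero]
    · obtain ⟨k, hk⟩ := hchild u huQ
      rw [hk, hp.depth_eq_succ hu, ← ih, List.length_append, List.length_singleton, add_assoc]

namespace Labelling

lemma fst_add_length_place (hp : IsParentMap p x) (hQ : IsSpine p x Q) (e : Labelling p Q)
    (w : W) : (e.place x w).1 + (e.place x w).2.length = depth p x w :=
  fst_add_length_eq_depth hp hQ (fun _ hw => e.place_of_mem hw)
    (fun _ hu => ⟨_, e.place_of_notMem hp hQ hu⟩) w

lemma place_ne_of_mem_of_notMem (hp : IsParentMap p x) (hQ : IsSpine p x Q) (e : Labelling p Q)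
    {a b : W} (ha : a ∈ Q) (hb : b ∉ Q) : e.place x a ≠ e.place x b := by
  rw [e.place_of_mem ha, e.place_of_notMem hp hQ hb]
  exact fun h => List.append_ne_nil_of_right_ne_nil _ (List.cons_ne_nil _ _)
    (congrArg Prod.snd h).symm

lemma place_injective (hp : IsParentMap p x) (hQ : IsSpine p x Q) (e : Labelling p Q) :
    Function.Injective (e.place x) := by
  have depth_eq : ∀ {a b}, e.place x a = e.place x b → depth p x a = depth p x b :=
    fun {a b} h => by rw [← e.fst_add_length_place hp hQ a, h, e.fst_add_length_place hp hQ b]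
  intro a
  induction a using hp.induction with
  | root => exact fun b hb => (hp.depth_eq_zero.1 ((depth_eq hb).symm.trans hp.depth_root)).symm
  | parent a _ ih =>
    intro b hb
    by_cases haQ : a ∈ Q <;> by_cases hbQ : b ∈ Q
    · exact hQ.inj haQ hbQ (depth_eq hb)
    · exact absurd hb (e.place_ne_of_mem_of_notMem hp hQ haQ hbQ)
    · exact absurd hb.symm (e.place_ne_of_mem_of_notMem hp hQ hbQ haQ)
    · rw [e.place_of_notMem hp hQ haQ, e.place_of_notMem hp hQ hbQ, Prod.mk.injEq,
        ← List.concat_eq_append, ← List.concat_eq_append, List.concat_inj] at hb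
      obtain ⟨hfst, hsnd, hlabel⟩ := hb
      have hparent : p a = p b := ih (Prod.ext hfst hsnd)
      rw [e.label_of_notMem haQ hparent, e.label_of_notMem hbQ rfl] at hlabel
      exact congrArg Subtype.val ((e (p b)).injective (Fin.ext hlabel))

lemma injective_place (hp : IsParentMap p x) (hQ : IsSpine p x Q) :
    Function.Injective (Labelling.place x : Labelling p Q → W → ℕ × List ℕ) := by
  intro e e' h
  refine funext fun w => Equiv.ext fun ⟨u, hu, hw⟩ => Fin.ext ?_
  have hplace := congrArg Prod.snd (congrFun h u)
  rw [e.place_of_notMem hp hQ hu, e'.place_of_notMem hp hQ hu, h] at hplace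
  rw [← e.label_of_notMem hu hw, ← e'.label_of_notMem hu hw]
  exact List.singleton_inj.1 (List.append_cancel_left hplace)

end Labelling

lemma IsSpine.depth_parent_lt (hQ : IsSpine p x Q) (hp : IsParentMap p x)
    (hr : ∀ w, depth p x w ≤ r) {u : W} (hu : u ∉ Q) : depth p x (p u) < r := by
  have hne : u ≠ x := fun h => hu (h ▸ hQ.root)
  exact Nat.lt_of_succ_le ((hp.depth_eq_succ hne).symm.trans_le (hr u))

lemma isEmpty_sideChildren (hp : IsParentMap p x) (hr : ∀ w, depth p x w ≤ r)
    (hQ : IsSpine p x Q) {w : W} (hw : ¬ depth p x w < r) : IsEmpty (SideChildren p Q w) :=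
  ⟨fun ⟨_, hu, hpu⟩ => hw (hpu ▸ hQ.depth_parent_lt hp hr hu)⟩

lemma Labelling.isPlacement_place (hp : IsParentMap p x) (hr : ∀ w, depth p x w ≤ r)
    (hQ : IsSpine p x Q) (e : Labelling p Q) {ω : ℕ × List ℕ → ℕ}
    (hω : ∀ w, depth p x w < r → ω (e.place x w) = sideCard p Q w) :
    IsPlacement p x r Q ω (e.place x) where
  inj := e.place_injective hp hQ
  spine w hw := e.place_of_mem hw
  child u hu := by
    refine ⟨e.label u, ?_, e.place_of_notMem hp hQ hu⟩
    rw [hω _ (hQ.depth_parent_lt hp hr hu), e.label_of_notMem hu rfl]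
    exact Fin.is_lt _
  surj w hw k hk := by
    rw [hω w hw] at hk
    obtain ⟨⟨u, hu, rfl⟩, hlabel⟩ := (e w).surjective ⟨k, hk⟩
    refine ⟨u, hu, rfl, ?_⟩
    rw [e.place_of_notMem hp hQ hu, e.label_of_notMem hu rfl, hlabel]

namespace IsPlacement

variable {ω : ℕ × List ℕ → ℕ} {f : W → ℕ × List ℕ}

lemma exists_bijOn_label (hf : IsPlacement p x r Q ω f) :
    ∃ ℓ : W → ℕ, (∀ u, u ∉ Q → f u = ((f (p u)).1, (f (p u)).2 ++ [ℓ u])) ∧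
      ∀ w, depth p x w < r → Set.BijOn ℓ {u | u ∉ Q ∧ p u = w} {k | k < ω (f w)} := by
  choose! ℓ hlt hℓ using hf.child
  refine ⟨ℓ, hℓ, fun w hw => ⟨?_, ?_, ?_⟩⟩
  · rintro u ⟨hu, rfl⟩
    exact hlt u hu
  · rintro u ⟨hu, hpu⟩ u' ⟨hu', hpu'⟩ h
    refine hf.inj ?_
    rw [hℓ u hu, hℓ u' hu', hpu, hpu', h]
  · intro k hk
    obtain ⟨u, hu, rfl, hfu⟩ := hf.surj w hw k hk
    refine ⟨u, ⟨hu, rfl⟩, ?_⟩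
    have hsnd := congrArg Prod.snd ((hℓ u hu).symm.trans hfu)
    exact List.singleton_inj.1 (List.append_cancel_left hsnd)

lemma exists_labelling (hf : IsPlacement p x r Q ω f) (hp : IsParentMap p x)
    (hr : ∀ w, depth p x w ≤ r) (hQ : IsSpine p x Q) :
    ∃ e : Labelling p Q, e.place x = f ∧ ∀ w, depth p x w < r → ω (f w) = sideCard p Q w := by
  obtain ⟨ℓ, hℓ, hbij⟩ := hf.exists_bijOn_label
  have hcard : ∀ w, depth p x w < r → ω (f w) = sideCard p Q w := by
    intro w hw
    exact (Nat.card_fin _).symm.trans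
      (Nat.card_congr (((hbij w hw).equiv ℓ).trans Fin.equivSubtype.symm)).symm
  have exists_numbering : ∀ w, ∃ ew : SideChildren p Q w ≃ Fin (sideCard p Q w),
      ∀ u, (ew u : ℕ) = ℓ u := by
    intro w
    by_cases hw : depth p x w < r
    · exact ⟨(((hbij w hw).equiv ℓ).trans Fin.equivSubtype.symm).trans (finCongr (hcard w hw)),
        fun u => rfl⟩
    · have := isEmpty_sideChildren hp hr hQ hw
      exact ⟨Finite.equivFin _, isEmptyElim⟩
  choose e he using exists_numbering
  refine ⟨e, funext (hp.induction ?_ fun u _ ih => ?_), hcard⟩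
  · rw [Labelling.place_of_mem e hQ.root, hf.spine x hQ.root]
  · by_cases hu : u ∈ Q
    · rw [Labelling.place_of_mem e hu, hf.spine u hu]
    · rw [Labelling.place_of_notMem hp hQ e hu, ih, hℓ u hu, Labelling.label_of_notMem e hu rfl, he]

end IsPlacement

/-- Placements correspond to labellings for which `ω` has the right values. -/
def labellingEquivPlacement (hp : IsParentMap p x) (hr : ∀ w, depth p x w ≤ r)
    (hQ : IsSpine p x Q) (ω : ℕ × List ℕ → ℕ) :
    {e : Labelling p Q // ∀ w, depth p x w < r → ω (e.place x w) = sideCard p Q w} ≃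
      {f : W → ℕ × List ℕ // IsPlacement p x r Q ω f} :=
  Equiv.ofBijective (fun e => ⟨e.1.place x, e.1.isPlacement_place hp hr hQ e.2⟩) <| by
    refine ⟨fun e e' h => Subtype.ext ?_, fun ⟨f, hf⟩ => ?_⟩
    · exact Labelling.injective_place hp hQ (congrArg Subtype.val h)
    · obtain ⟨e, rfl, hcard⟩ := hf.exists_labelling hp hr hQ
      exact ⟨⟨e, hcard⟩, rfl⟩

lemma card_labelling [Fintype W] (p : W → W) (Q : Set W) :
    Nat.card (Labelling p Q) = ∏ w, (sideCard p Q w).factorial := by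
  classical
  rw [Nat.card_pi]
  refine Finset.prod_congr rfl fun w _ => ?_
  have numbering : SideChildren p Q w ≃ Fin (sideCard p Q w) := Finite.equivFin _
  rw [Nat.card_eq_fintype_card, Fintype.card_equiv numbering, Fintype.card_congr numbering,
    Fintype.card_fin]

end Placements

/-! ### Family trees and trees with a spine -/

section Positions

/-- The parent of a position `(i, u)`, that is, of the individual `u` of the family tree pasted onto
the `i`-th vertex of a line. The first vertex `(0, [])` of the line is the root. -/
def positionParent (q : ℕ × List ℕ) : ℕ × List ℕ :=
  if q.2 = [] then (q.1 - 1, []) else (q.1, q.2.dropLast)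

lemma positionParent_nil (i : ℕ) : positionParent (i, []) = (i - 1, []) := if_pos rfl

lemma positionParent_concat (i : ℕ) (u : List ℕ) (k : ℕ) :
    positionParent (i, u ++ [k]) = (i, u) := by
  simp [positionParent]

lemma fst_add_length_positionParent {q : ℕ × List ℕ} (hq : q ≠ (0, [])) :
    q.1 + q.2.length = (positionParent q).1 + (positionParent q).2.length + 1 := by
  obtain ⟨i, u⟩ := q
  rcases List.eq_nil_or_concat' u with rfl | ⟨u, k, rfl⟩
  · cases i with
    | zero => exact absurd rfl hq
    | succ i => rw [positionParent_nil, Nat.add_sub_cancel, List.length_nil, add_zero, add_zero]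
  · rw [positionParent_concat, List.length_append, List.length_singleton, add_assoc]

lemma isParentMap_positionParent : IsParentMap positionParent (0, []) :=
  .of_lt (fun q => q.1 + q.2.length) (positionParent_nil 0) fun _ hq =>
    Nat.lt_of_lt_of_eq (Nat.lt_succ_self _) (fst_add_length_positionParent hq).symm

lemma depth_positionParent (q : ℕ × List ℕ) :
    depth positionParent (0, []) q = q.1 + q.2.length := by
  induction q using isParentMap_positionParent.induction with
  | root => exact isParentMap_positionParent.depth_root
  | parent q hq ih =>
    rw [isParentMap_positionParent.depth_eq_succ hq, ih, ← fst_add_length_positionParent hq]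

lemma positionParent_eq_iff {i j : ℕ} {u w : List ℕ} :
    positionParent (i, u) = (j, w) ↔
      (i = j ∧ ∃ k, u = w ++ [k]) ∨ (u = [] ∧ w = [] ∧ i - 1 = j) := by
  rcases List.eq_nil_or_concat' u with rfl | ⟨u, k, rfl⟩
  · rw [positionParent_nil, Prod.mk.injEq, eq_comm (a := []), and_comm]
    simp
  · simp [positionParent_concat]

lemma parentGraph_positionParent_adj {i j : ℕ} {u w : List ℕ} :
    (parentGraph positionParent).Adj (i, u) (j, w) ↔
      (i = j ∧ ParentChild u w) ∨ (u = [] ∧ w = [] ∧ (j = i + 1 ∨ i = j + 1)) := by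
  have hself := not_parentChild_self u
  simp only [parentGraph_adj, positionParent_eq_iff, ParentChild] at hself ⊢
  grind

end Positions

section FamilyTrees

variable {W V : Type*} {p : W → W} {x : W} {r : ℕ}

namespace IsTreeEmbedding

variable {P : Type*} {σ : V → V} {v : V} {τ : P → P} {o : P} {pos : V → P}

lemma isParentMap (hpos : IsTreeEmbedding σ v τ o pos) (hτ : IsParentMap τ o) :
    IsParentMap σ v where
  root := hpos.inj (by rw [hpos.map_parent.eq, hpos.map_root, hτ.root])
  reach u := (hτ.reach (pos u)).imp fun _ => hpos.iterate_eq_root_iff.1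

lemma depth_eq (hpos : IsTreeEmbedding σ v τ o pos) (hτ : IsParentMap τ o) (u : V) :
    depth τ o (pos u) = depth σ v u :=
  eq_of_forall_ge_iff fun n => by
    rw [hτ.depth_le_iff, (hpos.isParentMap hτ).depth_le_iff, hpos.iterate_eq_root_iff]

lemma comp_iff (hpos : IsTreeEmbedding σ v τ o pos) {f : W → V} :
    IsTreeEmbedding p x τ o (pos ∘ f) ↔ IsTreeEmbedding p x σ v f := by
  refine ⟨fun h => ⟨h.inj.of_comp, hpos.inj (h.map_root.trans hpos.map_root.symm), fun w => ?_⟩,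
    fun h => ⟨hpos.inj.comp h.inj, (congrArg pos h.map_root).trans hpos.map_root, ?_⟩⟩
  · exact hpos.inj ((h.map_parent w).trans (hpos.map_parent (f w)).symm)
  · exact hpos.map_parent.comp_left h.map_parent

end IsTreeEmbedding

/-- `g` is an embedding of a rooted tree into the tree of positions which, as an embedding into the
subtree with vertex set `S`, is saturated at the vertices of depth less than `r`. -/
structure IsSaturatedWithin (p : W → W) (x : W) (r : ℕ) (S : Set (ℕ × List ℕ))
    (g : W → ℕ × List ℕ) : Prop extends IsTreeEmbedding p x positionParent (0, []) g where
  mem : ∀ w, g w ∈ S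
  mem_range : ∀ q ∈ S, ∀ w, depth p x w < r → positionParent q = g w → q ∈ Set.range g

lemma IsTreeEmbedding.isSaturatedWithin_comp_iff {σ : V → V} {v : V} {pos : V → ℕ × List ℕ}
    (hpos : IsTreeEmbedding σ v positionParent (0, []) pos) {f : W → V} :
    IsSaturatedWithin p x r (Set.range pos) (pos ∘ f) ↔
      IsSaturatedEmbedding p x {w | depth p x w < r} σ v f := by
  refine ⟨fun h => ⟨hpos.comp_iff.1 h.toIsTreeEmbedding, ?_⟩,
    fun h => ⟨hpos.comp_iff.2 h.toIsTreeEmbedding, fun w => ⟨f w, rfl⟩, ?_⟩⟩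
  · rintro u ⟨w, hw, hwu⟩
    obtain ⟨u', hu'⟩ := h.mem_range (pos u) ⟨u, rfl⟩ w hw
      ((hpos.map_parent u).symm.trans (congrArg pos hwu.symm))
    exact ⟨u', hpos.inj hu'⟩
  · rintro _ ⟨u, rfl⟩ w hw hwu
    obtain ⟨u', rfl⟩ := h.mem_range u ⟨w, hw, hpos.inj (hwu.symm.trans (hpos.map_parent u).symm)⟩
    exact ⟨u', rfl⟩

lemma IsTreeEmbedding.card_isSaturatedEmbedding_eq {σ : V → V} {v : V} {pos : V → ℕ × List ℕ}
    (hpos : IsTreeEmbedding σ v positionParent (0, []) pos) :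
    Nat.card {f : W → V // IsSaturatedEmbedding p x {w | depth p x w < r} σ v f} =
      Nat.card {g : W → ℕ × List ℕ // IsSaturatedWithin p x r (Set.range pos) g} := by
  refine Nat.card_congr (Equiv.ofBijective
    (fun f => ⟨pos ∘ f.1, hpos.isSaturatedWithin_comp_iff.2 f.2⟩) ⟨fun f f' h => ?_, ?_⟩)
  · exact Subtype.ext (hpos.inj.comp_left (congrArg Subtype.val h))
  · rintro ⟨g, hg⟩
    choose f hf using hg.mem
    obtain rfl : pos ∘ f = g := funext hf
    exact ⟨⟨f, hpos.isSaturatedWithin_comp_iff.1 hg⟩, rfl⟩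

lemma IsParentMap.depth_parent (hp : IsParentMap p x) (w : W) :
    depth p x (p w) = depth p x w - 1 := by
  by_cases hw : w = x
  · rw [hw, hp.root, hp.depth_root]
  · rw [hp.depth_eq_succ hw, Nat.add_sub_cancel]

lemma IsParentMap.depth_iterate (hp : IsParentMap p x) (w : W) (n : ℕ) :
    depth p x (p^[n] w) = depth p x w - n := by
  induction n with
  | zero => rfl
  | succ n ih => rw [Function.iterate_succ_apply', hp.depth_parent, ih, Nat.sub_sub]

section Saturated

variable {S : Set (ℕ × List ℕ)} {ω : ℕ × List ℕ → ℕ} {g : W → ℕ × List ℕ}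

lemma IsTreeEmbedding.fst_add_length (hg : IsTreeEmbedding p x positionParent (0, []) g) (w : W) :
    (g w).1 + (g w).2.length = depth p x w := by
  rw [← depth_positionParent, hg.depth_eq isParentMap_positionParent]

lemma IsTreeEmbedding.eq_of_snd_eq_nil (hg : IsTreeEmbedding p x positionParent (0, []) g) {w : W}
    (hw : (g w).2 = []) : g w = (depth p x w, []) := by
  rw [← hg.fst_add_length w, hw]
  exact Prod.ext rfl hw

lemma IsTreeEmbedding.isSpine (hg : IsTreeEmbedding p x positionParent (0, []) g) :
    IsSpine p x {w | (g w).2 = []} where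
  root := congrArg Prod.snd hg.map_root
  parent w hw := by
    rw [Set.mem_ofPred_eq, hg.map_parent w, positionParent, if_pos (show (g w).2 = [] from hw)]
  inj a ha b hb h := hg.inj (by rw [hg.eq_of_snd_eq_nil ha, hg.eq_of_snd_eq_nil hb, h])

lemma IsSaturatedWithin.isPlacement (hg : IsSaturatedWithin p x r S g)
    (hS : ∀ i u k, (i, u ++ [k]) ∈ S ↔ (i, u) ∈ S ∧ k < ω (i, u)) :
    IsPlacement p x r {w | (g w).2 = []} ω g where
  inj := hg.inj
  spine _ hw := hg.eq_of_snd_eq_nil hw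
  child u hu := by
    obtain ⟨s, k, hs⟩ := (List.eq_nil_or_concat' (g u).2).resolve_left hu
    have hgu : g u = ((g u).1, s ++ [k]) := Prod.ext rfl hs
    have hgp : g (p u) = ((g u).1, s) := by
      rw [hg.map_parent u, hgu, positionParent_concat]
    rw [hgp]
    exact ⟨k, ((hS _ _ _).1 (hgu ▸ hg.mem u)).2, hgu⟩
  surj w hw k hk := by
    obtain ⟨u, hu⟩ :=
      hg.mem_range _ ((hS _ _ _).2 ⟨hg.mem w, hk⟩) w hw (positionParent_concat _ _ _)
    refine ⟨u, fun hnil => ?_, hg.inj ?_, hu⟩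
    · exact List.append_ne_nil_of_right_ne_nil _ (List.cons_ne_nil _ _)
        ((congrArg Prod.snd hu).symm.trans hnil)
    · rw [hg.map_parent u, hu, positionParent_concat]

lemma IsPlacement.isTreeEmbedding {Q : Set W} (hg : IsPlacement p x r Q ω g)
    (hp : IsParentMap p x) (hQ : IsSpine p x Q) :
    IsTreeEmbedding p x positionParent (0, []) g where
  inj := hg.inj
  map_root := by rw [hg.spine x hQ.root, hp.depth_root]
  map_parent w := by
    by_cases hw : w ∈ Q
    · rw [hg.spine w hw, positionParent_nil, hg.spine _ (hQ.parent w hw), hp.depth_parent]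
    · obtain ⟨k, -, hgw⟩ := hg.child w hw
      rw [hgw, positionParent_concat]

lemma IsPlacement.isSaturatedWithin {Q : Set W} (hg : IsPlacement p x r Q ω g)
    (hp : IsParentMap p x) (hQ : IsSpine p x Q)
    (hS : ∀ i u k, (i, u ++ [k]) ∈ S ↔ (i, u) ∈ S ∧ k < ω (i, u))
    (hline : ∀ w ∈ Q, (depth p x w, []) ∈ S)
    (hnext : ∀ i < r, (i + 1, []) ∈ S → ∃ w ∈ Q, depth p x w = i + 1) :
    IsSaturatedWithin p x r S g where
  toIsTreeEmbedding := hg.isTreeEmbedding hp hQ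
  mem w := by
    induction w using hp.induction with
    | root => exact hg.spine x hQ.root ▸ hline x hQ.root
    | parent u _ ih =>
      by_cases hu : u ∈ Q
      · exact hg.spine u hu ▸ hline u hu
      · obtain ⟨k, hk, hgu⟩ := hg.child u hu
        exact hgu ▸ (hS _ _ _).2 ⟨ih, hk⟩
  mem_range := by
    rintro ⟨i, s⟩ hq w hw hqw
    rcases List.eq_nil_or_concat' s with rfl | ⟨s, k, rfl⟩
    · cases i with
      | zero => exact ⟨x, (hg.isTreeEmbedding hp hQ).map_root⟩
      | succ i =>
        have hi : i = depth p x w := by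
          rw [← (hg.isTreeEmbedding hp hQ).fst_add_length, ← hqw, positionParent_nil]
          rfl
        obtain ⟨u, hu, hdepth⟩ := hnext i (hi ▸ hw) hq
        exact ⟨u, by rw [hg.spine u hu, hdepth]⟩
    · rw [positionParent_concat] at hqw
      obtain ⟨u, -, -, hu⟩ := hg.surj w hw k (hqw ▸ ((hS _ _ _).1 hq).2)
      exact ⟨u, by rw [hu, ← hqw]⟩

end Saturated

lemma mem_gwVertices_concat {ξ : List ℕ → ℕ} {u : List ℕ} {k : ℕ} :
    u ++ [k] ∈ gwVertices ξ ↔ u ∈ gwVertices ξ ∧ k < ξ u := by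
  constructor
  · intro h
    exact ⟨fun w j hw => h w j (hw.trans (List.prefix_append u [k])), h u k List.prefix_rfl⟩
  · rintro ⟨h, hk⟩ w j hw
    rcases List.prefix_concat_iff.1 hw with hw | hw
    · obtain ⟨rfl, rfl⟩ : w = u ∧ j = k := by simpa using hw
      exact hk
    · exact h w j hw

lemma dropLast_mem_gwVertices {ξ : List ℕ → ℕ} {u : List ℕ} (h : u ∈ gwVertices ξ) :
    u.dropLast ∈ gwVertices ξ :=
  fun w k hw => h w k (hw.trans (List.dropLast_prefix u))

/-- The parent map of the family tree. -/
def gwParent (ξ : List ℕ → ℕ) (u : gwVertices ξ) : gwVertices ξ :=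
  ⟨u.1.dropLast, dropLast_mem_gwVertices u.2⟩

/-- The position of an individual when the family tree is pasted onto the first vertex of the
line. -/
def gwPosition (ξ : List ℕ → ℕ) (u : gwVertices ξ) : ℕ × List ℕ := (0, u.1)

lemma isTreeEmbedding_gwPosition (ξ : List ℕ → ℕ) :
    IsTreeEmbedding (gwParent ξ) (gwRoot ξ) positionParent (0, []) (gwPosition ξ) where
  inj _ _ h := Subtype.ext (congrArg Prod.snd h)
  map_root := rfl
  map_parent := by
    rintro ⟨u, hu⟩
    rcases List.eq_nil_or_concat' u with rfl | ⟨u, k, rfl⟩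
    · rfl
    · exact Prod.ext (by simp [gwPosition, positionParent])
        (by simp [gwPosition, gwParent, positionParent])

lemma gwTree_eq_parentGraph (ξ : List ℕ → ℕ) : gwTree ξ = parentGraph (gwParent ξ) := by
  ext u w
  rw [← (isTreeEmbedding_gwPosition ξ).adj_iff, gwPosition, gwPosition,
    parentGraph_positionParent_adj]
  simp [gwTree]

lemma mem_range_gwPosition {ξ : List ℕ → ℕ} {i : ℕ} {u : List ℕ} :
    (i, u) ∈ Set.range (gwPosition ξ) ↔ i = 0 ∧ u ∈ gwVertices ξ := by
  simp [gwPosition, eq_comm, and_comm]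

lemma isSpine_singleton (hp : IsParentMap p x) : IsSpine p x {x} where
  root := rfl
  parent w hw := by rw [Set.mem_singleton_iff.1 hw, hp.root, Set.mem_singleton_iff]
  inj := Set.injOn_singleton _ _

lemma isSaturatedWithin_gwPosition_iff (hp : IsParentMap p x) {ξ : List ℕ → ℕ}
    {g : W → ℕ × List ℕ} :
    IsSaturatedWithin p x r (Set.range (gwPosition ξ)) g ↔
      IsPlacement p x r {x} (fun q => ξ q.2) g := by
  have hS : ∀ i u k, (i, u ++ [k]) ∈ Set.range (gwPosition ξ) ↔
      (i, u) ∈ Set.range (gwPosition ξ) ∧ k < ξ u := fun i u k => by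
    rw [mem_range_gwPosition, mem_range_gwPosition, mem_gwVertices_concat, and_assoc]
  refine ⟨fun hg => ?_, fun hg => hg.isSaturatedWithin hp (isSpine_singleton hp) hS ?_ ?_⟩
  · have hspine : {w | (g w).2 = []} = {x} := by
      refine Set.ext fun w => ⟨fun hw => hg.inj ?_, fun hw => ?_⟩
      · have hgw : g w = (0, []) := Prod.ext (mem_range_gwPosition.1 (hg.mem w)).1 hw
        exact hgw.trans hg.map_root.symm
      · rw [Set.mem_singleton_iff.1 hw]
        exact hg.isSpine.root
    exact hspine ▸ hg.isPlacement hS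
  · rintro w rfl
    exact mem_range_gwPosition.2 ⟨hp.depth_root, nil_mem_gwVertices ξ⟩
  · exact fun i _ hi => absurd (mem_range_gwPosition.1 hi).1 i.succ_ne_zero

open Classical in
lemma card_isPlacement_gwTree (hp : IsParentMap p x) (hr : ∀ w, depth p x w ≤ r)
    (ξ : List ℕ → ℕ) :
    Nat.card {g : W → ℕ × List ℕ // IsPlacement p x r {x} (fun q => ξ q.2) g} =
      if TruncationIs (gwTree ξ) (gwRoot ξ) r (parentGraph p) x then autCard (parentGraph p) x
      else 0 := by
  have hpos := isTreeEmbedding_gwPosition ξ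
  simp only [gwTree_eq_parentGraph, ← isSaturatedWithin_gwPosition_iff hp]
  rw [← hpos.card_isSaturatedEmbedding_eq,
    card_isSaturatedEmbedding hp (hpos.isParentMap isParentMap_positionParent) hr]

lemma positionParent_mem_spineVertices {ω : ℕ → List ℕ → ℕ} {q : ℕ × List ℕ}
    (hq : q ∈ spineVertices ω) : positionParent q ∈ spineVertices ω := by
  unfold positionParent
  split_ifs
  · exact nil_mem_gwVertices _
  · exact dropLast_mem_gwVertices (u := q.2) hq

/-- The parent map of a tree with a spine. -/
def spineParent (ω : ℕ → List ℕ → ℕ) (q : spineVertices ω) : spineVertices ω :=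
  ⟨positionParent q.1, positionParent_mem_spineVertices q.2⟩

lemma isTreeEmbedding_spineVertices (ω : ℕ → List ℕ → ℕ) :
    IsTreeEmbedding (spineParent ω) (spineRoot ω) positionParent (0, []) Subtype.val where
  inj := Subtype.val_injective
  map_root := rfl
  map_parent _ := rfl

lemma spineTree_eq_parentGraph (ω : ℕ → List ℕ → ℕ) :
    spineTree ω = parentGraph (spineParent ω) := by
  ext q q'
  exact parentGraph_positionParent_adj.symm.trans ((isTreeEmbedding_spineVertices ω).adj_iff q q')

lemma IsParentMap.iterate_depth_sub_eq (hp : IsParentMap p x) {b w : W} (h : Reach p b w) :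
    p^[depth p x b - depth p x w] b = w := by
  obtain ⟨n, rfl⟩ := h
  rw [hp.depth_iterate]
  rcases le_total n (depth p x b) with hn | hn
  · rw [Nat.sub_sub_self hn]
  · rw [Nat.sub_eq_zero_of_le hn, Nat.sub_zero, hp.iterate_of_le (hp.depth_le_iff.1 le_rfl) hn]
    exact hp.depth_le_iff.1 le_rfl

lemma isSpine_setOf_reach (hp : IsParentMap p x) (b : W) : IsSpine p x {w | Reach p b w} where
  root := hp.reach b
  parent _ hw := Reach.trans hw ⟨1, rfl⟩
  inj w hw w' hw' h := by
    rw [← hp.iterate_depth_sub_eq hw, ← hp.iterate_depth_sub_eq hw', h]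

lemma IsSpine.eq_setOf_reach {Q : Set W} (hQ : IsSpine p x Q) (hp : IsParentMap p x) {b : W}
    (hb : b ∈ Q) (hmax : ∀ w, depth p x w ≤ depth p x b) : Q = {w | Reach p b w} := by
  have iterate_mem : ∀ n, p^[n] b ∈ Q := fun n => by
    induction n with
    | zero => exact hb
    | succ n ih => exact Function.iterate_succ_apply' p n b ▸ hQ.parent _ ih
  refine Set.ext fun w => ⟨fun hw => ⟨depth p x b - depth p x w, ?_⟩, ?_⟩
  · refine hQ.inj (iterate_mem _) hw ?_
    rw [hp.depth_iterate, Nat.sub_sub_self (hmax w)]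
  · rintro ⟨n, rfl⟩
    exact iterate_mem n

lemma IsSaturatedWithin.exists_eq_line {ω : ℕ → List ℕ → ℕ} {g : W → ℕ × List ℕ}
    (hg : IsSaturatedWithin p x r (spineVertices ω) g) : ∀ j ≤ r, ∃ w, g w = (j, []) := by
  intro j
  induction j with
  | zero => exact fun _ => ⟨x, hg.map_root⟩
  | succ j ih =>
    intro hj
    obtain ⟨w, hw⟩ := ih (Nat.le_of_succ_le hj)
    have hdepth : depth p x w = j := by rw [← hg.fst_add_length, hw, List.length_nil, add_zero]
    exact hg.mem_range (j + 1, []) (nil_mem_gwVertices _) w (hdepth ▸ hj)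
      ((positionParent_nil _).trans hw.symm)

lemma isSaturatedWithin_spineVertices_iff (hp : IsParentMap p x) (hr : ∀ w, depth p x w ≤ r)
    {ω : ℕ → List ℕ → ℕ} {g : W → ℕ × List ℕ} :
    IsSaturatedWithin p x r (spineVertices ω) g ↔
      ∃ b, depth p x b = r ∧ IsPlacement p x r {w | Reach p b w} (fun q => ω q.1 q.2) g := by
  have hS : ∀ i u k, (i, u ++ [k]) ∈ spineVertices ω ↔ (i, u) ∈ spineVertices ω ∧ k < ω i u :=
    fun _ _ _ => mem_gwVertices_concat
  refine ⟨fun hg => ?_, fun ⟨b, hb, hg⟩ => ?_⟩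
  · obtain ⟨b, hgb⟩ := hg.exists_eq_line r le_rfl
    have hb : depth p x b = r := by rw [← hg.fst_add_length, hgb, List.length_nil, add_zero]
    refine ⟨b, hb, ?_⟩
    rw [← hg.isSpine.eq_setOf_reach hp (congrArg Prod.snd hgb) fun w => hb.symm ▸ hr w]
    exact hg.isPlacement hS
  · refine hg.isSaturatedWithin hp (isSpine_setOf_reach hp b) hS
      (fun _ _ => nil_mem_gwVertices _) fun i hi _ => ⟨p^[r - (i + 1)] b, ⟨_, rfl⟩, ?_⟩
    rw [hp.depth_iterate, hb, Nat.sub_sub_self hi]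

lemma card_exists_isPlacement (ω : ℕ × List ℕ → ℕ) :
    Nat.card {g : W → ℕ × List ℕ //
        ∃ b, depth p x b = r ∧ IsPlacement p x r {w | Reach p b w} ω g} =
      Nat.card (Σ b : {b // depth p x b = r},
        {g : W → ℕ × List ℕ // IsPlacement p x r {w | Reach p b.1 w} ω g}) := by
  refine (Nat.card_congr (Equiv.ofBijective
    (fun q => ⟨q.2.1, q.1.1, q.1.2, q.2.2⟩) ⟨?_, ?_⟩)).symm
  · rintro ⟨⟨b, hb⟩, g, hg⟩ ⟨⟨b', hb'⟩, g', hg'⟩ h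
    obtain rfl : g = g' := congrArg Subtype.val h
    obtain rfl : b = b' := hg.inj <| by
      rw [hg.spine b (Reach.refl _ _), hg'.spine b' (Reach.refl _ _), hb, hb']
    rfl
  · rintro ⟨g, b, hb, hg⟩
    exact ⟨⟨⟨b, hb⟩, g, hg⟩, rfl⟩

open Classical in
lemma card_isPlacement_spineTree (hp : IsParentMap p x) (hr : ∀ w, depth p x w ≤ r)
    (ω : ℕ → List ℕ → ℕ) :
    Nat.card (Σ b : {b // depth p x b = r}, {g : W → ℕ × List ℕ //
        IsPlacement p x r {w | Reach p b.1 w} (fun q => ω q.1 q.2) g}) =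
      if TruncationIs (spineTree ω) (spineRoot ω) r (parentGraph p) x then autCard (parentGraph p) x
      else 0 := by
  have hpos := isTreeEmbedding_spineVertices ω
  rw [spineTree_eq_parentGraph, ← card_exists_isPlacement,
    ← card_isSaturatedEmbedding hp (hpos.isParentMap isParentMap_positionParent) hr,
    hpos.card_isSaturatedEmbedding_eq, Subtype.range_coe]
  simp only [isSaturatedWithin_spineVertices_iff hp hr]

end FamilyTrees

/-! ### Independence -/

section Independence

section Counting

variable {Ω ι : Type*} [Finite ι] {E : ι → Set Ω} {S : Set Ω} [DecidablePred (· ∈ S)]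
  {A : ℕ}

lemma eq_iUnion_of_card_eq_ite (hA : 0 < A)
    (hcard : ∀ ω, Nat.card {j // ω ∈ E j} = if ω ∈ S then A else 0) : S = ⋃ j, E j := by
  refine Set.ext fun ω => ?_
  have hpos : (0 < if ω ∈ S then A else 0) ↔ ω ∈ S := by
    split_ifs with hω <;> simp [hω, hA]
  rw [← hpos, ← hcard, Finite.card_pos_iff, nonempty_subtype, Set.mem_iUnion]

lemma measureReal_mul_eq_sum [Fintype ι] [MeasurableSpace Ω] (μ : Measure Ω) [IsFiniteMeasure μ]
    (hE : ∀ j, MeasurableSet (E j)) (hA : 0 < A)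
    (hcard : ∀ ω, Nat.card {j // ω ∈ E j} = if ω ∈ S then A else 0) :
    μ.real S * A = ∑ j, μ.real (E j) := by
  classical
  have hS : MeasurableSet S :=
    eq_iUnion_of_card_eq_ite hA hcard ▸ MeasurableSet.iUnion hE
  have hsum : ∀ ω, S.indicator (fun _ => (A : ℝ)) ω =
      ∑ j, (E j).indicator (fun _ => (1 : ℝ)) ω := fun ω => by
    simp only [Set.indicator_apply, Finset.sum_boole, ← Fintype.card_subtype,
      ← Nat.card_eq_fintype_card, hcard, Nat.cast_ite, Nat.cast_zero]
  calc μ.real S * A = ∫ ω, S.indicator (fun _ => (A : ℝ)) ω ∂μ := by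
        rw [integral_indicator_const _ hS, smul_eq_mul]
    _ = ∫ ω, ∑ j, (E j).indicator (fun _ => (1 : ℝ)) ω ∂μ :=
        integral_congr_ae (.of_forall hsum)
    _ = ∑ j, ∫ ω, (E j).indicator (fun _ => (1 : ℝ)) ω ∂μ :=
        integral_finsetSum _ fun j _ => (integrable_const _).indicator (hE j)
    _ = ∑ j, μ.real (E j) := Finset.sum_congr rfl fun j _ => by
        rw [integral_indicator_const _ (hE j), smul_eq_mul, mul_one]

end Counting

lemma hasSum_measureReal_inter_fiber {Ω : Type*} [MeasurableSpace Ω] (μ : Measure Ω)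
    [IsFiniteMeasure μ] {f : Ω → ℕ} (hf : Measurable f) (S : Set Ω) :
    HasSum (fun k => μ.real (S ∩ {ω | f ω = k})) (μ.real S) := by
  have hfiber : ∀ k, MeasurableSet (f ⁻¹' {k}) := fun k => hf (measurableSet_singleton k)
  have htsum : ∑' k, μ (S ∩ f ⁻¹' {k}) = μ S := by
    have h := tsum_measure_preimage_singleton (μ := μ.restrict S) Set.countable_univ
      fun k _ => hfiber k
    rw [tsum_univ fun k => μ.restrict S (f ⁻¹' {k}), Set.preimage_univ,
      Measure.restrict_apply_univ] at h
    simpa only [Measure.restrict_apply (hfiber _), Set.inter_comm _ S] using h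
  rw [measureReal_def, ← htsum, ENNReal.tsum_toReal_eq fun _ => measure_ne_top _ _]
  exact (ENNReal.summable_toReal (htsum ▸ measure_ne_top _ _)).hasSum

section InfiniteProduct

variable {J X : Type*} [MeasurableSpace X] (ν : Measure X) [IsProbabilityMeasure ν]

lemma infinitePi_forall_mem {ι : Type*} [Fintype ι] {κ : ι → Type*} {Z : (Σ i, κ i) → J}
    (hZ : Function.Injective Z) {T : ∀ i, Set (κ i → X)} (hT : ∀ i, MeasurableSet (T i)) :
    Measure.infinitePi (fun _ : J => ν) {ω | ∀ i, (fun u => ω (Z ⟨i, u⟩)) ∈ T i} =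
      ∏ i, Measure.infinitePi (fun _ : κ i => ν) (T i) := by
  have hmap := Measure.infinitePi_map_piCurry (κ := κ) (X := fun _ _ => X) (fun _ _ => ν)
  rw [← Measure.map_infinitePi_infinitePi_of_inj (P := fun _ : J => ν) hZ,
    Measure.map_map (by fun_prop) (by fun_prop)] at hmap
  rw [← Measure.pi_pi, ← Measure.infinitePi_eq_pi, ← hmap, Measure.map_apply (by fun_prop)
    (MeasurableSet.univ_pi hT)]
  refine congrArg _ (Set.ext fun ω => ?_)
  rw [Set.mem_preimage, Set.mem_univ_pi]
  rfl

variable {A B : Type*} [Fintype A] [Fintype B] {a : A → J}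

lemma infinitePi_forall_apply_mem (ha : Function.Injective a) {s : A → Set X}
    (hs : ∀ i, MeasurableSet (s i)) :
    Measure.infinitePi (fun _ : J => ν) {ω | ∀ i, ω (a i) ∈ s i} = ∏ i, ν (s i) := by
  have hset : {ω : J → X | ∀ i, ω (a i) ∈ s i} = (fun ω i => ω (a i)) ⁻¹' Set.univ.pi s := by
    ext ω
    simp
  rw [hset, ← Measure.map_apply (by fun_prop) (.univ_pi hs),
    Measure.map_infinitePi_infinitePi_of_inj (P := fun _ : J => ν) ha,
    Measure.infinitePi_eq_pi, Measure.pi_pi]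

lemma infinitePi_forall_apply_mem_and_forall_mem {K : Type*} {b : B → K → J}
    (ha : Function.Injective a) (hb : ∀ j j' u u', b j u = b j' u' → j = j' ∧ u = u')
    (hab : ∀ i j u, a i ≠ b j u) {s : A → Set X} (hs : ∀ i, MeasurableSet (s i))
    {S : Set (K → X)} (hS : MeasurableSet S) :
    Measure.infinitePi (fun _ : J => ν)
        {ω | (∀ i, ω (a i) ∈ s i) ∧ ∀ j, (fun u => ω (b j u)) ∈ S} =
      (∏ i, ν (s i)) * Measure.infinitePi (fun _ : K => ν) S ^ Fintype.card B := by
  let κ : A ⊕ B → Type _ := Sum.elim (fun _ => PUnit) fun _ => K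
  let Z : (Σ c, κ c) → J
    | ⟨Sum.inl i, _⟩ => a i
    | ⟨Sum.inr j, u⟩ => b j u
  let T : ∀ c, Set (κ c → X)
    | Sum.inl i => {g | g PUnit.unit ∈ s i}
    | Sum.inr _ => S
  have hZ : Function.Injective Z := by
    rintro ⟨i | i, u⟩ ⟨j | j, w⟩ h
    · cases ha h
      rfl
    · exact absurd h (hab i j w)
    · exact absurd h.symm (hab j i u)
    · obtain ⟨rfl, rfl⟩ := hb i j u w h
      rfl
  have hT : ∀ c, MeasurableSet (T c)
    | Sum.inl i => (measurable_pi_apply PUnit.unit) (hs i)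
    | Sum.inr _ => hS
  have hprod := infinitePi_forall_mem ν hZ hT
  rw [Fintype.prod_sum_type] at hprod
  calc _ = Measure.infinitePi (fun _ : J => ν) {ω | ∀ c, (fun u => ω (Z ⟨c, u⟩)) ∈ T c} :=
        congrArg _ (Set.ext fun ω => Sum.forall.symm)
    _ = _ := hprod
    _ = _ := by
        congr 1
        · exact Finset.prod_congr rfl fun i _ =>
            (measurePreserving_eval_infinitePi _ PUnit.unit).measure_preimage
              (hs i).nullMeasurableSet
        · exact Finset.prod_const (Measure.infinitePi (fun _ : K => ν) S)

end InfiniteProduct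

section Poisson

variable {A B J : Type*} [Fintype A] [Fintype B]

lemma poissonMeasure_one_real_singleton (k : ℕ) :
    (poissonMeasure 1).real {k} = Real.exp (-1) / k.factorial := by
  simp [poissonMeasure_real_singleton]

lemma infinitePi_poisson_forall_eq {a : A → J} (ha : Function.Injective a) (k : A → ℕ) :
    (Measure.infinitePi fun _ : J => poissonMeasure 1).real {ω | ∀ i, ω (a i) = k i} =
      ∏ i, Real.exp (-1) / (k i).factorial := by
  have h := congrArg ENNReal.toReal (infinitePi_forall_apply_mem (poissonMeasure 1) ha
    fun i => measurableSet_singleton (k i))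
  rw [ENNReal.toReal_prod] at h
  exact h.trans (Finset.prod_congr rfl fun i _ => poissonMeasure_one_real_singleton (k i))

lemma spineMeasure_forall_eq {a : A → ℕ × List ℕ} (ha : Function.Injective a) (k : A → ℕ) :
    spineMeasure.real {ω | ∀ i, ω (a i).1 (a i).2 = k i} =
      ∏ i, Real.exp (-1) / (k i).factorial := by
  have hcurry := Measure.infinitePi_map_curry (fun (_ : ℕ) (_ : List ℕ) => poissonMeasure 1)
  rw [← infinitePi_poisson_forall_eq ha k, spineMeasure, gwMeasure, ← hcurry, measureReal_def,
    measureReal_def, MeasurableEquiv.map_apply]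
  rfl

lemma gwMeasure_forall_eq_and_forall_mem {a : A → List ℕ} {b : B → List ℕ}
    (ha : Function.Injective a) (hb : ∀ i j u w, b i ++ u = b j ++ w → i = j)
    (hab : ∀ i j u, a i ≠ b j ++ u) (k : A → ℕ) {S : Set (List ℕ → ℕ)} (hS : MeasurableSet S) :
    gwMeasure.real {ξ | (∀ i, ξ (a i) = k i) ∧ ∀ j, (fun u => ξ (b j ++ u)) ∈ S} =
      (∏ i, Real.exp (-1) / (k i).factorial) * gwMeasure.real S ^ Fintype.card B := by
  have append_inj : ∀ i j u w, b i ++ u = b j ++ w → i = j ∧ u = w := fun i j u w h => by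
    obtain rfl := hb i j u w h
    exact ⟨rfl, List.append_cancel_left h⟩
  have h := congrArg ENNReal.toReal (infinitePi_forall_apply_mem_and_forall_mem (poissonMeasure 1)
    ha append_inj hab (fun i => measurableSet_singleton (k i)) hS)
  rw [ENNReal.toReal_mul, ENNReal.toReal_prod, ENNReal.toReal_pow] at h
  exact h.trans (congrArg (· * _)
    (Finset.prod_congr rfl fun i _ => poissonMeasure_one_real_singleton (k i)))

end Poisson

end Independence

/-! ### Survival of the Poisson(1) Galton–Watson tree -/

section Survival

lemma append_mem_gwVertices {ξ : List ℕ → ℕ} {v u : List ℕ} :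
    v ++ u ∈ gwVertices ξ ↔ v ∈ gwVertices ξ ∧ u ∈ gwVertices (fun u => ξ (v ++ u)) := by
  induction u using List.reverseRecOn with
  | nil => rw [List.append_nil, and_iff_left (nil_mem_gwVertices _)]
  | append_singleton u k ih => rw [← List.append_assoc, mem_gwVertices_concat, ih,
      mem_gwVertices_concat, and_assoc]

lemma survives_zero (ξ : List ℕ → ℕ) : Survives 0 ξ := ⟨[], nil_mem_gwVertices ξ, rfl⟩

lemma survives_add {m n : ℕ} {ξ : List ℕ → ℕ} :
    Survives (m + n) ξ ↔
      ∃ v ∈ gwVertices ξ, v.length = m ∧ Survives n (fun u => ξ (v ++ u)) := by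
  constructor
  · rintro ⟨u, hu, hlen⟩
    rw [← List.take_append_drop m u, append_mem_gwVertices] at hu
    refine ⟨u.take m, hu.1, ?_, u.drop m, hu.2, ?_⟩
    · rw [List.length_take]
      omega
    · rw [List.length_drop]
      omega
  · rintro ⟨v, hv, rfl, u, hu, rfl⟩
    exact ⟨v ++ u, append_mem_gwVertices.2 ⟨hv, hu⟩, List.length_append⟩

lemma survives_succ {N : ℕ} {ξ : List ℕ → ℕ} :
    Survives (N + 1) ξ ↔ ∃ i < ξ [], Survives N (fun u => ξ ([i] ++ u)) := by
  rw [add_comm, survives_add]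
  constructor
  · rintro ⟨v, hv, hlen, h⟩
    obtain ⟨i, rfl⟩ := List.length_eq_one_iff.1 hlen
    exact ⟨i, (mem_gwVertices_concat (u := []).1 hv).2, h⟩
  · rintro ⟨i, hi, h⟩
    exact ⟨[i], mem_gwVertices_concat (u := []).2 ⟨nil_mem_gwVertices ξ, hi⟩, rfl, h⟩

lemma measurableSet_survives (N : ℕ) : MeasurableSet {ξ | Survives N ξ} := by
  have hset : {ξ | Survives N ξ} = ⋃ u ∈ {u : List ℕ | u.length = N},
      ⋂ (w : List ℕ), ⋂ (k : ℕ), ⋂ (_ : w ++ [k] <+: u), {ξ | k < ξ w} := by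
    ext ξ
    simp only [Survives, gwVertices, Set.mem_ofPred_eq, Set.mem_iUnion, Set.mem_iInter,
      exists_prop, and_comm]
  rw [hset]
  exact .biUnion (Set.to_countable _) fun u _ => .iInter fun w => .iInter fun k => .iInter fun _ =>
    measurableSet_lt measurable_const (measurable_pi_apply w)

/-- The probability that the Poisson(1) Galton–Watson tree survives for at least `N`
generations. -/
def survProb (N : ℕ) : ℝ := gwMeasure.real {ξ | Survives N ξ}

lemma survProb_zero : survProb 0 = 1 := by
  simp only [survProb, survives_zero, Set.ofPred_true, probReal_univ]

lemma measureReal_not_survives (N : ℕ) :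
    gwMeasure.real {ξ | Survives N ξ}ᶜ = 1 - survProb N :=
  probReal_compl_eq_one_sub (measurableSet_survives N)

lemma measureReal_not_survives_succ_inter (N k : ℕ) :
    gwMeasure.real ({ξ | Survives (N + 1) ξ}ᶜ ∩ {ξ | ξ [] = k}) =
      Real.exp (-1) * ((1 - survProb N) ^ k / k.factorial) := by
  have h := gwMeasure_forall_eq_and_forall_mem (A := Unit) (B := Fin k) (a := fun _ => [])
    (b := fun j => [(j : ℕ)]) (Function.injective_of_subsingleton _)
    (fun i j u w h => Fin.ext (List.cons.inj h).1) (fun _ j u => (List.cons_ne_nil (j : ℕ) u).symm)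
    (fun _ => k) (measurableSet_survives N).compl
  rw [Fintype.card_fin, Fintype.prod_unique, measureReal_not_survives] at h
  rw [mul_div_left_comm, mul_comm, ← h]
  refine congrArg _ (Set.ext fun ξ => ?_)
  simp only [Set.mem_inter_iff, Set.mem_compl_iff, Set.mem_ofPred_eq, survives_succ, forall_const,
    not_exists, not_and, and_comm (b := ξ [] = k)]
  refine and_congr_right fun hk => ?_
  rw [hk]
  exact ⟨fun h j => h j j.2, fun h i hi => h ⟨i, hi⟩⟩

lemma survProb_succ (N : ℕ) : survProb (N + 1) = 1 - Real.exp (-survProb N) := by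
  have hsum := hasSum_measureReal_inter_fiber gwMeasure (measurable_pi_apply [])
    {ξ | Survives (N + 1) ξ}ᶜ
  simp only [measureReal_not_survives_succ_inter, measureReal_not_survives] at hsum
  have hexp := (NormedSpace.expSeries_div_hasSum_exp (1 - survProb N)).mul_left (Real.exp (-1))
  rw [← Real.exp_eq_exp_ℝ, ← Real.exp_add, neg_add_eq_sub, sub_sub_cancel_left] at hexp
  rw [← hsum.unique hexp, sub_sub_cancel]

lemma survProb_pos (N : ℕ) : 0 < survProb N := by
  induction N with
  | zero => exact survProb_zero ▸ one_pos
  | succ N ih =>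
    rw [survProb_succ, sub_pos, Real.exp_lt_one_iff]
    exact neg_lt_zero.2 ih

lemma survProb_antitone : Antitone survProb := by
  refine antitone_nat_of_succ_le fun N => ?_
  rw [survProb_succ]
  linarith [Real.add_one_le_exp (-survProb N)]

lemma tendsto_survProb : Tendsto survProb atTop (𝓝 0) := by
  have bddBelow : BddBelow (Set.range survProb) :=
    ⟨0, Set.forall_mem_range.2 fun N => (survProb_pos N).le⟩
  have hlim := tendsto_atTop_ciInf survProb_antitone bddBelow
  set s := ⨅ N, survProb N
  have hlim_succ : Tendsto (fun N => survProb (N + 1)) atTop (𝓝 (1 - Real.exp (-s))) := by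
    simp only [survProb_succ]
    exact tendsto_const_nhds.sub ((Real.continuous_exp.tendsto _).comp hlim.neg)
  have fixed_point : 1 - Real.exp (-s) = s :=
    tendsto_nhds_unique hlim_succ ((tendsto_add_atTop_iff_nat 1).2 hlim)
  have hs : s = 0 := by
    by_contra hs
    linarith [Real.add_one_lt_exp (neg_ne_zero.2 hs)]
  rwa [hs] at hlim

lemma tendsto_survProb_succ_div :
    Tendsto (fun N => survProb (N + 1) / survProb N) atTop (𝓝 1) := by
  have hderiv : HasDerivAt (fun s : ℝ => 1 - Real.exp (-s)) 1 0 := by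
    simpa using ((hasDerivAt_neg (0 : ℝ)).exp).const_sub 1
  have hlim : Tendsto survProb atTop (𝓝[≠] 0) :=
    tendsto_nhdsWithin_iff.2 ⟨tendsto_survProb, .of_forall fun N => (survProb_pos N).ne'⟩
  refine (hderiv.tendsto_slope_zero.comp hlim).congr fun N => ?_
  simp [survProb_succ, div_eq_inv_mul]

lemma tendsto_survProb_add_div (r : ℕ) :
    Tendsto (fun N => survProb (r + N) / survProb N) atTop (𝓝 1) := by
  induction r with
  | zero => simp [(survProb_pos _).ne']
  | succ r ih =>
    have h := (tendsto_survProb_succ_div.comp (tendsto_add_atTop_nat r)).mul ih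
    rw [mul_one] at h
    refine h.congr fun N => ?_
    rw [Function.comp_apply, add_comm N r, div_mul_div_cancel₀ (survProb_pos _).ne',
      add_right_comm]

lemma tendsto_one_sub_pow_div_survProb (r m : ℕ) :
    Tendsto (fun N => (1 - (1 - survProb N) ^ m) / survProb (r + N)) atTop (𝓝 m) := by
  have hgeom : Tendsto (fun N => ∑ i ∈ Finset.range m, (1 - survProb N) ^ i) atTop (𝓝 m) := by
    simpa using tendsto_finsetSum (Finset.range m) fun i _ =>
      (tendsto_survProb.const_sub 1).pow i
  have h := hgeom.mul ((tendsto_survProb_add_div r).inv₀ one_ne_zero)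
  rw [inv_one, mul_one] at h
  refine h.congr fun N => ?_
  rw [inv_div, ← mul_neg_geom_sum (1 - survProb N) m, sub_sub_cancel, mul_comm (survProb N),
    mul_div_assoc]

end Survival

/-! ### The law of the truncated limit trees -/

section Laws

variable {W : Type*} {p : W → W} {x : W} {r : ℕ}

lemma sum_labelling_prod_div_factorial [Finite W] {Q : Set W} [Fintype (Labelling p Q)]
    [Fintype {w // depth p x w < r}] (hp : IsParentMap p x) (hr : ∀ w, depth p x w ≤ r)
    (hQ : IsSpine p x Q) :
    ∑ _e : Labelling p Q, ∏ w : {w // depth p x w < r},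
      Real.exp (-1) / (sideCard p Q w).factorial = Real.exp (-{w | depth p x w < r}.ncard) := by
  classical
  have := Fintype.ofFinite W
  have sideCard_eq_zero : ∀ w, ¬ depth p x w < r → sideCard p Q w = 0 := fun w hw =>
    have := isEmpty_sideChildren hp hr hQ hw
    Nat.card_of_isEmpty
  have hcard : Fintype.card (Labelling p Q) =
      ∏ w : {w // depth p x w < r}, (sideCard p Q w).factorial := by
    rw [← Nat.card_eq_fintype_card, card_labelling,
      ← Fintype.prod_subtype_mul_prod_subtype (fun w => depth p x w < r),
      Fintype.prod_eq_one fun w : {w // ¬ depth p x w < r} => (sideCard p Q w).factorial, mul_one]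
    · exact Finset.prod_congr (by congr!) fun _ _ => rfl
    · rintro ⟨w, hw⟩
      rw [sideCard_eq_zero w hw, Nat.factorial_zero]
  rw [Finset.sum_const, Finset.card_univ, hcard, nsmul_eq_mul, Finset.prod_div_distrib,
    Finset.prod_const, Finset.card_univ, Nat.cast_prod, mul_div_cancel₀]
  · rw [← Real.exp_nat_mul, mul_neg_one, ← Nat.card_eq_fintype_card, ← Nat.card_coe_set_eq]
    rfl
  · exact Finset.prod_ne_zero_iff.2 fun w _ => Nat.cast_ne_zero.2 (Nat.factorial_ne_zero _)

lemma card_depth_eq [Fintype W] [Fintype {b // depth p x b = r}] (hr : ∀ w, depth p x w ≤ r) :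
    (Fintype.card {b // depth p x b = r} : ℝ) =
      Fintype.card W - {w | depth p x w < r}.ncard := by
  have hcompl : {b | depth p x b = r} = {w | depth p x w < r}ᶜ := by
    ext w
    exact (hr w).ge_iff_eq.symm.trans not_lt.symm
  rw [← Nat.card_eq_fintype_card, ← Nat.card_eq_fintype_card,
    ← Set.ncard_add_ncard_compl {w | depth p x w < r}, ← hcompl, Nat.cast_add,
    add_sub_cancel_left]
  rfl

lemma measurableSet_forall_eq {Ω ι : Type*} [MeasurableSpace Ω] [Countable ι] {f : ι → Ω → ℕ}
    (hf : ∀ i, Measurable (f i)) (k : ι → ℕ) : MeasurableSet {ω | ∀ i, f i ω = k i} := by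
  rw [Set.ofPred_forall]
  exact .iInter fun i => measurableSet_eq_fun (hf i) measurable_const

section Spine

instance : IsProbabilityMeasure spineMeasure := by
  unfold spineMeasure
  infer_instance

theorem p1TruncProb_mul_autCard [Fintype W] (hp : IsParentMap p x)
    (hr : ∀ w, depth p x w ≤ r) :
    p1TruncProb r (parentGraph p) x * autCard (parentGraph p) x =
      Real.exp (-{w | depth p x w < r}.ncard) *
        (Fintype.card W - {w | depth p x w < r}.ncard) := by
  classical
  let E : (Σ b : {b // depth p x b = r}, Labelling p {w | Reach p b.1 w}) →
      Set (ℕ → List ℕ → ℕ) := fun j => {ω | ∀ w : {w // depth p x w < r},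
        ω (j.2.place x w).1 (j.2.place x w).2 = sideCard p {w | Reach p j.1.1 w} w}
  have hE : ∀ j, MeasurableSet (E j) := fun j => measurableSet_forall_eq (by fun_prop) _
  have hcard : ∀ ω, Nat.card {j // ω ∈ E j} =
      if TruncationIs (spineTree ω) (spineRoot ω) r (parentGraph p) x then
        autCard (parentGraph p) x else 0 := fun ω => by
    rw [← card_isPlacement_spineTree hp hr]
    refine Nat.card_congr (Equiv.trans ?_ (Equiv.sigmaCongrRight fun b =>
      labellingEquivPlacement hp hr (isSpine_setOf_reach hp b.1) _))
    exact ⟨fun j => ⟨j.1.1, j.1.2, fun w hw => j.2 ⟨w, hw⟩⟩,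
      fun j => ⟨⟨j.1, j.2.1⟩, fun w => j.2.2 w.1 w.2⟩, fun _ => rfl, fun _ => rfl⟩
  have hsum : ∀ b : {b // depth p x b = r}, ∑ e : Labelling p {w | Reach p b.1 w},
      spineMeasure.real (E ⟨b, e⟩) = Real.exp (-{w | depth p x w < r}.ncard) := fun b => by
    have hQ := isSpine_setOf_reach hp b.1
    rw [← sum_labelling_prod_div_factorial hp hr hQ]
    exact Finset.sum_congr rfl fun e _ =>
      spineMeasure_forall_eq ((e.place_injective hp hQ).comp Subtype.val_injective) _
  rw [p1TruncProb, measureReal_mul_eq_sum spineMeasure hE (autCard_pos (parentGraph p) x)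
      (S := {ω | TruncationIs (spineTree ω) (spineRoot ω) r (parentGraph p) x}) hcard,
    Fintype.sum_sigma, Finset.sum_congr rfl fun b _ => hsum b, Finset.sum_const, Finset.card_univ,
    nsmul_eq_mul, card_depth_eq hr, mul_comm]

end Spine

section ConditionedTree

namespace IsPlacement

variable {ξ : List ℕ → ℕ} {f : W → ℕ × List ℕ}

lemma exists_snd_eq (hf : IsPlacement p x r {x} (fun q => ξ q.2) f) (hp : IsParentMap p x)
    {u : List ℕ} (hu : u ∈ gwVertices ξ) (hlen : u.length ≤ r) : ∃ w, (f w).2 = u := by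
  have hsat := (isSaturatedWithin_gwPosition_iff hp).2 hf
  induction u using List.reverseRecOn with
  | nil => exact ⟨x, congrArg Prod.snd hsat.map_root⟩
  | append_singleton u k ih =>
    rw [List.length_append, List.length_singleton] at hlen
    obtain ⟨hu, hk⟩ := mem_gwVertices_concat.1 hu
    obtain ⟨w, rfl⟩ := ih hu (Nat.le_of_succ_le hlen)
    have hw : depth p x w < r := by
      rw [← hsat.fst_add_length w, (mem_range_gwPosition.1 (hsat.mem w)).1, zero_add]
      exact hlen
    obtain ⟨w', -, -, hw'⟩ := hf.surj w hw k hk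
    exact ⟨w', congrArg Prod.snd hw'⟩

lemma survives_add_iff (hf : IsPlacement p x r {x} (fun q => ξ q.2) f) (hp : IsParentMap p x)
    (M : ℕ) :
    Survives (r + M) ξ ↔
      ∃ b : {b // depth p x b = r}, Survives M (fun u => ξ ((f b).2 ++ u)) := by
  have hsat := (isSaturatedWithin_gwPosition_iff hp).2 hf
  have hmem := fun w => mem_range_gwPosition.1 (hsat.mem w)
  have hlen : ∀ w, (f w).2.length = depth p x w := fun w => by
    rw [← hsat.fst_add_length w, (hmem w).1, zero_add]
  rw [survives_add]
  constructor
  · rintro ⟨v, hv, hv_len, hsurv⟩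
    obtain ⟨b, rfl⟩ := hf.exists_snd_eq hp hv hv_len.le
    exact ⟨⟨b, (hlen b).symm.trans hv_len⟩, hsurv⟩
  · rintro ⟨b, hsurv⟩
    exact ⟨_, (hmem b).2, (hlen b).trans b.2, hsurv⟩

end IsPlacement

namespace Labelling

lemma fst_place_singleton (hp : IsParentMap p x) (e : Labelling p {x}) (w : W) :
    (e.place x w).1 = 0 := by
  induction w using hp.induction with
  | root => rw [e.place_of_mem rfl, hp.depth_root]
  | parent w hw ih => rw [e.place_of_notMem hp (isSpine_singleton hp) hw, ih]

lemma length_snd_place_singleton (hp : IsParentMap p x) (e : Labelling p {x}) (w : W) :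
    (e.place x w).2.length = depth p x w := by
  rw [← e.fst_add_length_place hp (isSpine_singleton hp), e.fst_place_singleton hp, zero_add]

lemma injective_snd_place_singleton (hp : IsParentMap p x) (e : Labelling p {x}) :
    Function.Injective fun w => (e.place x w).2 := fun w w' h =>
  e.place_injective hp (isSpine_singleton hp)
    (Prod.ext ((e.fst_place_singleton hp w).trans (e.fst_place_singleton hp w').symm) h)

/-- The event that the vertices of depth less than `r`, placed in the family tree according to
`e`, have the right number of children. -/
def event (x : W) (r : ℕ) (e : Labelling p {x}) : Set (List ℕ → ℕ) :=
  {ξ | ∀ w : {w // depth p x w < r}, ξ (e.place x w).2 = sideCard p {x} w}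

lemma measurableSet_event [Countable W] (e : Labelling p {x}) : MeasurableSet (e.event x r) :=
  measurableSet_forall_eq (by fun_prop) _

lemma measureReal_event_inter_forall_mem [Fintype {w // depth p x w < r}]
    [Fintype {b // depth p x b = r}] (hp : IsParentMap p x) (e : Labelling p {x})
    {S : Set (List ℕ → ℕ)} (hS : MeasurableSet S) :
    gwMeasure.real (e.event x r ∩
        {ξ | ∀ b : {b // depth p x b = r}, (fun u => ξ ((e.place x b).2 ++ u)) ∈ S}) =
      (∏ w : {w // depth p x w < r}, Real.exp (-1) / (sideCard p {x} w).factorial) *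
        gwMeasure.real S ^ Fintype.card {b // depth p x b = r} := by
  have hinj := e.injective_snd_place_singleton hp
  have hlen := e.length_snd_place_singleton hp
  refine gwMeasure_forall_eq_and_forall_mem (hinj.comp Subtype.val_injective)
    (fun b b' u u' h => ?_) (fun w b u h => ?_) (fun w => sideCard p {x} w.1) hS
  · exact Subtype.ext (hinj (List.append_inj h (by rw [hlen, hlen, b.2, b'.2])).1)
  · have hw : depth p x w < r := w.2
    have hlen_append := congrArg List.length h
    rw [Function.comp_apply, List.length_append, hlen, hlen, b.2] at hlen_append
    exact hw.not_ge (hlen_append ▸ Nat.le_add_right _ _)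

lemma measureReal_event_inter_survives [Finite W] [Fintype {w // depth p x w < r}]
    [Fintype {b // depth p x b = r}] (hp : IsParentMap p x) (hr : ∀ w, depth p x w ≤ r)
    (e : Labelling p {x}) (M : ℕ) :
    gwMeasure.real (e.event x r ∩ {ξ | Survives (r + M) ξ}) =
      (∏ w : {w // depth p x w < r}, Real.exp (-1) / (sideCard p {x} w).factorial) *
        (1 - (1 - survProb M) ^ Fintype.card {b // depth p x b = r}) := by
  have hevent := e.measureReal_event_inter_forall_mem (r := r) hp MeasurableSet.univ
  have hextinct := e.measureReal_event_inter_forall_mem (r := r) hp (measurableSet_survives M).compl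
  have hsdiff : e.event x r \ {ξ | Survives (r + M) ξ} = e.event x r ∩
      {ξ | ∀ b : {b // depth p x b = r},
        (fun u => ξ ((e.place x b).2 ++ u)) ∈ {ξ | Survives M ξ}ᶜ} := by
    refine Set.ext fun ξ => and_congr_right fun hξ => ?_
    have hplace := e.isPlacement_place hp hr (isSpine_singleton hp) (ω := fun q => ξ q.2)
      fun w hw => hξ ⟨w, hw⟩
    exact (not_congr (hplace.survives_add_iff hp M)).trans not_exists
  simp only [Set.mem_univ, implies_true, Set.ofPred_true, Set.inter_univ, probReal_univ, one_pow,
    mul_one] at hevent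
  rw [measureReal_not_survives, ← hsdiff] at hextinct
  rw [mul_sub, mul_one, ← hextinct, ← hevent]
  exact eq_sub_of_add_eq (measureReal_inter_add_sdiff (measurableSet_survives (r + M)))

end Labelling

theorem gwCondTruncProb_mul_autCard [Finite W] [Fintype {b // depth p x b = r}]
    (hp : IsParentMap p x) (hr : ∀ w, depth p x w ≤ r) (M : ℕ) :
    gwCondTruncProb (r + M) r (parentGraph p) x * autCard (parentGraph p) x =
      Real.exp (-{w | depth p x w < r}.ncard) *
        ((1 - (1 - survProb M) ^ Fintype.card {b // depth p x b = r}) / survProb (r + M)) := by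
  classical
  have := Fintype.ofFinite W
  have hQ := isSpine_singleton hp
  have hcard : ∀ ξ, Nat.card {e : Labelling p {x} //
      ξ ∈ e.event x r ∩ {ξ | Survives (r + M) ξ}} =
      if ξ ∈ {ξ | Survives (r + M) ξ ∧ TruncationIs (gwTree ξ) (gwRoot ξ) r (parentGraph p) x}
        then autCard (parentGraph p) x else 0 := fun ξ => by
    by_cases hsurv : Survives (r + M) ξ
    · simp only [Set.mem_ofPred_eq, hsurv, true_and]
      rw [← card_isPlacement_gwTree hp hr, ← Nat.card_congr (labellingEquivPlacement hp hr hQ _)]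
      exact Nat.card_congr (Equiv.subtypeEquivRight fun e =>
        ⟨fun h w hw => h.1 ⟨w, hw⟩, fun h => ⟨fun w => h w.1 w.2, hsurv⟩⟩)
    · rw [if_neg fun h => hsurv h.1, Nat.card_eq_zero]
      exact Or.inl ⟨fun e => hsurv e.2.2⟩
  have hmeas : ∀ e : Labelling p {x},
      MeasurableSet (e.event x r ∩ {ξ | Survives (r + M) ξ}) :=
    fun e => e.measurableSet_event.inter (measurableSet_survives _)
  rw [gwCondTruncProb, div_mul_eq_mul_div,
    measureReal_mul_eq_sum gwMeasure hmeas (autCard_pos (parentGraph p) x) hcard,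
    Finset.sum_congr rfl fun e _ => e.measureReal_event_inter_survives hp hr M,
    ← Finset.sum_mul, sum_labelling_prod_div_factorial hp hr hQ, mul_div_assoc]
  rfl

theorem tendsto_gwCondTruncProb_mul_autCard [Fintype W] (hp : IsParentMap p x)
    (hr : ∀ w, depth p x w ≤ r) :
    Tendsto (fun N => gwCondTruncProb N r (parentGraph p) x * autCard (parentGraph p) x) atTop
      (𝓝 (Real.exp (-{w | depth p x w < r}.ncard) *
        (Fintype.card W - {w | depth p x w < r}.ncard))) := by
  classical
  rw [← tendsto_add_atTop_iff_nat r, ← card_depth_eq hr]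
  refine ((tendsto_one_sub_pow_div_survProb r _).const_mul _).congr fun M => ?_
  rw [add_comm M r, gwCondTruncProb_mul_autCard hp hr]

end ConditionedTree

end Laws

end UST

end

/-- Let `G n` be a Gino-regular sequence of finite connected graphs (self-edges and parallel edges
allowed) whose numbers of vertices tend to infinity, and let `v n` be a vertex of `G n`. For every
`r` and every finite rooted tree `(t, x)` of height at most `r`, the probability that the
`r`-truncation at `v n` of a uniform spanning tree of `G n` is `(t, x)` converges to the
probability that the `r`-truncation of `𝒫₁` is `(t, x)`; here `𝒫₁`, the infinite line with
independent Poisson(1) Galton–Watson trees attached, is the limit of the Poisson(1) Galton–Watson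
tree conditioned to survive for `N` generations. -/
theorem mainTheorem5 {α β : ℕ → Type*} (G : ∀ n, Graph (α n) (β n))
    (hV : ∀ n, (G n).vertexSet.Finite) (hE : ∀ n, (G n).edgeSet.Finite)
    (hconn : ∀ n, UST.IsConnected (G n))
    (hsize : Tendsto (fun n => (G n).vertexSet.ncard) atTop atTop)
    (hG : UST.IsGinoRegular G) (v : ∀ n, (G n).vertexSet)
    (r : ℕ) {W : Type*} [Finite W] (t : SimpleGraph W) (x : W)
    (ht : t.IsTree) (hheight : ∀ w, t.dist x w ≤ r) :
    Tendsto (fun n => UST.ustTruncProb (G n) (v n) r t x) atTop (𝓝 (UST.p1TruncProb r t x)) ∧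
    Tendsto (fun N => UST.gwCondTruncProb N r t x) atTop (𝓝 (UST.p1TruncProb r t x)) := by
  have := Fintype.ofFinite W
  obtain ⟨p, hp, rfl⟩ := UST.exists_eq_parentGraph ht x
  have haut : (UST.autCard (UST.parentGraph p) x : ℝ) ≠ 0 :=
    Nat.cast_ne_zero.2 (UST.autCard_pos _ x).ne'
  have hust := UST.tendsto_ustTruncProb_mul_autCard hV hE hconn hsize hG v hp hheight
  have hgw := UST.tendsto_gwCondTruncProb_mul_autCard hp hheight
  rw [← UST.p1TruncProb_mul_autCard hp hheight] at hust hgw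
  constructor
  · simpa only [mul_div_cancel_right₀ _ haut] using
      hust.div_const (UST.autCard (UST.parentGraph p) x : ℝ)
  · simpa only [mul_div_cancel_right₀ _ haut] using
      hgw.div_const (UST.autCard (UST.parentGraph p) x : ℝ)
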